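/- **Setting.** Let $d\ge 1$, $0<\alpha\le 1$, $c>0$, $E=[0,1]^d$ with Lebesgue measure $\nu$, and let $f:E\to(0,\infty)$ be $\alpha$-Lipschitz, i.e. $|f(x)-f(y)|\le L\|x-y\|^\alpha$ on $E$ for some constant $L$. For each $n\ge 1$ let $N_n$ be a Poisson point process on $E\times\mathbb R$ with intensity $nc\,(\nu\otimes\lambda)\mathbf 1_S$, where $\lambda$ is Lebesgue measure and $S=\{(x,y): x\in E,\ 0\le y\le f(x)\}$. Let $\{I_{n,r}:1\le r\le k_n\}$ be a partition of $E$ into products of $d$ intervals of length $k_n^{-1/d}$, and put $D_{n,r}=\{(x,y): x\in I_{n,r},\ 0\le y\le f(x)\}$ and $N_{n,r}=N_n(D_{n,r})$. Let $Y^*_{n,r}$ be the largest second coordinate of the points of the process in $D_{n,r}$ if $N_{n,r}\ne 0$, and $Y^*_{n,r}=0$ otherwise. Let $K^{PR}:\mathbb R^d\to[0,\infty)$ be Lipschitz and compactly supported with $\int K^{PR}=1$, let $h_n>0$ with $h_n\to0$, and set $K_n(x,t)=h_n^{-d}K^{PR}((x-t)/h_n)$ and $$\widehat f_n(x)=\sum_{r=1}^{k_n}\Big(\int_{I_{n,r}}K_n(x,t)\,dt\Big)\Big(1+\frac1{N_{n,r}}\Big)Y^*_{n,r},$$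 a cell with $N_{n,r}=0$ contributing $0$. **(a)** Assume (i) $n^{-1}k_n\log n\to0$, (ii) $h_n^dk_n\to\infty$ and (iii) $nk_n^{-1/2}h_n^{\alpha+d/2}\to0$. Then for all pairwise distinct points $x_1,\dots,x_p\in(0,1)^d$, $$\{v_nc\,(\widehat f_n(x_j)-f(x_j)):1\le j\le p\}\to N\big(0,\|K^{PR}\|_2^2I_p\big)\quad\text{in distribution},\qquad v_n=nh_n^{d/2}k_n^{-1/2}.$$ **(b)** Let $h_n=n^{-1/(\alpha+d)}$ and $k_n=n^{d/(\alpha+d)}u_n^2$ with $u_n>0$, $u_n\to\infty$ slowly enough that $u_n^2\,n^{-\alpha/(\alpha+d)}\log n\to0$. Then $h_n\to0$, (i), (ii) and (iii) hold and $v_n=n^{\alpha/(\alpha+d)}u_n^{-1}$, so that the convergence in (a) holds with this normalization whenever there are partitions with these numbers $k_n$ of cells. Moreover $u_n$ can tend to infinity arbitrarily slowly: for every sequence $a_n\to\infty$ there are such a sequence $u_n$ with $u_n\le a_n$ for all large $n$, and partitions of $E$ as above with exactly $k_n=n^{d/(\alpha+d)}u_n^2$ cells, $k_n$ nondecreasing.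 -/

import Mathlib

open MeasureTheory ProbabilityTheory Filter Topology
open scoped NNReal ENNReal

noncomputable section

/-- The unit cube `[0,1]^d` in Euclidean space. -/
def unitCube (d : ℕ) : Set (EuclideanSpace ℝ (Fin d)) :=
  {x | ∀ i, x i ∈ Set.Icc (0 : ℝ) 1}

/-- The part of the hypograph of `f` that lies above `A`:
all `(x, y)` with `x ∈ A` and `0 ≤ y ≤ f x`. -/
def hypographOver {E : Type*} (A : Set E) (f : E → ℝ) : Set (E × ℝ) :=
  {z | z.1 ∈ A ∧ 0 ≤ z.2 ∧ z.2 ≤ f z.1}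

open Classical in
/-- The number of points, with multiplicity, of the finite configuration `Z` lying in `D`. -/
def pointCount {E : Type*} (Z : Multiset E) (D : Set E) : ℕ :=
  Z.countP (fun z => z ∈ D)

/-- A random finite point configuration `N` is a Poisson point process with intensity measure `μ`:
counts of measurable sets are random variables, `N(D)` has the Poisson law of mean `μ D` whenever
`μ D` is finite, and the counts of pairwise disjoint measurable sets are independent. -/
structure IsPoissonPointProcess {Ω E : Type*} [MeasurableSpace Ω] [MeasurableSpace E]
    (P : Measure Ω) (N : Ω → Multiset E) (μ : Measure E) : Prop where
  measurable_count : ∀ D : Set E, MeasurableSet D → Measurable fun ω => pointCount (N ω) D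
  hasLaw_count : ∀ D : Set E, MeasurableSet D → μ D ≠ ∞ →
    HasLaw (fun ω => pointCount (N ω) D) (poissonMeasure (μ D).toNNReal) P
  indep_count : ∀ (m : ℕ) (D : Fin m → Set E), (∀ i, MeasurableSet (D i)) →
    Pairwise (fun i j => Disjoint (D i) (D j)) →
    iIndepFun (fun i ω => pointCount (N ω) (D i)) P

/-- The intensity `a (ν ⊗ λ) 1_S`, where `ν` is Lebesgue measure on `[0,1]^d`, `λ` is Lebesgue
measure on the line and `S` is the hypograph of `f` over `[0,1]^d`. -/
def hypographIntensity {d : ℕ} (a : ℝ) (f : EuclideanSpace ℝ (Fin d) → ℝ) :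
    Measure (EuclideanSpace ℝ (Fin d) × ℝ) :=
  ENNReal.ofReal a •
    ((volume.restrict (unitCube d)).prod (volume : Measure ℝ)).restrict
      (hypographOver (unitCube d) f)

/-- A partition of `[0,1]^d` into `k` cubes, each the product of `d` intervals
(with or without their endpoints) of length `k^{-1/d}`. -/
structure IsCubePartition (d k : ℕ) (I : Fin k → Set (EuclideanSpace ℝ (Fin d))) : Prop where
  cell : ∀ r, ∃ J : Fin d → Set ℝ,
    (∀ j, (J j).OrdConnected ∧ volume (J j) = ENNReal.ofReal ((k : ℝ) ^ (-(1 / (d : ℝ))))) ∧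
    I r = {x | ∀ j, x j ∈ J j}
  disjoint : Pairwise fun r s => Disjoint (I r) (I s)
  cover : ⋃ r, I r = unitCube d

/-- The largest ordinate of the points of `Z` lying in `D`, and `0` if there are none. -/
def maxOrdinate {E : Type*} (Z : Multiset (E × ℝ)) (D : Set (E × ℝ)) : ℝ :=
  sSup {y | ∃ x, (x, y) ∈ Z ∧ (x, y) ∈ D}

/-- The kernel estimate
`∑_r (∫_{I_r} κ(x,t) dt) (1 + 1/N_r) Y_r`, where `N_r` and `Y_r` are the number of points of `Z`
and the largest ordinate of such a point in the cell `{(t,y) : t ∈ I_r, 0 ≤ y ≤ f t}`.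
A cell without points has `Y_r = 0` and contributes `0`. -/
def kernelEstimate {d k : ℕ}
    (κ : EuclideanSpace ℝ (Fin d) → EuclideanSpace ℝ (Fin d) → ℝ)
    (I : Fin k → Set (EuclideanSpace ℝ (Fin d))) (f : EuclideanSpace ℝ (Fin d) → ℝ)
    (Z : Multiset (EuclideanSpace ℝ (Fin d) × ℝ)) (x : EuclideanSpace ℝ (Fin d)) : ℝ :=
  ∑ r, (∫ t in I r, κ x t) * (1 + 1 / (pointCount Z (hypographOver (I r) f) : ℝ)) *
    maxOrdinate Z (hypographOver (I r) f)

/-- Rescaled convolution kernel `h^{-d} K((x - t)/h)`. -/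
def rescaledKernel {d : ℕ} (K : EuclideanSpace ℝ (Fin d) → ℝ) (h : ℝ)
    (x t : EuclideanSpace ℝ (Fin d)) : ℝ :=
  1 / h ^ d * K ((1 / h) • (x - t))

/-- A compactly supported Lipschitz Parzen-Rosenblatt kernel: a nonnegative Lipschitz
probability density on `ℝ^d` with compact support. -/
structure IsLipschitzParzenKernel {d : ℕ} (K : EuclideanSpace ℝ (Fin d) → ℝ) : Prop where
  nonneg : ∀ u, 0 ≤ K u
  integral_eq_one : ∫ u, K u = 1
  lipschitz : ∃ L : ℝ≥0, LipschitzWith L K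
  compact_support : HasCompactSupport K

end

/-! Put `β = nc/k`, the mean number of points per unit height above a cell, and let `m r` be the
infimum of `f` over the cell `I r`. The flat cell `I r ×ˢ Set.Icc 0 (m r)` lies inside the hypograph
and carries a homogeneous Poisson process, so the law of its count `N'` and maximum `Y'` is
explicit. There `β(1 + 1/N')Y' - βm` splits as `(1 - β(m - Y')) + (βY'/N' - 1)`. The gap `β(m - Y')`
is a standard exponential variable truncated at `βm`, so the first term is nearly centred with
variance nearly 1. The second term has exponentially small mean and second moment of order `1/(βm)`:
the factor `1 + 1/N'` removes the bias of the maximum without adding variance in the limit.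

With `s = √(h^d k)` the normalization `v_n c` equals `β s`, and a linear combination of the errors
at the points `x j` becomes a sum over independent cells with weights `t r = ∑ j, θ j * s * w j r`,
where `w j r` is the kernel weight of cell `r` at `x j`. Three facts about these weights suffice: `∑
|t r|` is `O(s)`, `max |t r|` is `O(1/s)`, and `∑ t r ^ 2` tends to `‖K‖² ∑ θ j ^ 2`, because the
kernel windows at distinct points are eventually disjoint.

Characteristic functions are compared with explicit errors at each sample size
(`norm_integral_exp_kernelEstimate_sub_le`): the main sum by factorization and a third order
estimate (`norm_integral_exp_sum_gap_sub_le`), whose cubic error is `O(1/s)` by (ii); the count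
fluctuations in `L²` (`integral_abs_sum_fluctuation_le`), negligible by (i), which makes empty cells
rarer than any weight can compensate; the points between the flat cell and the graph in `L¹`
(`IsEnlargedCell.integrable_and_integral_abs_sub_le`), together with the deterministic Hölder bias
(`abs_sum_kernelWeight_mul_sInf_sub_le`), both negligible by (iii). Lévy's continuity theorem
concludes. The explicit choice is exponent arithmetic (`h^d k = u²`, and the quantity in (iii)
equals `1/u`), and grids of `m^d` cubes realize it. -/

/-! ### Counts and largest ordinates of finite configurations -/

section PointConfigurations

variable {E : Type*}

lemma pointCount_eq_zero_iff (Z : Multiset E) (D : Set E) :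
    pointCount Z D = 0 ↔ ∀ z ∈ Z, z ∉ D := by
  classical
  unfold pointCount
  rw [Multiset.countP_eq_zero]

lemma pointCount_union (Z : Multiset E) {A B : Set E} (h : Disjoint A B) :
    pointCount Z (A ∪ B) = pointCount Z A + pointCount Z B := by
  classical
  unfold pointCount
  induction Z using Multiset.induction_on with
  | empty => simp
  | cons z Z ih =>
    rw [Multiset.countP_cons, Multiset.countP_cons, Multiset.countP_cons, ih]
    by_cases hA : z ∈ A
    · have hB : z ∉ B := Set.disjoint_left.mp h hA
      simp [hA, hB]; ring
    · by_cases hB : z ∈ B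
      · simp [hA, hB]; ring
      · simp [hA, hB]

@[simp] lemma pointCount_empty (Z : Multiset E) : pointCount Z ∅ = 0 := by
  simp [pointCount_eq_zero_iff]

lemma finite_ordinates (Z : Multiset (E × ℝ)) (D : Set (E × ℝ)) :
    {y | ∃ x, (x, y) ∈ Z ∧ (x, y) ∈ D}.Finite := by
  classical
  refine ((Z.toFinset.image Prod.snd).finite_toSet).subset ?_
  rintro y ⟨x, hx, -⟩
  simp only [Finset.coe_image, Set.mem_image, Finset.mem_coe, Multiset.mem_toFinset]
  exact ⟨_, hx, rfl⟩

lemma le_maxOrdinate {Z : Multiset (E × ℝ)} {D : Set (E × ℝ)} {z : E × ℝ} (hz : z ∈ Z)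
    (hD : z ∈ D) : z.2 ≤ maxOrdinate Z D :=
  le_csSup (finite_ordinates Z D).bddAbove ⟨z.1, hz, hD⟩

lemma maxOrdinate_nonneg (Z : Multiset (E × ℝ)) {D : Set (E × ℝ)} (hD : ∀ z ∈ D, 0 ≤ z.2) :
    0 ≤ maxOrdinate Z D :=
  Real.sSup_nonneg fun _ ⟨_, _, h⟩ => hD _ h

/-- A bound on the maximum is a void event, so every law of a maximum reduces to Poisson counts.
Nonnegativity of `y` is needed because an empty configuration has maximum `sSup ∅ = 0`. -/
lemma maxOrdinate_le_iff (Z : Multiset (E × ℝ)) (D : Set (E × ℝ)) {y : ℝ} (hy : 0 ≤ y) :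
    maxOrdinate Z D ≤ y ↔ pointCount Z (D ∩ {z | y < z.2}) = 0 := by
  rw [pointCount_eq_zero_iff]
  constructor
  · intro h z hz hzD
    exact absurd ((le_maxOrdinate hz hzD.1).trans h) (not_le.mpr hzD.2)
  · intro h
    refine Real.sSup_le ?_ hy
    rintro s ⟨x, hx, hxD⟩
    by_contra hs
    exact h _ hx ⟨hxD, not_le.mp hs⟩

lemma maxOrdinate_le (Z : Multiset (E × ℝ)) {D : Set (E × ℝ)} {y : ℝ} (hy : 0 ≤ y)
    (hD : ∀ z ∈ D, z.2 ≤ y) : maxOrdinate Z D ≤ y :=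
  Real.sSup_le (fun _ ⟨_, _, h⟩ => hD _ h) hy

lemma maxOrdinate_union_of_pointCount_eq_zero {Z : Multiset (E × ℝ)} {A B : Set (E × ℝ)}
    (h : pointCount Z B = 0) : maxOrdinate Z (A ∪ B) = maxOrdinate Z A := by
  rw [pointCount_eq_zero_iff] at h
  unfold maxOrdinate
  congr 1
  ext y
  constructor
  · rintro ⟨x, hx, hA | hB⟩
    · exact ⟨x, hx, hA⟩
    · exact absurd hB (h _ hx)
  · rintro ⟨x, hx, hA⟩
    exact ⟨x, hx, Or.inl hA⟩

end PointConfigurations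

/-! ### Independence of counts and maxima over disjoint sets -/

section OrdinateIndependence

variable {Ω E : Type*} [MeasurableSpace E]

/-- The event that `D` contains `j` points, all with ordinate at most `y`, is described by the
counts of two disjoint subsets of `D`. -/
lemma exists_counts_of_ordinate_event (N : Ω → Multiset (E × ℝ)) {D : Set (E × ℝ)}
    (hD : MeasurableSet D) (h0 : ∀ z ∈ D, 0 ≤ z.2) (j : ℕ) (y : ℝ) :
    ∃ (A B : Set (E × ℝ)) (a b : ℕ), MeasurableSet A ∧ MeasurableSet B ∧ A ⊆ D ∧ B ⊆ D ∧
      Disjoint A B ∧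
      {ω | pointCount (N ω) D = j ∧ maxOrdinate (N ω) D ≤ y} =
        {ω | pointCount (N ω) A = a ∧ pointCount (N ω) B = b} := by
  by_cases hy : 0 ≤ y
  · have hm : MeasurableSet {z : E × ℝ | y < z.2} := measurableSet_lt measurable_const measurable_snd
    have hm' : MeasurableSet {z : E × ℝ | z.2 ≤ y} := measurableSet_le measurable_snd measurable_const
    have hdis : Disjoint (D ∩ {z | z.2 ≤ y}) (D ∩ {z | y < z.2}) := by
      rw [Set.disjoint_left]
      rintro z ⟨-, hz⟩ ⟨-, hz'⟩
      rw [Set.mem_ofPred_eq] at hz hz'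
      exact absurd hz (not_le.mpr hz')
    have hun : D = (D ∩ {z | z.2 ≤ y}) ∪ (D ∩ {z | y < z.2}) := by
      ext z
      simp only [Set.mem_union, Set.mem_inter_iff, Set.mem_ofPred_eq, ← and_or_left]
      simp [le_or_gt]
    refine ⟨_, _, j, 0, hD.inter hm', hD.inter hm, Set.inter_subset_left, Set.inter_subset_left,
      hdis, ?_⟩
    ext ω
    simp only [Set.mem_ofPred_eq]
    rw [maxOrdinate_le_iff _ _ hy]
    have := pointCount_union (N ω) hdis
    rw [← hun] at this
    constructor <;> rintro ⟨h1, h2⟩ <;> refine ⟨?_, h2⟩ <;> omega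
  -- For `y < 0` the event is impossible; it is encoded as the empty set containing one point.
  · refine ⟨∅, ∅, 1, 1, .empty, .empty, Set.empty_subset _, Set.empty_subset _,
      Set.disjoint_empty _, ?_⟩
    ext ω
    have := maxOrdinate_nonneg (N ω) h0
    simp only [Set.mem_ofPred_eq, pointCount_empty]
    constructor
    · rintro ⟨-, h⟩; linarith
    · rintro ⟨h, -⟩; omega

namespace IsPoissonPointProcess

variable [MeasurableSpace Ω] {P : Measure Ω} {N : Ω → Multiset (E × ℝ)} {μ : Measure (E × ℝ)}

lemma measurable_maxOrdinate (h : IsPoissonPointProcess P N μ) {D : Set (E × ℝ)}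
    (hD : MeasurableSet D) (h0 : ∀ z ∈ D, 0 ≤ z.2) :
    Measurable fun ω => maxOrdinate (N ω) D := by
  refine measurable_of_Iic fun y => ?_
  by_cases hy : 0 ≤ y
  · have : (fun ω => maxOrdinate (N ω) D) ⁻¹' Set.Iic y =
        (fun ω => pointCount (N ω) (D ∩ {z | y < z.2})) ⁻¹' {0} := by
      ext ω
      simp [maxOrdinate_le_iff _ _ hy]
    rw [this]
    exact h.measurable_count _ (hD.inter (measurableSet_lt measurable_const measurable_snd))
      (measurableSet_singleton 0)
  · have : (fun ω => maxOrdinate (N ω) D) ⁻¹' Set.Iic y = ∅ := by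
      ext ω
      have := maxOrdinate_nonneg (N ω) h0
      simp only [Set.mem_preimage, Set.mem_Iic, Set.mem_empty_iff_false, iff_false]
      linarith
    rw [this]
    exact .empty

/-- Over disjoint sets, the pairs (number of points, largest ordinate) are independent. -/
lemma iIndepFun_count_maxOrdinate (h : IsPoissonPointProcess P N μ) {m : ℕ}
    (D : Fin m → Set (E × ℝ)) (hD : ∀ i, MeasurableSet (D i)) (h0 : ∀ i, ∀ z ∈ D i, 0 ≤ z.2)
    (hdis : Pairwise fun i j => Disjoint (D i) (D j)) :
    iIndepFun (fun i ω => (pointCount (N ω) (D i), maxOrdinate (N ω) (D i))) P := by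
  -- Independence is checked on the π-system of the sets `{j} ×ˢ Set.Iic y`, whose preimages are the
  -- events described by two counts.
  set C : Set (Set (ℕ × ℝ)) := Set.image2 (· ×ˢ ·) (Set.range fun j : ℕ => ({j} : Set ℕ))
    (Set.range (Set.Iic : ℝ → Set ℝ)) with hC
  have hgen : (Prod.instMeasurableSpace : MeasurableSpace (ℕ × ℝ)) =
      MeasurableSpace.generateFrom C := by
    have e1 : (inferInstance : MeasurableSpace ℕ) =
        MeasurableSpace.generateFrom (Set.range fun j : ℕ => ({j} : Set ℕ)) := by
      refine le_antisymm (fun s _ => ?_) le_top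
      rw [← Set.biUnion_of_singleton s]
      exact MeasurableSet.biUnion (Set.to_countable s)
        fun j _ => MeasurableSpace.measurableSet_generateFrom ⟨j, rfl⟩
    have e2 : (inferInstance : MeasurableSpace ℝ) =
        MeasurableSpace.generateFrom (Set.range (Set.Iic : ℝ → Set ℝ)) :=
      (BorelSpace.measurable_eq).trans (borel_eq_generateFrom_Iic ℝ)
    have s1 : IsCountablySpanning (Set.range fun j : ℕ => ({j} : Set ℕ)) :=
      ⟨fun j => {j}, fun j => ⟨j, rfl⟩, by ext; simp⟩
    have s2 : IsCountablySpanning (Set.range (Set.Iic : ℝ → Set ℝ)) :=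
      ⟨fun j : ℕ => Set.Iic (j : ℝ), fun j => ⟨j, rfl⟩, by
        ext x
        simpa using exists_nat_ge x⟩
    have := generateFrom_prod_eq s1 s2
    rw [← e1, ← e2] at this
    exact this
  have hpi : IsPiSystem C := by
    refine IsPiSystem.prod ?_ ?_
    · rintro _ ⟨i, rfl⟩ _ ⟨j, rfl⟩ hij
      obtain ⟨x, hx, hx'⟩ := hij
      simp only [Set.mem_singleton_iff] at hx hx'
      exact ⟨i, by simp [← hx, ← hx']⟩
    · exact isPiSystem_Iic
  have hcount : ∀ i, Measurable fun ω => pointCount (N ω) (D i) :=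
    fun i => h.measurable_count _ (hD i)
  have hmax : ∀ i, Measurable fun ω => maxOrdinate (N ω) (D i) :=
    fun i => h.measurable_maxOrdinate (hD i) (h0 i)
  set X : Fin m → Ω → ℕ × ℝ :=
    fun i ω => (pointCount (N ω) (D i), maxOrdinate (N ω) (D i)) with hX
  have hXm : ∀ i, Measurable (X i) := fun i => (hcount i).prodMk (hmax i)
  rw [iIndepFun_iff_iIndep]
  refine iIndepSets.iIndep (fun i => (hXm i).comap_le) (fun i => {s | ∃ t ∈ C, X i ⁻¹' t = s})
    (fun i => hpi.comap _) (fun i => ?_) ?_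
  · rw [hgen, MeasurableSpace.comap_generateFrom]
    rfl
  rw [iIndepSets_iff]
  intro S g hg
  have hev : ∀ i ∈ S, ∃ (A B : Set (E × ℝ)) (a b : ℕ), MeasurableSet A ∧ MeasurableSet B ∧
      A ⊆ D i ∧ B ⊆ D i ∧ Disjoint A B ∧
      g i = {ω | pointCount (N ω) A = a ∧ pointCount (N ω) B = b} := by
    intro i hi
    obtain ⟨t, ⟨_, ⟨j, rfl⟩, _, ⟨y, rfl⟩, rfl⟩, ht⟩ := hg i hi
    obtain ⟨A, B, a, b, hA, hB, hAD, hBD, hAB, hEq⟩ :=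
      exists_counts_of_ordinate_event N (hD i) (h0 i) j y
    refine ⟨A, B, a, b, hA, hB, hAD, hBD, hAB, ?_⟩
    rw [← hEq, ← ht]
    ext ω
    simp [hX]
  have hev' : ∀ i, ∃ (A B : Set (E × ℝ)) (a b : ℕ), MeasurableSet A ∧ MeasurableSet B ∧
      A ⊆ D i ∧ B ⊆ D i ∧ Disjoint A B ∧
      (i ∈ S → g i = {ω | pointCount (N ω) A = a ∧ pointCount (N ω) B = b}) := by
    intro i
    by_cases hi : i ∈ S
    · obtain ⟨A, B, a, b, hA, hB, hAD, hBD, hAB, hEq⟩ := hev i hi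
      exact ⟨A, B, a, b, hA, hB, hAD, hBD, hAB, fun _ => hEq⟩
    · exact ⟨∅, ∅, 0, 0, .empty, .empty, Set.empty_subset _, Set.empty_subset _,
        Set.disjoint_empty _, fun h => absurd h hi⟩
  choose A B a b hA hB hAD hBD hAB hEq using hev'
  -- The two subsets `A i`, `B i` of each `D i` form one disjoint family indexed by `Fin m ⊕ Fin m`,
  -- so independence of `2m` counts applies.
  have hind := h.indep_count (m + m) (fun i => Sum.elim A B (finSumFinEquiv.symm i))
    (fun i => by rcases finSumFinEquiv.symm i with j | j <;> simp [hA, hB])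
    (by
      intro i j hij
      have hij' : finSumFinEquiv.symm i ≠ finSumFinEquiv.symm j := by simpa using hij
      rcases hi : finSumFinEquiv.symm i with i' | i' <;>
      rcases hj : finSumFinEquiv.symm j with j' | j' <;>
      simp only [hi, hj, Sum.elim_inl, Sum.elim_inr] at hij' ⊢
      · exact (hdis (by simpa using hij')).mono (hAD _) (hAD _)
      · by_cases e : i' = j'
        · subst e; exact hAB _
        · exact (hdis e).mono (hAD _) (hBD _)
      · by_cases e : i' = j'
        · subst e; exact (hAB _).symm
        · exact (hdis e).mono (hBD _) (hAD _)
      · exact (hdis (by simpa using hij')).mono (hBD _) (hBD _))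
  have hind' := hind.precomp finSumFinEquiv.injective
  simp only [Equiv.symm_apply_apply] at hind'
  -- An arbitrary `T` is allowed so that both the joint probability (`T = S`) and each factor (`T =
  -- {i}`) come from the same identity.
  have key : ∀ T : Finset (Fin m),
      P (⋂ i ∈ T, {ω | pointCount (N ω) (A i) = a i ∧ pointCount (N ω) (B i) = b i}) =
        ∏ i ∈ T, P {ω | pointCount (N ω) (A i) = a i} * P {ω | pointCount (N ω) (B i) = b i} := by
    intro T
    have := hind'.measure_inter_preimage_eq_mul (T.disjSum T)
      (sets := fun i => {Sum.elim a b i}) (fun _ _ => measurableSet_singleton _)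
    rw [Finset.prod_disjSum] at this
    simp only [Sum.elim_inl, Sum.elim_inr] at this
    rw [Finset.prod_mul_distrib]
    refine Eq.trans ?_ this
    congr 1
    ext ω
    simp only [Set.mem_iInter, Set.mem_ofPred_eq, Set.mem_preimage, Set.mem_singleton_iff]
    constructor
    · intro H i hi
      rcases i with i | i
      · exact (H i (by simpa using hi)).1
      · exact (H i (by simpa using hi)).2
    · intro H i hi
      exact ⟨H (Sum.inl i) (by simpa using hi), H (Sum.inr i) (by simpa using hi)⟩
  have hS : (⋂ i ∈ S, g i) =
      ⋂ i ∈ S, {ω | pointCount (N ω) (A i) = a i ∧ pointCount (N ω) (B i) = b i} :=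
    Set.iInter₂_congr fun i hi => hEq i hi
  rw [hS, key]
  refine Finset.prod_congr rfl fun i hi => ?_
  have := key {i}
  simp only [Finset.mem_singleton, Set.iInter_iInter_eq_left, Finset.prod_singleton] at this
  rw [hEq i hi, this]

lemma measure_count_eq (h : IsPoissonPointProcess P N μ) {D : Set (E × ℝ)}
    (hD : MeasurableSet D) {r : ℝ} (hr : 0 ≤ r) (hμ : μ D = ENNReal.ofReal r) (j : ℕ) :
    P.real {ω | pointCount (N ω) D = j} = Real.exp (-r) * r ^ j / j.factorial := by
  have hl := h.hasLaw_count D hD (by simp [hμ])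
  have := poissonMeasure_real_singleton (μ D).toNNReal j
  rw [← hl.map_eq, map_measureReal_apply (h.measurable_count D hD)
    (measurableSet_singleton j)] at this
  have hr' : (((μ D).toNNReal : ℝ≥0) : ℝ) = r := by
    rw [hμ]
    exact ENNReal.toReal_ofReal hr
  rw [hr'] at this
  rw [← this]
  rfl

/-- This is `1 - exp (-x) ≤ x`; it bounds the probability of having any point between a flat cell
and the graph. -/
lemma measure_count_pos_le [IsProbabilityMeasure P] (h : IsPoissonPointProcess P N μ)
    {D : Set (E × ℝ)} (hD : MeasurableSet D) {r : ℝ} (hr : 0 ≤ r) (hμ : μ D ≤ ENNReal.ofReal r) :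
    P.real {ω | pointCount (N ω) D ≠ 0} ≤ r := by
  have hfin : μ D ≠ ∞ := ne_top_of_le_ne_top ENNReal.ofReal_ne_top hμ
  have h1 := h.measure_count_eq hD ENNReal.toReal_nonneg (ENNReal.ofReal_toReal hfin).symm 0
  have h2 : {ω | pointCount (N ω) D ≠ 0} = {ω | pointCount (N ω) D = 0}ᶜ := rfl
  have hm : MeasurableSet {ω | pointCount (N ω) D = 0} :=
    h.measurable_count D hD (measurableSet_singleton 0)
  rw [h2, probReal_compl_eq_one_sub hm, h1]
  have h3 : (μ D).toReal ≤ r := ENNReal.toReal_le_of_le_ofReal hr hμ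
  have h4 := Real.add_one_le_exp (-(μ D).toReal)
  simp only [pow_zero, mul_one, Nat.factorial_zero, Nat.cast_one, div_one]
  linarith

/-- Counts of two disjoint measurable sets are independent. -/
lemma measure_count_inter_count (h : IsPoissonPointProcess P N μ) {A B : Set (E × ℝ)}
    (hA : MeasurableSet A) (hB : MeasurableSet B) (hAB : Disjoint A B) (a b : ℕ) :
    P.real {ω | pointCount (N ω) A = a ∧ pointCount (N ω) B = b} =
      P.real {ω | pointCount (N ω) A = a} * P.real {ω | pointCount (N ω) B = b} := by
  have hi := h.indep_count 2 ![A, B] (fun i => by fin_cases i <;> simp [hA, hB])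
    (fun i j hij => by
      fin_cases i <;> fin_cases j <;> simp [hAB, hAB.symm] at hij ⊢)
  have h2 := hi.indepFun (i := 0) (j := 1) (by decide)
  have h3 := h2.measure_inter_preimage_eq_mul {a} {b} (measurableSet_singleton _)
    (measurableSet_singleton _)
  simp only [Matrix.cons_val_zero, Matrix.cons_val_one] at h3
  rw [measureReal_def, measureReal_def, measureReal_def, ← ENNReal.toReal_mul]
  exact congrArg ENNReal.toReal h3

end IsPoissonPointProcess
end OrdinateIndependence

/-! ### The flat cell: joint law of count and maximum -/

/-- `N` and `Y` are distributed like the number of points and the largest ordinate of a homogeneous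
Poisson process on a strip of height `m`, with `β` points per unit of height on average. -/
structure IsUniformCell {Ω : Type*} [MeasurableSpace Ω] (P : Measure Ω) (N : Ω → ℕ) (Y : Ω → ℝ)
    (β m : ℝ) : Prop where
  rate_pos : 0 < β
  height_pos : 0 < m
  measurable_count : Measurable N
  measurable_max : Measurable Y
  max_nonneg : ∀ ω, 0 ≤ Y ω
  max_le : ∀ ω, Y ω ≤ m
  measure_count_max : ∀ (j : ℕ) (y : ℝ), 0 ≤ y → y ≤ m →
    P.real {ω | N ω = j ∧ Y ω ≤ y} = Real.exp (-(β * m)) * (β * y) ^ j / j.factorial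
  measure_max : ∀ y : ℝ, 0 ≤ y → y ≤ m → P.real {ω | Y ω ≤ y} = Real.exp (-(β * (m - y)))

/-- Having `j` points, none above `y`, means `j` points in the lower slab and none in the upper one.
The slabs are disjoint, so the probability is a product, and the two exponentials merge into `exp
(-(β * m))`. -/
lemma IsPoissonPointProcess.isUniformCell {Ω E : Type*} [MeasurableSpace Ω] [MeasurableSpace E]
    {P : Measure Ω} {N : Ω → Multiset (E × ℝ)} {μ : Measure (E × ℝ)}
    (h : IsPoissonPointProcess P N μ) {I : Set E} (hI : MeasurableSet I) {β m : ℝ} (hβ : 0 < β)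
    (hm : 0 < m) (hlow : ∀ y, 0 ≤ y → y ≤ m → μ (I ×ˢ Set.Icc 0 y) = ENNReal.ofReal (β * y))
    (hup : ∀ y, 0 ≤ y → y ≤ m → μ (I ×ˢ Set.Ioc y m) = ENNReal.ofReal (β * (m - y))) :
    IsUniformCell P (fun ω => pointCount (N ω) (I ×ˢ Set.Icc 0 m))
      (fun ω => maxOrdinate (N ω) (I ×ˢ Set.Icc 0 m)) β m := by
  have hD : MeasurableSet (I ×ˢ Set.Icc (0 : ℝ) m) := hI.prod measurableSet_Icc
  have hinter : ∀ y, 0 ≤ y →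
      (I ×ˢ Set.Icc (0 : ℝ) m) ∩ {z | y < z.2} = I ×ˢ Set.Ioc y m := by
    intro y hy
    ext z
    simp only [Set.mem_inter_iff, Set.mem_prod, Set.mem_Icc, Set.mem_ofPred_eq, Set.mem_Ioc]
    constructor
    · rintro ⟨⟨h1, h2, h3⟩, h4⟩; exact ⟨h1, h4, h3⟩
    · rintro ⟨h1, h4, h3⟩; exact ⟨⟨h1, by linarith, h3⟩, h4⟩
  have h0 : ∀ z ∈ (I ×ˢ Set.Icc (0 : ℝ) m), 0 ≤ z.2 := fun z hz => hz.2.1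
  have hmax : ∀ y, 0 ≤ y → y ≤ m → P.real {ω | pointCount (N ω) (I ×ˢ Set.Ioc y m) = 0} =
      Real.exp (-(β * (m - y))) := by
    intro y hy hym
    rw [h.measure_count_eq (hI.prod measurableSet_Ioc)
      (mul_nonneg hβ.le (sub_nonneg.mpr hym)) (hup y hy hym)]
    simp
  refine ⟨hβ, hm, h.measurable_count _ hD, h.measurable_maxOrdinate hD h0,
    fun ω => maxOrdinate_nonneg _ h0, fun ω => maxOrdinate_le _ hm.le fun z hz => hz.2.2, ?_, ?_⟩
  · intro j y hy hym
    have hdis : Disjoint (I ×ˢ Set.Icc (0 : ℝ) y) (I ×ˢ Set.Ioc y m) := by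
      rw [Set.disjoint_left]
      rintro z ⟨-, hz⟩ ⟨-, hz'⟩
      exact absurd hz.2 (not_le.mpr hz'.1)
    have hun : I ×ˢ Set.Icc (0 : ℝ) m = I ×ˢ Set.Icc (0 : ℝ) y ∪ I ×ˢ Set.Ioc y m := by
      rw [← Set.prod_union, Set.Icc_union_Ioc_eq_Icc hy hym]
    have hset : {ω | pointCount (N ω) (I ×ˢ Set.Icc 0 m) = j ∧
        maxOrdinate (N ω) (I ×ˢ Set.Icc 0 m) ≤ y} =
        {ω | pointCount (N ω) (I ×ˢ Set.Icc 0 y) = j ∧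
          pointCount (N ω) (I ×ˢ Set.Ioc y m) = 0} := by
      ext ω
      simp only [Set.mem_ofPred_eq]
      rw [maxOrdinate_le_iff _ _ hy, hinter y hy]
      have := pointCount_union (N ω) hdis
      rw [← hun] at this
      constructor <;> rintro ⟨h1, h2⟩ <;> refine ⟨?_, h2⟩ <;> omega
    rw [hset, h.measure_count_inter_count (hI.prod measurableSet_Icc) (hI.prod measurableSet_Ioc)
      hdis, hmax y hy hym, h.measure_count_eq (hI.prod measurableSet_Icc)
      (mul_nonneg hβ.le hy) (hlow y hy hym)]
    have : Real.exp (-(β * m)) = Real.exp (-(β * y)) * Real.exp (-(β * (m - y))) := by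
      rw [← Real.exp_add]; ring_nf
    rw [this]
    ring
  · intro y hy hym
    rw [← hmax y hy hym]
    congr 1
    ext ω
    simp only [Set.mem_ofPred_eq]
    rw [maxOrdinate_le_iff _ _ hy, hinter y hy]

/-! ### Layer cake formula -/

section LayerCake

/-- Layer cake formula for a bounded random variable and a continuous derivative `g`. -/
lemma integral_intervalIntegral_eq {Ω F : Type*} [MeasurableSpace Ω] [NormedAddCommGroup F]
    [NormedSpace ℝ F] [CompleteSpace F] {ν : Measure Ω} [IsFiniteMeasure ν]
    {Y : Ω → ℝ} (hY : Measurable Y) {m : ℝ} (h0 : ∀ ω, 0 ≤ Y ω) (hm : ∀ ω, Y ω ≤ m)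
    {g : ℝ → F} (hg : Continuous g) :
    ∫ ω, (∫ y in (0 : ℝ)..Y ω, g y) ∂ν = ∫ y in Set.Ioc 0 m, ν.real {ω | y < Y ω} • g y := by
  set S : Set (Ω × ℝ) := {z | z.2 < Y z.1} with hS
  have hSm : MeasurableSet S := measurableSet_lt measurable_snd (hY.comp measurable_fst)
  have hgi : IntegrableOn g (Set.Ioc 0 m) := (hg.integrableOn_Icc).mono_set Set.Ioc_subset_Icc_self
  have hint : Integrable (S.indicator fun z => g z.2) (ν.prod (volume.restrict (Set.Ioc 0 m))) :=
    (hgi.integrable.comp_snd ν).indicator hSm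
  have h1 : ∀ ω, (∫ y in (0 : ℝ)..Y ω, g y) =
      ∫ y in Set.Ioc 0 m, S.indicator (fun z => g z.2) (ω, y) := by
    intro ω
    have e : (fun y => S.indicator (fun z => g z.2) (ω, y)) = (Set.Iio (Y ω)).indicator g := by
      ext y
      by_cases hy : y < Y ω
      · rw [Set.indicator_of_mem (show (ω, y) ∈ S from hy),
          Set.indicator_of_mem (show y ∈ Set.Iio (Y ω) from hy)]
      · rw [Set.indicator_of_notMem (show (ω, y) ∉ S from hy),
          Set.indicator_of_notMem (show y ∉ Set.Iio (Y ω) from hy)]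
    rw [e, setIntegral_indicator measurableSet_Iio, intervalIntegral.integral_of_le (h0 ω),
      integral_Ioc_eq_integral_Ioo]
    have : Set.Ioc 0 m ∩ Set.Iio (Y ω) = Set.Ioo 0 (Y ω) := by
      ext y
      simp only [Set.mem_inter_iff, Set.mem_Ioc, Set.mem_Iio, Set.mem_Ioo]
      have := hm ω
      constructor
      · rintro ⟨⟨a, b⟩, c⟩; exact ⟨a, c⟩
      · rintro ⟨a, c⟩; exact ⟨⟨a, by linarith⟩, c⟩
    rw [this]
  simp_rw [h1]
  rw [integral_integral_swap (f := fun ω y => S.indicator (fun z => g z.2) (ω, y)) hint]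
  refine integral_congr_ae (Eventually.of_forall fun y => ?_)
  have e : (fun ω => S.indicator (fun z => g z.2) (ω, y)) =
      {ω | y < Y ω}.indicator fun _ => g y := by
    ext ω
    by_cases hy : y < Y ω
    · rw [Set.indicator_of_mem (show (ω, y) ∈ S from hy),
        Set.indicator_of_mem (show ω ∈ {ω | y < Y ω} from hy)]
    · rw [Set.indicator_of_notMem (show (ω, y) ∉ S from hy),
        Set.indicator_of_notMem (show ω ∉ {ω | y < Y ω} from hy)]
  simp only [e]
  rw [integral_indicator (measurableSet_lt measurable_const hY), setIntegral_const]

end LayerCake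

/-! ### Moments of the flat cell -/

namespace IsUniformCell

variable {Ω : Type*} [MeasurableSpace Ω] {P : Measure Ω}
  {N : Ω → ℕ} {Y : Ω → ℝ} {β m : ℝ}

/-- The Poisson weights of a cell. -/
lemma measure_count (h : IsUniformCell P N Y β m) (j : ℕ) :
    P.real {ω | N ω = j} = Real.exp (-(β * m)) * (β * m) ^ j / j.factorial := by
  rw [← h.measure_count_max j m h.height_pos.le le_rfl]
  congr 1
  ext ω
  simp [h.max_le ω]

/-- Given `N = j`, the maximum is that of `j` independent uniform variables on `[0, m]`, whose
`q`-th moment is `m ^ q * j / (j + q)`. The proof is the layer cake formula on the event `N = j`.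
Positivity of `q` makes the formula right at `j = 0`, where `Y` vanishes. -/
lemma setIntegral_max_pow [IsProbabilityMeasure P] (h : IsUniformCell P N Y β m) (j q : ℕ) (hq : 0 < q) :
    ∫ ω in {ω | N ω = j}, Y ω ^ q ∂P =
      m ^ q * (j / (j + q)) * (Real.exp (-(β * m)) * (β * m) ^ j / j.factorial) := by
  have hg : Continuous fun y : ℝ => (q : ℝ) * y ^ (q - 1) := by fun_prop
  have e1 : ∀ ω, Y ω ^ q = ∫ y in (0 : ℝ)..Y ω, (q : ℝ) * y ^ (q - 1) := by
    intro ω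
    rw [intervalIntegral.integral_const_mul, integral_pow]
    have : q - 1 + 1 = q := by omega
    rw [this]
    have hq' : (q : ℝ) ≠ 0 := by positivity
    have hc : ((q - 1 : ℕ) : ℝ) + 1 = q := by exact_mod_cast this
    rw [hc]
    simp [hq.ne']
    field_simp
  simp_rw [e1]
  rw [integral_intervalIntegral_eq h.measurable_max h.max_nonneg h.max_le hg]
  have hjm : MeasurableSet {ω | N ω = j} := h.measurable_count (measurableSet_singleton j)
  set p := Real.exp (-(β * m)) * β ^ j / j.factorial with hp
  have e2 : ∀ y ∈ Set.Ioc 0 m, (P.restrict {ω | N ω = j}).real {ω | y < Y ω} •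
      ((q : ℝ) * y ^ (q - 1)) = (p * m ^ j * q) * y ^ (q - 1) - (p * q) * y ^ (j + q - 1) := by
    intro y hy
    have hmeas : MeasurableSet {ω | y < Y ω} := measurableSet_lt measurable_const h.measurable_max
    rw [measureReal_restrict_apply hmeas]
    have hdiff : {ω | y < Y ω} ∩ {ω | N ω = j} = {ω | N ω = j} \ {ω | N ω = j ∧ Y ω ≤ y} := by
      ext ω
      simp only [Set.mem_inter_iff, Set.mem_ofPred_eq, Set.mem_sdiff, not_and, not_le]
      tauto
    have hjy : MeasurableSet {ω | N ω = j ∧ Y ω ≤ y} :=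
      hjm.inter (measurableSet_le h.measurable_max measurable_const)
    rw [hdiff, measureReal_sdiff (show {ω | N ω = j ∧ Y ω ≤ y} ⊆ {ω | N ω = j} from fun ω hω => hω.1) hjy, h.measure_count,
      h.measure_count_max j y hy.1.le hy.2]
    have : y ^ (j + q - 1) = y ^ j * y ^ (q - 1) := by
      rw [← pow_add]; congr 1; omega
    rw [this, hp, mul_pow, mul_pow, smul_eq_mul]
    ring
  rw [setIntegral_congr_fun measurableSet_Ioc e2, ← intervalIntegral.integral_of_le h.height_pos.le,
    intervalIntegral.integral_sub
      ((by fun_prop : Continuous fun y : ℝ => p * m ^ j * q * y ^ (q - 1)).intervalIntegrable _ _)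
      ((by fun_prop : Continuous fun y : ℝ => p * q * y ^ (j + q - 1)).intervalIntegrable _ _),
    intervalIntegral.integral_const_mul, intervalIntegral.integral_const_mul, integral_pow,
    integral_pow]
  have a1 : q - 1 + 1 = q := by omega
  have a2 : j + q - 1 + 1 = j + q := by omega
  have c1 : ((q - 1 : ℕ) : ℝ) + 1 = q := by exact_mod_cast a1
  have c2 : ((j + q - 1 : ℕ) : ℝ) + 1 = j + q := by exact_mod_cast a2
  have hjq : (0 : ℝ) < j + q := by positivity
  have hq' : (0 : ℝ) < q := by positivity
  rw [c1, c2, a1, a2, zero_pow hq.ne', zero_pow (by omega), hp, mul_pow, pow_add]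
  field_simp
  ring

/-- Conditioning on the count: expectations involving `1 / N` become series over the Poisson
weights. -/
lemma hasSum_integral_count_mul (h : IsUniformCell P N Y β m) (φ : ℕ → ℝ) {Z : Ω → ℝ}
    (hZ : Integrable (fun ω => φ (N ω) * Z ω) P) :
    HasSum (fun j => φ j * ∫ ω in {ω | N ω = j}, Z ω ∂P) (∫ ω, φ (N ω) * Z ω ∂P) := by
  have hmeas : ∀ j, MeasurableSet {ω | N ω = j} :=
    fun j => h.measurable_count (measurableSet_singleton j)
  have hun : (⋃ j, {ω | N ω = j}) = Set.univ := by ext ω; simp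
  have := hasSum_integral_iUnion (μ := P) (f := fun ω => φ (N ω) * Z ω) hmeas
    (fun i j hij => by
      simp only [Function.onFun]
      rw [Set.disjoint_left]
      rintro ω hi hj
      exact hij (hi.symm.trans hj))
    (by rw [hun]; exact hZ.integrableOn)
  rw [hun, setIntegral_univ] at this
  convert! this using 2 with j
  rw [← integral_const_mul]
  refine setIntegral_congr_fun (hmeas j) fun ω hω => ?_
  have : N ω = j := hω
  simp [this]

/-- The count is either `0`, where the quotient is `0` by convention, or at least `1`; this
boundedness supplies all integrability. -/
lemma abs_rate_mul_max_div_count_le (h : IsUniformCell P N Y β m) (ω : Ω) :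
    |β * Y ω / N ω| ≤ β * m := by
  have h0 := h.max_nonneg ω
  have h1 := h.max_le ω
  have hβ := h.rate_pos
  rcases Nat.eq_zero_or_pos (N ω) with hN | hN
  · have := h.height_pos
    simp [hN]; positivity
  · have : (1 : ℝ) ≤ N ω := by exact_mod_cast hN
    rw [abs_of_nonneg (by positivity)]
    refine (div_le_self (by positivity) this).trans ?_
    gcongr

variable [IsProbabilityMeasure P]

lemma integrable_max_div_count (h : IsUniformCell P N Y β m) :
    Integrable (fun ω => β * Y ω / N ω) P := by
  have := h.measurable_count
  have := h.measurable_max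
  refine Integrable.of_bound (C := β * m)
    (Measurable.aestronglyMeasurable (by fun_prop)) ?_
  exact Eventually.of_forall fun ω => h.abs_rate_mul_max_div_count_le ω

lemma integrable_max_div_count_sq (h : IsUniformCell P N Y β m) :
    Integrable (fun ω => (β * Y ω / N ω) ^ 2) P := by
  have := h.measurable_count
  have := h.measurable_max
  refine Integrable.of_bound (C := (β * m) ^ 2)
    (Measurable.aestronglyMeasurable (by fun_prop)) ?_
  refine Eventually.of_forall fun ω => ?_
  rw [norm_pow]
  exact pow_le_pow_left₀ (norm_nonneg _) (h.abs_rate_mul_max_div_count_le ω) 2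

end IsUniformCell

/-- The Poisson weight `e^{-a} a ^ j / j!`. -/
noncomputable def poissonWeight (a : ℝ) (j : ℕ) : ℝ := Real.exp (-a) * a ^ j / j.factorial

lemma poissonWeight_nonneg {a : ℝ} (ha : 0 ≤ a) (j : ℕ) : 0 ≤ poissonWeight a j := by
  unfold poissonWeight; positivity

lemma poissonWeight_succ (a : ℝ) (j : ℕ) :
    poissonWeight a (j + 1) = a / (j + 1) * poissonWeight a j := by
  unfold poissonWeight
  rw [Nat.factorial_succ, pow_succ]
  have : (j.factorial : ℝ) ≠ 0 := by positivity
  have : (j : ℝ) + 1 ≠ 0 := by positivity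
  push_cast
  field_simp

lemma hasSum_poissonWeight {a : ℝ} (ha : 0 ≤ a) : HasSum (poissonWeight a) 1 :=
  hasSum_one_poissonMeasure ⟨a, ha⟩

lemma hasSum_poissonWeight_add_two {a : ℝ} (ha : 0 ≤ a) :
    HasSum (fun j => poissonWeight a (j + 2)) (1 - (1 + a) * Real.exp (-a)) := by
  have := (hasSum_nat_add_iff' 2).mpr (hasSum_poissonWeight ha)
  convert this using 1
  · rfl
  · simp only [Finset.sum_range_succ, poissonWeight, Finset.range_zero, Finset.sum_empty,
      Nat.factorial, pow_zero, pow_one]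
    push_cast
    ring

namespace IsUniformCell

variable {Ω : Type*} [MeasurableSpace Ω] {P : Measure Ω} [IsProbabilityMeasure P]
  {N : Ω → ℕ} {Y : Ω → ℝ} {β m : ℝ}

/-- The contribution of `N = j ≥ 1` is `βm/(j+1)` times the Poisson weight at `j`, which is exactly
the weight at `j + 1`. The expectation is therefore the Poisson mass of `{2, 3, ...}`. -/
lemma integral_max_div_count (h : IsUniformCell P N Y β m) :
    ∫ ω, β * Y ω / N ω ∂P = 1 - (1 + β * m) * Real.exp (-(β * m)) := by
  have ha : 0 ≤ β * m := (mul_pos h.rate_pos h.height_pos).le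
  have e : (fun ω => β * Y ω / N ω) = fun ω => β * (N ω : ℝ)⁻¹ * Y ω ^ 1 := by
    ext ω; rw [pow_one]; ring
  have h1 := h.hasSum_integral_count_mul (fun j => β * (j : ℝ)⁻¹) (Z := fun ω => Y ω ^ 1)
    (by rw [← e]; exact h.integrable_max_div_count)
  rw [← e] at h1
  refine h1.unique ?_
  simp_rw [h.setIntegral_max_pow _ 1 one_pos]
  rw [← hasSum_nat_add_iff' 1]
  have h2 := hasSum_poissonWeight_add_two ha
  convert! h2 using 1
  · ext j
    have hj : ((j : ℝ) + 1) ≠ 0 := by positivity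
    have hj' : ((j : ℝ) + 1 + 1) ≠ 0 := by positivity
    rw [poissonWeight_succ, poissonWeight]
    push_cast
    field_simp
  · simp

/-- The contribution of `N = j ≥ 1` is `(βm)² / (j(j+2))` times the weight at `j`. It is dominated
termwise by the weight at `j + 2`, which gives the main term, plus `4/(βm)` times the weight at `j +
3`. -/
lemma integral_max_div_count_sq_le (h : IsUniformCell P N Y β m) :
    ∫ ω, (β * Y ω / N ω) ^ 2 ∂P ≤ 1 - (1 + β * m) * Real.exp (-(β * m)) + 4 / (β * m) := by
  have ha : 0 < β * m := mul_pos h.rate_pos h.height_pos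
  have e : (fun ω => (β * Y ω / N ω) ^ 2) = fun ω => (β * (N ω : ℝ)⁻¹) ^ 2 * Y ω ^ 2 := by
    ext ω; ring
  have h1 := h.hasSum_integral_count_mul (fun j => (β * (j : ℝ)⁻¹) ^ 2) (Z := fun ω => Y ω ^ 2)
    (by rw [← e]; exact h.integrable_max_div_count_sq)
  rw [← e] at h1
  simp_rw [h.setIntegral_max_pow _ 2 two_pos] at h1
  have h3 : HasSum (fun j => poissonWeight (β * m) (j + 3))
      (1 - ∑ j ∈ Finset.range 3, poissonWeight (β * m) j) :=
    (hasSum_nat_add_iff' 3).mpr (hasSum_poissonWeight ha.le)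
  have h4 := (hasSum_poissonWeight_add_two ha.le).add (h3.mul_left (4 / (β * m)))
  refine (hasSum_le (fun j => ?_) h1 h4).trans ?_
  · rcases Nat.eq_zero_or_pos j with rfl | hj
    · have := poissonWeight_nonneg ha.le 2
      have := poissonWeight_nonneg ha.le 3
      simp only [Nat.cast_zero, zero_div, mul_zero, zero_mul]
      positivity
    · rw [poissonWeight_succ _ (j + 2), poissonWeight_succ _ (j + 1), poissonWeight_succ]
      rw [← poissonWeight]
      have hw := poissonWeight_nonneg ha.le j
      have hj1 : (1 : ℝ) ≤ j := by exact_mod_cast hj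
      have hβ := h.rate_pos
      have hm := h.height_pos
      push_cast
      have l : (β * (j : ℝ)⁻¹) ^ 2 * (m ^ 2 * (j / (j + 2)) * poissonWeight (β * m) j) =
          ((β * m) ^ 2 * poissonWeight (β * m) j) * (1 / (j * (j + 2))) := by
        field_simp
      have r : β * m / ((j : ℝ) + 1 + 1) * (β * m / (j + 1) * poissonWeight (β * m) j) +
          4 / (β * m) * (β * m / ((j : ℝ) + 2 + 1) * (β * m / (j + 1 + 1) *
            (β * m / (j + 1) * poissonWeight (β * m) j))) =
          ((β * m) ^ 2 * poissonWeight (β * m) j) *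
            (1 / ((j + 2) * (j + 1)) + 4 / ((j + 3) * (j + 2) * (j + 1))) := by
        have e1 : (j : ℝ) + 1 + 1 = j + 2 := by ring
        have e2 : (j : ℝ) + 2 + 1 = j + 3 := by ring
        rw [e1, e2]
        field_simp
      rw [l, r]
      -- After cancelling, the claim is `1/(j(j+1)(j+2)) ≤ 4/((j+1)(j+2)(j+3))`, that is `j + 3 ≤
      -- 4j`; the constant 4 is attained at `j = 1`.
      refine mul_le_mul_of_nonneg_left ?_ (by positivity)
      rw [div_add_div _ _ (by positivity) (by positivity), div_le_div_iff₀ (by positivity)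
        (by positivity)]
      have : 0 ≤ (j : ℝ) - 1 := by linarith
      nlinarith [mul_nonneg this this, mul_nonneg this (mul_nonneg this this),
        mul_nonneg (mul_nonneg this this) (mul_nonneg this this),
        mul_nonneg this (mul_nonneg (mul_nonneg this this) (mul_nonneg this this))]
  · have h5 : 0 ≤ ∑ j ∈ Finset.range 3, poissonWeight (β * m) j :=
      Finset.sum_nonneg fun j _ => poissonWeight_nonneg ha.le j
    have h6 : 4 / (β * m) * (1 - ∑ j ∈ Finset.range 3, poissonWeight (β * m) j) ≤
        4 / (β * m) * 1 := by
      gcongr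
      linarith
    linarith

/-- The fluctuation of `β Y / N` around `1` has exponentially small mean. -/
lemma integral_max_div_count_sub_one (h : IsUniformCell P N Y β m) :
    ∫ ω, (β * Y ω / N ω - 1) ∂P = -((1 + β * m) * Real.exp (-(β * m))) := by
  rw [integral_sub h.integrable_max_div_count (integrable_const _), h.integral_max_div_count]
  simp

/-- The fluctuation of `β Y / N` around `1` is small in `L²`. -/
lemma integral_max_div_count_sub_one_sq_le (h : IsUniformCell P N Y β m) :
    ∫ ω, (β * Y ω / N ω - 1) ^ 2 ∂P ≤ (1 + β * m) * Real.exp (-(β * m)) + 4 / (β * m) := by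
  have e : ∀ ω, (β * Y ω / N ω - 1) ^ 2 =
      (β * Y ω / N ω) ^ 2 - (2 * (β * Y ω / N ω - 1) + 1) := by
    intro ω; ring
  have i1 : Integrable (fun ω => β * Y ω / N ω - 1) P :=
    h.integrable_max_div_count.sub (integrable_const _)
  have i2 : Integrable (fun ω => 2 * (β * Y ω / N ω - 1) + 1) P :=
    (i1.const_mul 2).add (integrable_const _)
  simp_rw [e]
  rw [integral_sub h.integrable_max_div_count_sq i2,
    integral_add (i1.const_mul 2) (integrable_const _), integral_const_mul,
    h.integral_max_div_count_sub_one]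
  have := h.integral_max_div_count_sq_le
  simp
  linarith

/-- The weight at `j` times `βm/(j+1)` is the weight at `j + 1`, so the expectation is the
probability that the count is nonzero. -/
lemma integral_inv_count_add_one_le (h : IsUniformCell P N Y β m) :
    ∫ ω, β * m / ((N ω : ℝ) + 1) ∂P ≤ 1 := by
  have ha : 0 < β * m := mul_pos h.rate_pos h.height_pos
  have hNm := h.measurable_count
  have e : (fun ω => β * m / ((N ω : ℝ) + 1)) = fun ω => β * m / ((N ω : ℝ) + 1) * 1 := by
    ext ω; ring
  have hi : Integrable (fun ω => β * m / ((N ω : ℝ) + 1) * 1) P := by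
    refine Integrable.of_bound (C := β * m) (Measurable.aestronglyMeasurable (by fun_prop)) ?_
    refine Eventually.of_forall fun ω => ?_
    rw [mul_one, Real.norm_of_nonneg (by positivity)]
    refine div_le_self ha.le ?_
    simp
  have h1 := h.hasSum_integral_count_mul (fun j => β * m / ((j : ℝ) + 1)) (Z := fun _ => 1) hi
  rw [← e] at h1
  have h2 : HasSum (fun j => poissonWeight (β * m) (j + 1))
      (1 - ∑ j ∈ Finset.range 1, poissonWeight (β * m) j) :=
    (hasSum_nat_add_iff' 1).mpr (hasSum_poissonWeight ha.le)
  have h3 : ∫ ω, β * m / ((N ω : ℝ) + 1) ∂P =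
      1 - ∑ j ∈ Finset.range 1, poissonWeight (β * m) j := by
    refine h1.unique ?_
    convert! h2 using 1
    ext j
    rw [poissonWeight_succ, poissonWeight, ← h.measure_count, setIntegral_const]
    simp
  rw [h3]
  have : 0 ≤ ∑ j ∈ Finset.range 1, poissonWeight (β * m) j :=
      Finset.sum_nonneg fun j _ => poissonWeight_nonneg ha.le j
  linarith

lemma measure_lt_max (h : IsUniformCell P N Y β m) {y : ℝ} (h0 : 0 ≤ y) (hm : y ≤ m) :
    P.real {ω | y < Y ω} = 1 - Real.exp (-(β * (m - y))) := by
  have hmeas : MeasurableSet {ω | Y ω ≤ y} := measurableSet_le h.measurable_max measurable_const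
  have : {ω | y < Y ω} = {ω | Y ω ≤ y}ᶜ := by ext ω; simp
  rw [this, probReal_compl_eq_one_sub hmeas, h.measure_max y h0 hm]

lemma integrable_max (h : IsUniformCell P N Y β m) : Integrable Y P := by
  refine Integrable.of_bound (C := m) h.measurable_max.aestronglyMeasurable ?_
  refine Eventually.of_forall fun ω => ?_
  rw [Real.norm_of_nonneg (h.max_nonneg ω)]
  exact h.max_le ω

/-- The gap `β(m - Y)` is a standard exponential variable truncated at `βm`, with mean `1 - exp (-(β
* m))`. -/
lemma integral_gap_le (h : IsUniformCell P N Y β m) : ∫ ω, β * (m - Y ω) ∂P ≤ 1 := by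
  have hβ := h.rate_pos
  have h1 := integral_intervalIntegral_eq (ν := P) h.measurable_max h.max_nonneg h.max_le
    (g := fun _ : ℝ => (1 : ℝ)) continuous_const
  simp only [intervalIntegral.integral_const, sub_zero, smul_eq_mul, mul_one] at h1
  rw [setIntegral_congr_fun measurableSet_Ioc fun y hy => h.measure_lt_max hy.1.le hy.2,
    ← intervalIntegral.integral_of_le h.height_pos.le] at h1
  have h2 : ∫ y in (0 : ℝ)..m, (1 - Real.exp (-(β * (m - y)))) =
      m - (1 - Real.exp (-(β * m))) / β := by
    rw [intervalIntegral.integral_eq_sub_of_hasDerivAt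
      (f := fun y => y - Real.exp (-(β * (m - y))) / β)]
    · simp; field_simp; ring
    · intro y _
      have : HasDerivAt (fun y => -(β * (m - y))) β y := by
        convert! (((hasDerivAt_id y).const_sub m).const_mul β).neg using 1
        simp
      convert! (hasDerivAt_id y).sub (this.exp.div_const β) using 1
      field_simp
    · exact (by fun_prop : Continuous fun y => 1 - Real.exp (-(β * (m - y)))).intervalIntegrable _ _
  rw [integral_const_mul, integral_sub (integrable_const _) h.integrable_max, h1, h2]
  have := Real.exp_pos (-(β * m))
  simp
  field_simp
  linarith

/-- The characteristic function of `1 - β (m - Y)` is close to that of a centered exponential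
variable with the opposite sign. -/
lemma norm_integral_exp_sub_le (h : IsUniformCell P N Y β m) (t : ℝ) :
    ‖∫ ω, Complex.exp (Complex.I * (t * (1 - β * (m - Y ω)) : ℝ)) ∂P -
      Complex.exp (Complex.I * t) / (1 + Complex.I * t)‖ ≤ |t| * Real.exp (-(β * m)) := by
  have hβ := h.rate_pos
  set s : ℂ := Complex.I * (t * β : ℝ) with hs
  have hne : (1 : ℂ) + Complex.I * t ≠ 0 := by
    intro h0
    have := congrArg Complex.re h0
    simp at this
  have hβ' : (β : ℂ) ≠ 0 := by exact_mod_cast hβ.ne'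
  have hsβ : s + β = β * (1 + Complex.I * t) := by rw [hs]; push_cast; ring
  have hsne : s + β ≠ 0 := by rw [hsβ]; exact mul_ne_zero hβ' hne
  have hderiv : ∀ (b : ℂ) (y : ℝ), HasDerivAt (fun y : ℝ => Complex.exp (b * y))
      (b * Complex.exp (b * y)) y := by
    intro b y
    have h1 : HasDerivAt (fun y : ℝ => b * (y : ℂ)) (b * 1) y :=
      (Complex.ofRealCLM.hasDerivAt (x := y)).const_mul b
    convert! h1.cexp using 1
    ring
  have hcont : ∀ b : ℂ, Continuous fun y : ℝ => b * Complex.exp (b * y) := fun b => by fun_prop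
  have hprim : ∀ b : ℂ, ∫ u in (0 : ℝ)..m, b * Complex.exp (b * u) =
      Complex.exp (b * m) - Complex.exp (b * (0 : ℝ)) := fun b =>
    intervalIntegral.integral_eq_sub_of_hasDerivAt (fun u _ => hderiv b u)
      ((hcont b).intervalIntegrable _ _)
  -- Writing the exponential as the integral of its derivative lets the layer cake formula replace
  -- the law of `Y` by its explicit tail.
  have hexp : ∀ y : ℝ, Complex.exp (s * y) = 1 + ∫ u in (0 : ℝ)..y, s * Complex.exp (s * u) := by
    intro y
    rw [intervalIntegral.integral_eq_sub_of_hasDerivAt (fun u _ => hderiv s u)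
      ((hcont s).intervalIntegrable _ _)]
    simp
  have hbound : ∀ y ∈ Set.Icc (0 : ℝ) m, ‖∫ u in (0 : ℝ)..y, s * Complex.exp (s * u)‖ ≤ 2 := by
    intro y _
    have e : ∫ u in (0 : ℝ)..y, s * Complex.exp (s * u) = Complex.exp (s * y) - 1 := by
      rw [hexp y]; ring
    rw [e]
    refine (norm_sub_le _ _).trans ?_
    have : s * y = ((t * β * y : ℝ) : ℂ) * Complex.I := by rw [hs]; push_cast; ring
    rw [this, Complex.norm_exp_ofReal_mul_I]
    norm_num
  have hYexp : ∫ ω, Complex.exp (s * Y ω) ∂P =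
      1 + ∫ ω, (∫ u in (0 : ℝ)..Y ω, s * Complex.exp (s * u)) ∂P := by
    have e0 : (fun ω => Complex.exp (s * Y ω)) =
        fun ω => 1 + ∫ u in (0 : ℝ)..Y ω, s * Complex.exp (s * u) := funext fun ω => hexp (Y ω)
    rw [e0, integral_add (integrable_const _)]
    · simp
    · refine Integrable.of_bound (C := 2) ?_ (Eventually.of_forall fun ω =>
        hbound _ ⟨h.max_nonneg ω, h.max_le ω⟩)
      have e : (fun ω => ∫ u in (0 : ℝ)..Y ω, s * Complex.exp (s * u)) =
          fun ω => Complex.exp (s * Y ω) - 1 := by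
        ext ω; rw [hexp (Y ω)]; ring
      rw [e]
      have := h.measurable_max
      exact Measurable.aestronglyMeasurable (by fun_prop)
  rw [integral_intervalIntegral_eq h.measurable_max h.max_nonneg h.max_le (hcont s),
    setIntegral_congr_fun (g := fun y : ℝ => s * Complex.exp (s * y) -
      s / (s + β) * Complex.exp (-(β * m)) * ((s + β) * Complex.exp ((s + β) * y)))
      measurableSet_Ioc ?_, ← intervalIntegral.integral_of_le h.height_pos.le,
    intervalIntegral.integral_sub ((hcont s).intervalIntegrable _ _)
      (((hcont (s + β)).const_mul _).intervalIntegrable _ _),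
    intervalIntegral.integral_const_mul (s / (s + β) * Complex.exp (-(β * m))),
    hprim, hprim] at hYexp
  · have hfac : ∀ ω, Complex.exp (Complex.I * (t * (1 - β * (m - Y ω)) : ℝ)) =
        Complex.exp (Complex.I * t - s * m) * Complex.exp (s * Y ω) := by
      intro ω
      rw [← Complex.exp_add, hs]
      congr 1
      push_cast
      ring
    simp_rw [hfac]
    rw [integral_const_mul, hYexp]
    have hs2 : s / (s + β) = Complex.I * t / (1 + Complex.I * t) := by
      rw [hsβ, hs]
      push_cast
      field_simp
    have e1 : Complex.exp (Complex.I * t - s * m) * Complex.exp (s * m) =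
        Complex.exp (Complex.I * t) := by
      rw [← Complex.exp_add]; congr 1; ring
    have e2 : Complex.exp (-(β * m)) * Complex.exp ((s + β) * m) = Complex.exp (s * m) := by
      rw [← Complex.exp_add]; congr 1; ring
    -- The error is exact: truncating the exponential variable at `βm` costs a term of modulus `|t|
    -- / |1 + it|` times `exp (-(β * m))`.
    have e3 : Complex.exp (Complex.I * t - s * m) * (1 + (Complex.exp (s * m) -
        Complex.exp (s * (0 : ℝ)) - s / (s + β) * Complex.exp (-(β * m)) *
          (Complex.exp ((s + β) * m) - Complex.exp ((s + β) * (0 : ℝ))))) -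
        Complex.exp (Complex.I * t) / (1 + Complex.I * t) =
        Complex.I * t / (1 + Complex.I * t) *
          (Complex.exp (Complex.I * t - s * m) * Complex.exp (-(β * m))) := by
      have e4 : s / (s + β) * Complex.exp (-(β * m)) *
          (Complex.exp ((s + β) * m) - Complex.exp ((s + β) * (0 : ℝ))) =
          Complex.I * t / (1 + Complex.I * t) *
            (Complex.exp (s * m) - Complex.exp (-(β * m))) := by
        rw [hs2, ← e2]
        simp
        ring
      rw [e4, ← e1]
      simp
      field_simp
      ring
    rw [e3, norm_mul, norm_mul, norm_div, norm_mul, Complex.norm_I, one_mul, Complex.norm_real]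
    have n1 : ‖Complex.exp (Complex.I * t - s * m)‖ = 1 := by
      have : Complex.I * t - s * m = ((t - t * β * m : ℝ) : ℂ) * Complex.I := by
        rw [hs]; push_cast; ring
      rw [this, Complex.norm_exp_ofReal_mul_I]
    have n2 : ‖Complex.exp (-((β : ℂ) * m))‖ = Real.exp (-(β * m)) := by
      rw [Complex.norm_exp]; simp
    have n3 : 1 ≤ ‖(1 : ℂ) + Complex.I * t‖ := by
      refine le_trans ?_ (Complex.abs_re_le_norm _)
      simp
    rw [n1, n2, one_mul, Real.norm_eq_abs]
    gcongr
    exact div_le_self (abs_nonneg t) n3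
  · intro y hy
    simp only
    rw [h.measure_lt_max hy.1.le hy.2, Complex.real_smul]
    have : Complex.exp (-(β * m)) * Complex.exp ((s + β) * y) =
        Complex.exp (-(β * (m - y))) * Complex.exp (s * y) := by
      rw [← Complex.exp_add, ← Complex.exp_add]; congr 1; ring
    have e5 : s / (s + β) * Complex.exp (-(β * m)) * ((s + β) * Complex.exp ((s + β) * y)) =
        s * (Complex.exp (-(β * m)) * Complex.exp ((s + β) * y)) := by
      field_simp
    rw [e5, this]
    push_cast
    ring

end IsUniformCell

/-! ### Comparison of characteristic functions -/

section ComplexEstimates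

/-- Exchange one factor at a time; the remaining factors lie in the unit disc and cannot amplify the
difference. -/
lemma norm_prod_sub_prod_le_sum {ι : Type*} (s : Finset ι) (a b : ι → ℂ)
    (ha : ∀ i ∈ s, ‖a i‖ ≤ 1) (hb : ∀ i ∈ s, ‖b i‖ ≤ 1) :
    ‖∏ i ∈ s, a i - ∏ i ∈ s, b i‖ ≤ ∑ i ∈ s, ‖a i - b i‖ := by
  classical
  induction s using Finset.induction_on with
  | empty => simp
  | insert i s hi ih =>
    rw [Finset.prod_insert hi, Finset.prod_insert hi, Finset.sum_insert hi]
    have ih' := ih (fun j hj => ha j (Finset.mem_insert_of_mem hj))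
      (fun j hj => hb j (Finset.mem_insert_of_mem hj))
    have hbp : ‖∏ j ∈ s, b j‖ ≤ 1 := by
      rw [norm_prod]
      exact Finset.prod_le_one (fun _ _ => norm_nonneg _)
        fun j hj => hb j (Finset.mem_insert_of_mem hj)
    have e : a i * ∏ j ∈ s, a j - b i * ∏ j ∈ s, b j =
        a i * (∏ j ∈ s, a j - ∏ j ∈ s, b j) + (a i - b i) * ∏ j ∈ s, b j := by ring
    rw [e]
    refine (norm_add_le _ _).trans ?_
    rw [norm_mul, norm_mul]
    have h1 := mul_le_of_le_one_left (norm_nonneg (∏ j ∈ s, a j - ∏ j ∈ s, b j))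
      (ha i (Finset.mem_insert_self i s))
    have h2 := mul_le_of_le_one_right (norm_nonneg (a i - b i)) hbp
    linarith

/-- Second order comparison of the characteristic functions of a centered exponential and of a
standard Gaussian variable. -/
lemma norm_exp_div_sub_exp_neg_sq_le {t : ℝ} (ht : |t| ≤ 1) :
    ‖Complex.exp (Complex.I * t) / (1 + Complex.I * t) - Complex.exp (-(t ^ 2 / 2 : ℝ))‖ ≤
      6 * |t| ^ 3 := by
  have hne : 1 ≤ ‖(1 : ℂ) + Complex.I * t‖ := by
    refine le_trans ?_ (Complex.abs_re_le_norm _)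
    simp
  have hne0 : (1 : ℂ) + Complex.I * t ≠ 0 := by
    intro h; rw [h] at hne; norm_num at hne
  have h3 : Real.exp 1 ≤ 3 := by
    have := Real.exp_one_lt_d9; linarith
  have h1 := Complex.norm_exp_sub_sum_le_norm_mul_exp (Complex.I * t) 3
  have h2 := Complex.norm_exp_sub_sum_le_norm_mul_exp (-(t ^ 2 / 2 : ℝ) : ℂ) 2
  have n1 : ‖Complex.I * (t : ℂ)‖ = |t| := by simp
  have n2 : ‖(-(t ^ 2 / 2 : ℝ) : ℂ)‖ = |t| ^ 2 / 2 := by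
    rw [norm_neg, Complex.norm_real, Real.norm_eq_abs, abs_div, abs_pow]; simp
  have e1 : Real.exp |t| ≤ 3 := (Real.exp_le_exp.mpr ht).trans h3
  have hsq : |t| ^ 2 / 2 ≤ 1 := by nlinarith [abs_nonneg t]
  have e2 : Real.exp (|t| ^ 2 / 2) ≤ 3 := (Real.exp_le_exp.mpr hsq).trans h3
  rw [n1] at h1
  rw [n2] at h2
  have h1' := h1.trans (mul_le_mul_of_nonneg_left e1 (by positivity))
  have h2' := h2.trans (mul_le_mul_of_nonneg_left e2 (by positivity))
  simp only [Finset.sum_range_succ, Finset.range_zero, Finset.sum_empty, Nat.factorial, pow_zero,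
    pow_one, zero_add] at h1' h2'
  set A := Complex.exp (Complex.I * t) -
    (1 / ((1 : ℕ) : ℂ) + Complex.I * t / ((0 + 1) * 1 : ℕ) + (Complex.I * t) ^ 2 / ((1 + 1) * ((0 + 1) * 1) : ℕ)) with hA
  set B := Complex.exp (-(t ^ 2 / 2 : ℝ)) -
    (1 / ((1 : ℕ) : ℂ) + (-(t ^ 2 / 2 : ℝ) : ℂ) / ((0 + 1) * 1 : ℕ)) with hB
  -- Since `(1 + it)(1 - t²/2) = (1 + it - t²/2) - it³/2`, the second order terms cancel and only
  -- the remainders `A`, `B` and a cubic term survive. Their bounds add up to at most `3 + 3/2 + 1/2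
  -- = 5` times `|t| ^ 3`.
  have e : Complex.exp (Complex.I * t) / (1 + Complex.I * t) - Complex.exp (-(t ^ 2 / 2 : ℝ)) =
      (A - (1 + Complex.I * t) * B + Complex.I * t ^ 3 / 2) / (1 + Complex.I * t) := by
    rw [hA, hB]
    field_simp
    push_cast
    ring_nf
    simp [Complex.I_sq]
  have n3 : ‖(1 : ℂ) + Complex.I * t‖ ≤ 2 := by
    refine (norm_add_le _ _).trans ?_
    rw [n1, norm_one]; linarith
  have n4 : ‖Complex.I * (t : ℂ) ^ 3 / 2‖ = |t| ^ 3 / 2 := by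
    simp
  rw [e, norm_div]
  refine (div_le_self (norm_nonneg _) hne).trans ?_
  refine (norm_add_le _ _).trans ?_
  have h5 := norm_sub_le A ((1 + Complex.I * t) * B)
  rw [norm_mul] at h5
  have h6 : ‖(1 : ℂ) + Complex.I * t‖ * ‖B‖ ≤ 2 * ((|t| ^ 2 / 2) ^ 2 * 3) :=
    mul_le_mul n3 h2' (norm_nonneg _) (by norm_num)
  have h7 : |t| ^ 4 ≤ |t| ^ 3 := pow_le_pow_of_le_one (abs_nonneg t) ht (by norm_num)
  rw [n4]
  nlinarith

/-- As `|exp (ia) - exp (ib)| ≤ |a - b|`, negligible terms need only be small in `L¹`. -/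
lemma norm_integral_exp_sub_integral_exp_le {Ω : Type*} [MeasurableSpace Ω] {P : Measure Ω}
    [IsProbabilityMeasure P] {A B : Ω → ℝ} (hA : Measurable A) (hB : Measurable B)
    (hAB : Integrable (fun ω => |A ω - B ω|) P) :
    ‖∫ ω, Complex.exp (Complex.I * A ω) ∂P - ∫ ω, Complex.exp (Complex.I * B ω) ∂P‖ ≤
      ∫ ω, |A ω - B ω| ∂P := by
  have hn : ∀ x : ℝ, ‖Complex.exp (Complex.I * x)‖ = 1 := fun x => by
    rw [mul_comm, Complex.norm_exp_ofReal_mul_I]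
  have hi : ∀ {C : Ω → ℝ}, Measurable C → Integrable (fun ω => Complex.exp (Complex.I * C ω)) P :=
    fun hC => Integrable.of_bound (C := 1) (Measurable.aestronglyMeasurable (by fun_prop))
      (Eventually.of_forall fun ω => (hn _).le)
  rw [← integral_sub (hi hA) (hi hB)]
  refine norm_integral_le_of_norm_le hAB (Eventually.of_forall fun ω => ?_)
  have e : Complex.exp (Complex.I * A ω) - Complex.exp (Complex.I * B ω) =
      Complex.exp (Complex.I * B ω) * (Complex.exp (Complex.I * (A ω - B ω : ℝ)) - 1) := by
    rw [mul_sub, ← Complex.exp_add, mul_one]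
    congr 2
    push_cast
    ring
  rw [e, norm_mul, hn, one_mul]
  exact Real.norm_exp_I_mul_ofReal_sub_one_le

end ComplexEstimates

/-! ### Weighted sums over independent flat cells -/

section IndependentCells

variable {Ω : Type*} [MeasurableSpace Ω] {P : Measure Ω} [IsProbabilityMeasure P] {k : ℕ}
  {N : Fin k → Ω → ℕ} {Y : Fin k → Ω → ℝ} {β : ℝ} {m : Fin k → ℝ}

/-- Independence factors the characteristic function, and the Gaussian one factors as well. Each
factor pays for the truncation of the exponential variable and for its cubic distance to the
Gaussian. -/
lemma norm_integral_exp_sum_gap_sub_le (h : ∀ r, IsUniformCell P (N r) (Y r) β (m r))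
    (hind : iIndepFun (fun r ω => (N r ω, Y r ω)) P) (t : Fin k → ℝ) (ht : ∀ r, |t r| ≤ 1) :
    ‖∫ ω, Complex.exp (Complex.I * (∑ r, t r * (1 - β * (m r - Y r ω)) : ℝ)) ∂P -
      Complex.exp (-((∑ r, t r ^ 2) / 2 : ℝ))‖ ≤
      ∑ r, (|t r| * Real.exp (-(β * m r)) + 6 * |t r| ^ 3) := by
  have hYm := fun r => (h r).measurable_max
  have e1 : ∀ ω, Complex.exp (Complex.I * (∑ r, t r * (1 - β * (m r - Y r ω)) : ℝ)) =
      ∏ r, Complex.exp (Complex.I * (t r * (1 - β * (m r - Y r ω)) : ℝ)) := by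
    intro ω
    rw [← Complex.exp_sum]
    congr 1
    rw [← Finset.mul_sum]
    push_cast
    rfl
  have e2 : Complex.exp (-((∑ r, t r ^ 2) / 2 : ℝ)) = ∏ r, Complex.exp (-(t r ^ 2 / 2 : ℝ)) := by
    rw [← Complex.exp_sum]
    congr 1
    rw [Finset.sum_div]
    push_cast
    rw [Finset.sum_neg_distrib]
  have hind' : iIndepFun (fun r ω => Complex.exp (Complex.I *
      (t r * (1 - β * (m r - Y r ω)) : ℝ))) P :=
    hind.comp (fun r (z : ℕ × ℝ) => Complex.exp (Complex.I * (t r * (1 - β * (m r - z.2)) : ℝ)))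
      fun r => by fun_prop
  simp_rw [e1]
  rw [hind'.integral_fun_prod_eq_prod_integral
    (fun r => Measurable.aestronglyMeasurable (by have := hYm r; fun_prop)), e2]
  refine (norm_prod_sub_prod_le_sum _ _ _ (fun r _ => ?_) (fun r _ => ?_)).trans ?_
  · refine (norm_integral_le_of_norm_le_const (C := 1) (Eventually.of_forall fun ω => ?_)).trans ?_
    · rw [mul_comm, Complex.norm_exp_ofReal_mul_I]
    · simp
  · rw [← Complex.ofReal_neg, Complex.norm_exp_ofReal]
    exact Real.exp_le_one_iff.mpr (by have := sq_nonneg (t r); linarith)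
  · refine Finset.sum_le_sum fun r _ => ?_
    have h1 := (h r).norm_integral_exp_sub_le (t r)
    have h2 := norm_exp_div_sub_exp_neg_sq_le (ht r)
    exact (norm_sub_le_norm_sub_add_norm_sub _ _ _).trans (add_le_add h1 h2)

/-- Half of the exponent absorbs the linear factor: `1 + b ≤ 2 * exp (b / 2)`. -/
lemma one_add_mul_exp_neg_le {a b : ℝ} (hab : a ≤ b) :
    (1 + b) * Real.exp (-b) ≤ 2 * Real.exp (-(a / 2)) := by
  have h1 : 1 + b ≤ 2 * Real.exp (b / 2) := by
    have := Real.add_one_le_exp (b / 2); linarith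
  have h2 : Real.exp (b / 2) * Real.exp (-b) = Real.exp (-(b / 2)) := by
    rw [← Real.exp_add]; ring_nf
  calc (1 + b) * Real.exp (-b) ≤ 2 * Real.exp (b / 2) * Real.exp (-b) := by gcongr
    _ = 2 * Real.exp (-(b / 2)) := by rw [mul_assoc, h2]
    _ ≤ 2 * Real.exp (-(a / 2)) := by gcongr

/-- Bounding cell by cell in `L¹` would bring in `∑ |t r|`, which may grow, multiplied by a term
decaying only polynomially in `Λ`. Passing to `L²`, the variances of independent cells add with
weights `t r ^ 2`, and `∑ |t r|` multiplies only the exponentially small means. -/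
lemma integral_abs_sum_fluctuation_le (h : ∀ r, IsUniformCell P (N r) (Y r) β (m r))
    (hind : iIndepFun (fun r ω => (N r ω, Y r ω)) P) (t : Fin k → ℝ) {Λ : ℝ} (hΛ : 0 < Λ)
    (hm : ∀ r, Λ ≤ β * m r) :
    ∫ ω, |∑ r, t r * (β * Y r ω / N r ω - 1)| ∂P ≤
      √((∑ r, t r ^ 2) * (2 * Real.exp (-(Λ / 2)) + 4 / Λ) +
        ((∑ r, |t r|) * (2 * Real.exp (-(Λ / 2)))) ^ 2) := by
  set W : Fin k → Ω → ℝ := fun r ω => t r * (β * Y r ω / N r ω - 1) with hW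
  have hWm : ∀ r, Measurable (W r) := fun r => by
    have := (h r).measurable_max
    have := (h r).measurable_count
    fun_prop
  have hWb : ∀ r ω, ‖W r ω‖ ≤ |t r| * (β * m r + 1) := by
    intro r ω
    rw [hW, norm_mul, Real.norm_eq_abs, Real.norm_eq_abs]
    gcongr
    refine (abs_sub _ _).trans ?_
    have := (h r).abs_rate_mul_max_div_count_le ω
    simpa using this
  have hWL : ∀ r, MemLp (W r) 2 P := fun r =>
    MemLp.of_bound (hWm r).aestronglyMeasurable _ (Eventually.of_forall (hWb r))
  have hWi : iIndepFun W P :=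
    hind.comp (fun r (z : ℕ × ℝ) => t r * (β * z.2 / z.1 - 1)) fun r => by fun_prop
  have hmean : ∀ r, |∫ ω, W r ω ∂P| ≤ |t r| * (2 * Real.exp (-(Λ / 2))) := by
    intro r
    simp only [hW]
    rw [integral_const_mul, (h r).integral_max_div_count_sub_one, abs_mul, abs_neg]
    have : 0 ≤ (1 + β * m r) * Real.exp (-(β * m r)) := by
      have := hm r
      have : 0 ≤ 1 + β * m r := by linarith
      positivity
    rw [abs_of_nonneg this]
    exact mul_le_mul_of_nonneg_left (one_add_mul_exp_neg_le (hm r)) (abs_nonneg _)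
  have hvar : ∀ r, Var[W r; P] ≤ t r ^ 2 * (2 * Real.exp (-(Λ / 2)) + 4 / Λ) := by
    intro r
    refine (variance_le_expectation_sq (hWm r).aestronglyMeasurable).trans ?_
    have e : (∫ ω, (W r ^ 2) ω ∂P) = t r ^ 2 * ∫ ω, (β * Y r ω / N r ω - 1) ^ 2 ∂P := by
      rw [← integral_const_mul]
      refine integral_congr_ae (Eventually.of_forall fun ω => ?_)
      simp only [hW, Pi.pow_apply]
      ring
    rw [e]
    refine mul_le_mul_of_nonneg_left ?_ (sq_nonneg _)
    refine (h r).integral_max_div_count_sub_one_sq_le.trans ?_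
    exact add_le_add (one_add_mul_exp_neg_le (hm r))
      (div_le_div_of_nonneg_left (by norm_num) hΛ (hm r))
  set S : Ω → ℝ := ∑ r, W r with hS
  have hSe : ∀ ω, ∑ r, t r * (β * Y r ω / N r ω - 1) = S ω := fun ω => by
    simp [hS, hW, Finset.sum_apply]
  simp_rw [hSe]
  have hSL : MemLp S 2 P := memLp_finsetSum' _ fun r _ => hWL r
  have hvarS : Var[S; P] ≤ (∑ r, t r ^ 2) * (2 * Real.exp (-(Λ / 2)) + 4 / Λ) := by
    rw [hS, IndepFun.variance_sum (fun r _ => hWL r) fun i _ j _ hij => hWi.indepFun hij,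
      Finset.sum_mul]
    exact Finset.sum_le_sum fun r _ => hvar r
  have hmeanS : |∫ ω, S ω ∂P| ≤ (∑ r, |t r|) * (2 * Real.exp (-(Λ / 2))) := by
    have : ∫ ω, S ω ∂P = ∑ r, ∫ ω, W r ω ∂P := by
      rw [← integral_finsetSum _ fun r _ => (hWL r).integrable (by norm_num)]
      refine integral_congr_ae (Eventually.of_forall fun ω => ?_)
      simp [hS, Finset.sum_apply]
    rw [this, Finset.sum_mul]
    exact (Finset.abs_sum_le_sum_abs _ _).trans (Finset.sum_le_sum fun r _ => hmean r)
  have hsq : ∫ ω, S ω ^ 2 ∂P = Var[S; P] + (∫ ω, S ω ∂P) ^ 2 := by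
    rw [variance_eq_sub hSL]
    simp
  have habs : (∫ ω, |S ω| ∂P) ^ 2 ≤ ∫ ω, S ω ^ 2 ∂P := by
    have := variance_nonneg (fun ω => |S ω|) P
    rw [variance_eq_sub (by simpa using hSL.norm)] at this
    simpa using this
  refine Real.le_sqrt_of_sq_le (habs.trans ?_)
  rw [hsq]
  refine add_le_add hvarS ?_
  rw [← sq_abs]
  gcongr

end IndependentCells

/-! ### Points between the flat cell and the graph -/

/-- The cell `(N', Y')` enlarged by `e` additional points, none of them exceeding the height `m` by
more than `η`, into a cell with `N` points and largest ordinate `Y`. -/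
structure IsEnlargedCell {Ω : Type*} [MeasurableSpace Ω] (P : Measure Ω) (N' e N : Ω → ℕ)
    (Y' Y : Ω → ℝ) (β m η : ℝ) : Prop where
  uniform : IsUniformCell P N' Y' β m
  measurable_extra : Measurable e
  measurable_max : Measurable Y
  count_eq : ∀ ω, N ω = N' ω + e ω
  max_eq : ∀ ω, e ω = 0 → Y ω = Y' ω
  max_le : ∀ ω, Y ω ≤ m + η
  le_max : ∀ ω, Y' ω ≤ Y ω
  indep : IndepFun (fun ω => (N' ω, Y' ω)) e P
  measure_extra : P.real {ω | e ω ≠ 0} ≤ β * η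

namespace IsEnlargedCell

variable {Ω : Type*} [MeasurableSpace Ω] {P : Measure Ω}
  {N' e N : Ω → ℕ} {Y' Y : Ω → ℝ} {β m η : ℝ}

lemma measurable_count (h : IsEnlargedCell P N' e N Y' Y β m η) : Measurable N := by
  have : N = fun ω => N' ω + e ω := funext h.count_eq
  rw [this]
  exact h.uniform.measurable_count.add h.measurable_extra

/-- Effect of the additional points on the rescaled estimate of the height. -/
lemma abs_sub_le (h : IsEnlargedCell P N' e N Y' Y β m η) (hη : 0 ≤ η) (ω : Ω) :
    |β * ((1 + 1 / (N ω : ℝ)) * Y ω) - β * ((1 + 1 / (N' ω : ℝ)) * Y' ω)| ≤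
      (β * (m - Y' ω) + β * η + β * η / ((N' ω : ℝ) + 1) + 3 * (β * m / ((N' ω : ℝ) + 1))) *
        {ω | e ω ≠ 0}.indicator 1 ω := by
  by_cases he : e ω = 0
  · have hN : N ω = N' ω := by rw [h.count_eq, he, add_zero]
    rw [hN, h.max_eq ω he, sub_self, abs_zero]
    simp [he]
  · have hβ := h.uniform.rate_pos
    have hm := h.uniform.height_pos
    have hY' := h.uniform.max_nonneg ω
    have hY'm := h.uniform.max_le ω
    have hY := h.max_le ω
    have hYY := h.le_max ω
    have hn : (0 : ℝ) ≤ N' ω := by positivity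
    have hN : ((N' ω : ℝ) + 1) ≤ N ω := by
      rw [h.count_eq]
      have : N' ω + 1 ≤ N' ω + e ω := by omega
      exact_mod_cast this
    have hind : {ω | e ω ≠ 0}.indicator (1 : Ω → ℝ) ω = 1 := Set.indicator_of_mem he _
    rw [hind, mul_one]
    have h1 : β * Y ω / N ω ≤ β * η / ((N' ω : ℝ) + 1) + β * m / ((N' ω : ℝ) + 1) := by
      rw [← add_div, ← mul_add, add_comm η m]
      gcongr
    have h1' : 0 ≤ β * Y ω / N ω := by
      have : 0 ≤ Y ω := hY'.trans hYY
      positivity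
    -- The factor 2 is `1/N' ≤ 2/(N' + 1)` for `N' ≥ 1`; an empty flat cell contributes `0`. Passing
    -- to `N' + 1` gives a quantity whose expectation is at most 1.
    have h2 : β * Y' ω / N' ω ≤ 2 * (β * m / ((N' ω : ℝ) + 1)) := by
      rcases Nat.eq_zero_or_pos (N' ω) with h0 | h0
      · rw [h0]
        simp only [Nat.cast_zero, div_zero, zero_add, div_one]
        positivity
      · have h0' : (1 : ℝ) ≤ N' ω := by exact_mod_cast h0
        calc β * Y' ω / N' ω ≤ β * m / N' ω := by gcongr
          _ ≤ 2 * (β * m / ((N' ω : ℝ) + 1)) := by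
            rw [← mul_div_assoc, div_le_div_iff₀ (by linarith) (by linarith)]
            nlinarith [mul_pos hβ hm]
    have h2' : 0 ≤ β * Y' ω / N' ω := by positivity
    have h3 : β * ((1 + 1 / (N ω : ℝ)) * Y ω) - β * ((1 + 1 / (N' ω : ℝ)) * Y' ω) =
        β * (Y ω - Y' ω) + (β * Y ω / N ω - β * Y' ω / N' ω) := by ring
    have h4 : β * (Y ω - Y' ω) ≤ β * (m - Y' ω) + β * η := by
      rw [← mul_add]; gcongr; linarith
    have h5 : 0 ≤ β * (Y ω - Y' ω) := mul_nonneg hβ.le (by linarith)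
    have h6 : 0 ≤ β * η / ((N' ω : ℝ) + 1) := by positivity
    have h7 : 0 ≤ β * m / ((N' ω : ℝ) + 1) := by positivity
    rw [h3, abs_le]
    constructor <;> linarith

variable [IsProbabilityMeasure P]

/-- The pointwise bound is a function of the flat cell times the indicator that extra points occur.
These are independent, so the expectation is at most `6` times a probability bounded by `β * η`. -/
lemma integrable_and_integral_abs_sub_le (h : IsEnlargedCell P N' e N Y' Y β m η) (hη : 0 ≤ η)
    (hη1 : β * η ≤ 1) :
    Integrable (fun ω => |β * ((1 + 1 / (N ω : ℝ)) * Y ω) -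
      β * ((1 + 1 / (N' ω : ℝ)) * Y' ω)|) P ∧
    ∫ ω, |β * ((1 + 1 / (N ω : ℝ)) * Y ω) - β * ((1 + 1 / (N' ω : ℝ)) * Y' ω)| ∂P ≤
      6 * (β * η) := by
  have hβ := h.uniform.rate_pos
  have hm := h.uniform.height_pos
  have m1 := h.uniform.measurable_count
  have m2 := h.uniform.measurable_max
  have m3 := h.measurable_count
  have m4 := h.measurable_max
  set g : ℕ × ℝ → ℝ := fun z => β * (m - z.2) + β * η + β * η / ((z.1 : ℝ) + 1) +
    3 * (β * m / ((z.1 : ℝ) + 1)) with hg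
  have hgm : Measurable g := by fun_prop
  have i1 : Integrable (fun ω => β * (m - Y' ω)) P :=
    ((integrable_const _).sub h.uniform.integrable_max).const_mul _
  have i2 : ∀ c : ℝ, Integrable (fun ω => c / ((N' ω : ℝ) + 1)) P := by
    intro c
    refine Integrable.of_bound (C := |c|) (Measurable.aestronglyMeasurable (by fun_prop)) ?_
    refine Eventually.of_forall fun ω => ?_
    rw [norm_div, Real.norm_eq_abs, Real.norm_of_nonneg (by positivity)]
    refine div_le_self (abs_nonneg c) ?_
    simp
  have i12 : Integrable (fun ω => β * (m - Y' ω) + β * η) P := i1.add (integrable_const _)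
  have i123 : Integrable (fun ω => β * (m - Y' ω) + β * η + β * η / ((N' ω : ℝ) + 1)) P :=
    i12.add (i2 _)
  have igX : Integrable (fun ω => g (N' ω, Y' ω)) P := i123.add ((i2 _).const_mul 3)
  -- The summands contribute at most `1`, `1`, `1` and `3`, the middle two because `β * η ≤ 1`.
  have hgE : ∫ ω, g (N' ω, Y' ω) ∂P ≤ 6 := by
    simp only [hg]
    rw [integral_add i123 ((i2 _).const_mul 3), integral_add i12 (i2 _),
      integral_add i1 (integrable_const _), integral_const_mul 3]
    have e1 := h.uniform.integral_gap_le
    have e2 := h.uniform.integral_inv_count_add_one_le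
    have e3 : ∫ ω, β * η / ((N' ω : ℝ) + 1) ∂P ≤ 1 := by
      calc ∫ ω, β * η / ((N' ω : ℝ) + 1) ∂P ≤ ∫ _ω, (1 : ℝ) ∂P := by
            refine integral_mono (i2 _) (integrable_const _) fun ω => ?_
            refine (div_le_self (by positivity) ?_).trans hη1
            simp
        _ = 1 := by simp
    simp only [integral_const, probReal_univ, one_smul]
    linarith
  have hg0 : 0 ≤ ∫ ω, g (N' ω, Y' ω) ∂P := by
    refine integral_nonneg fun ω => ?_
    have : 0 ≤ m - Y' ω := sub_nonneg.mpr (h.uniform.max_le ω)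
    simp only [hg, Pi.zero_apply]
    positivity
  have hem : MeasurableSet {ω | e ω ≠ 0} :=
    h.measurable_extra (measurableSet_singleton 0).compl
  have eind : {ω | e ω ≠ 0}.indicator (1 : Ω → ℝ) =
      fun ω => ({n : ℕ | n ≠ 0}.indicator (1 : ℕ → ℝ)) (e ω) := by
    ext ω
    by_cases he : e ω = 0 <;> simp [he]
  have hindep : IndepFun (fun ω => g (N' ω, Y' ω)) ({ω | e ω ≠ 0}.indicator (1 : Ω → ℝ)) P := by
    rw [eind]
    exact h.indep.comp (φ := g) (ψ := {n : ℕ | n ≠ 0}.indicator (1 : ℕ → ℝ)) hgm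
      (measurable_of_countable _)
  have i3 : Integrable ({ω | e ω ≠ 0}.indicator (1 : Ω → ℝ)) P :=
    (integrable_const (1 : ℝ)).indicator hem
  have hprod : Integrable (fun ω => g (N' ω, Y' ω) * {ω | e ω ≠ 0}.indicator (1 : Ω → ℝ) ω) P :=
    hindep.integrable_mul igX i3
  have hint : Integrable (fun ω => |β * ((1 + 1 / (N ω : ℝ)) * Y ω) -
      β * ((1 + 1 / (N' ω : ℝ)) * Y' ω)|) P := by
    refine hprod.mono' (Measurable.aestronglyMeasurable (by fun_prop))
      (Eventually.of_forall fun ω => ?_)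
    rw [Real.norm_eq_abs, abs_abs]
    exact h.abs_sub_le hη ω
  refine ⟨hint, (integral_mono hint hprod fun ω => h.abs_sub_le hη ω).trans ?_⟩
  rw [hindep.integral_fun_mul_eq_mul_integral igX.aestronglyMeasurable i3.aestronglyMeasurable,
    integral_indicator_one hem]
  exact mul_le_mul hgE h.measure_extra measureReal_nonneg (by norm_num)

end IsEnlargedCell

/-- Gaussian approximation of a weighted sum of rescaled height estimates over independent cells. -/
theorem norm_integral_exp_sum_sub_le {Ω : Type*} [MeasurableSpace Ω] {P : Measure Ω}
    [IsProbabilityMeasure P] {k : ℕ} {N' e N : Fin k → Ω → ℕ} {Y' Y : Fin k → Ω → ℝ} {β η : ℝ}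
    {m : Fin k → ℝ} (h : ∀ r, IsEnlargedCell P (N' r) (e r) (N r) (Y' r) (Y r) β (m r) η)
    (hind : iIndepFun (fun r ω => (N' r ω, Y' r ω)) P) (hη : 0 ≤ η) (hη1 : β * η ≤ 1)
    {Λ : ℝ} (hΛ : 0 < Λ) (hm : ∀ r, Λ ≤ β * m r)
    (t : Fin k → ℝ) {τ : ℝ} (hτ : τ ≤ 1) (ht : ∀ r, |t r| ≤ τ) :
    ‖∫ ω, Complex.exp (Complex.I *
        (∑ r, t r * (β * ((1 + 1 / (N r ω : ℝ)) * Y r ω) - β * m r) : ℝ)) ∂P -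
      Complex.exp (-((∑ r, t r ^ 2) / 2 : ℝ))‖ ≤
      6 * (β * η) * ∑ r, |t r| +
      √((∑ r, t r ^ 2) * (2 * Real.exp (-(Λ / 2)) + 4 / Λ) +
        ((∑ r, |t r|) * (2 * Real.exp (-(Λ / 2)))) ^ 2) +
      ((∑ r, |t r|) * Real.exp (-Λ) + 6 * τ * ∑ r, t r ^ 2) := by
  have m1 := fun r => (h r).uniform.measurable_count
  have m2 := fun r => (h r).uniform.measurable_max
  have m3 := fun r => (h r).measurable_count
  have m4 := fun r => (h r).measurable_max
  have hu := fun r => (h r).uniform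
  set A : Ω → ℝ := fun ω => ∑ r, t r * (β * ((1 + 1 / (N r ω : ℝ)) * Y r ω) - β * m r) with hA
  set B : Ω → ℝ := fun ω => ∑ r, t r * (1 - β * (m r - Y' r ω)) with hB
  have hAm : Measurable A := by fun_prop
  have hBm : Measurable B := by fun_prop
  set D : Fin k → Ω → ℝ := fun r ω => |β * ((1 + 1 / (N r ω : ℝ)) * Y r ω) -
      β * ((1 + 1 / (N' r ω : ℝ)) * Y' r ω)| with hD
  set S : Ω → ℝ := fun ω => ∑ r, t r * (β * Y' r ω / N' r ω - 1) with hS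
  have hDi : ∀ r, Integrable (D r) P := fun r =>
    ((h r).integrable_and_integral_abs_sub_le hη hη1).1
  have hSi : Integrable (fun ω => |S ω|) P := by
    refine Integrable.abs ?_
    refine integrable_finsetSum _ fun r _ => Integrable.const_mul ?_ _
    exact (hu r).integrable_max_div_count.sub (integrable_const _)
  have hDsum : Integrable (fun ω => ∑ r, |t r| * D r ω) P :=
    integrable_finsetSum _ fun r _ => (hDi r).const_mul _
  have hpt : ∀ ω, |A ω - B ω| ≤ ∑ r, |t r| * D r ω + |S ω| := by
    intro ω
    -- The difference from the exponential main term has two sources: the extra points, controlled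
    -- in `L¹`, and the count fluctuation `S`, controlled in `L²`.
    have : A ω - B ω = ∑ r, t r * (β * ((1 + 1 / (N r ω : ℝ)) * Y r ω) -
      β * ((1 + 1 / (N' r ω : ℝ)) * Y' r ω)) + S ω := by
      simp only [hA, hB, hS]
      rw [← Finset.sum_sub_distrib, ← Finset.sum_add_distrib]
      refine Finset.sum_congr rfl fun r _ => ?_
      ring
    rw [this]
    refine (abs_add_le _ _).trans (add_le_add_left ?_ _)
    refine (Finset.abs_sum_le_sum_abs _ _).trans (Finset.sum_le_sum fun r _ => ?_)
    rw [abs_mul]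
  have hABi : Integrable (fun ω => |A ω - B ω|) P := by
    refine (hDsum.add hSi).mono' (Measurable.aestronglyMeasurable (by fun_prop))
      (Eventually.of_forall fun ω => ?_)
    rw [Real.norm_eq_abs, abs_abs]
    exact hpt ω
  have b1 := norm_integral_exp_sub_integral_exp_le hAm hBm hABi
  have b2 := norm_integral_exp_sum_gap_sub_le hu hind t fun r => (ht r).trans hτ
  have b3 := integral_abs_sum_fluctuation_le hu hind t hΛ hm
  have b4 : ∫ ω, |A ω - B ω| ∂P ≤ 6 * (β * η) * ∑ r, |t r| + ∫ ω, |S ω| ∂P := by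
    refine (integral_mono hABi (hDsum.add hSi) hpt).trans ?_
    simp only [Pi.add_apply]
    rw [integral_add hDsum hSi, integral_finsetSum _ fun r _ => (hDi r).const_mul _]
    refine add_le_add_left ?_ _
    rw [Finset.mul_sum]
    refine Finset.sum_le_sum fun r _ => ?_
    rw [integral_const_mul, mul_comm]
    exact mul_le_mul_of_nonneg_right ((h r).integrable_and_integral_abs_sub_le hη hη1).2
      (abs_nonneg _)
  have b5 : ∑ r, (|t r| * Real.exp (-(β * m r)) + 6 * |t r| ^ 3) ≤
      (∑ r, |t r|) * Real.exp (-Λ) + 6 * τ * ∑ r, t r ^ 2 := by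
    rw [Finset.sum_add_distrib, Finset.sum_mul, Finset.mul_sum]
    refine add_le_add (Finset.sum_le_sum fun r _ => ?_) (Finset.sum_le_sum fun r _ => ?_)
    · have := hm r
      gcongr
    · have : |t r| ^ 3 = |t r| * t r ^ 2 := by rw [pow_succ', sq_abs]
      rw [this, mul_assoc]
      have := mul_le_mul_of_nonneg_right (ht r) (sq_nonneg (t r))
      linarith
  refine (norm_sub_le_norm_sub_add_norm_sub _ _ _).trans (add_le_add (b1.trans ?_) (b2.trans b5))
  linarith

/-! ### Geometry of cube partitions -/

section Cubes

variable {d k : ℕ}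

lemma measurableSet_coordinate_box {J : Fin d → Set ℝ} (hJ : ∀ j, MeasurableSet (J j)) :
    MeasurableSet {x : EuclideanSpace ℝ (Fin d) | ∀ j, x j ∈ J j} := by
  have : {x : EuclideanSpace ℝ (Fin d) | ∀ j, x j ∈ J j} =
      ⋂ j, (fun x : EuclideanSpace ℝ (Fin d) => x j) ⁻¹' J j := by ext; simp
  rw [this]
  exact MeasurableSet.iInter fun j => (by fun_prop : Measurable fun x : EuclideanSpace ℝ (Fin d) => x j) (hJ j)

lemma volume_coordinate_box {J : Fin d → Set ℝ} (hJ : ∀ j, MeasurableSet (J j)) :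
    volume {x : EuclideanSpace ℝ (Fin d) | ∀ j, x j ∈ J j} = ∏ j, volume (J j) := by
  have h := (PiLp.volume_preserving_ofLp (Fin d)).measure_preimage
    (MeasurableSet.univ_pi hJ).nullMeasurableSet
  rw [volume_pi_pi] at h
  rw [← h]
  congr 1
  ext x
  simp

lemma isCompact_unitCube (d : ℕ) : IsCompact (unitCube d) := by
  have h : IsCompact (Set.univ.pi fun _ : Fin d => Set.Icc (0 : ℝ) 1) :=
    isCompact_univ_pi fun _ => isCompact_Icc
  have e : unitCube d = (EuclideanSpace.equiv (Fin d) ℝ).symm ''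
      (Set.univ.pi fun _ : Fin d => Set.Icc (0 : ℝ) 1) := by
    ext x
    constructor
    · intro hx
      exact ⟨x, fun j _ => hx j, rfl⟩
    · rintro ⟨y, hy, rfl⟩ j
      exact hy j (Set.mem_univ j)
  rw [e]
  exact h.image (EuclideanSpace.equiv (Fin d) ℝ).symm.continuous

namespace IsCubePartition

variable {I : Fin k → Set (EuclideanSpace ℝ (Fin d))}

lemma measurableSet_cell (h : IsCubePartition d k I) (r : Fin k) : MeasurableSet (I r) := by
  obtain ⟨J, hJ, hI⟩ := h.cell r
  rw [hI]
  exact measurableSet_coordinate_box fun j => (hJ j).1.measurableSet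

lemma cell_subset (h : IsCubePartition d k I) (r : Fin k) : I r ⊆ unitCube d := by
  rw [← h.cover]
  exact Set.subset_iUnion I r

lemma card_pos (h : IsCubePartition d k I) : 0 < k := by
  have h0 : (0 : EuclideanSpace ℝ (Fin d)) ∈ unitCube d := fun j => by simp
  rw [← h.cover] at h0
  obtain ⟨r, -⟩ := Set.mem_iUnion.mp h0
  exact r.pos

lemma volume_cell (hd : 0 < d) (h : IsCubePartition d k I) (r : Fin k) :
    volume (I r) = ENNReal.ofReal (1 / k) := by
  obtain ⟨J, hJ, hI⟩ := h.cell r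
  have hk : (0 : ℝ) < k := by exact_mod_cast h.card_pos
  rw [hI, volume_coordinate_box fun j => (hJ j).1.measurableSet]
  simp_rw [fun j => (hJ j).2]
  rw [Finset.prod_const, Finset.card_univ, Fintype.card_fin, ← ENNReal.ofReal_pow (by positivity),
    ← Real.rpow_natCast, ← Real.rpow_mul hk.le]
  have : (-(1 / (d : ℝ)) * d) = -1 := by
    field_simp
  rw [this, Real.rpow_neg_one, one_div]

lemma nonempty_cell (hd : 0 < d) (h : IsCubePartition d k I) (r : Fin k) : (I r).Nonempty := by
  have hk : (0 : ℝ) < k := by exact_mod_cast h.card_pos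
  refine nonempty_of_measure_ne_zero (μ := volume) ?_
  rw [h.volume_cell hd]
  simpa using h.card_pos.ne'

lemma dist_le (h : IsCubePartition d k I) (r : Fin k) {s t : EuclideanSpace ℝ (Fin d)}
    (hs : s ∈ I r) (ht : t ∈ I r) : dist s t ≤ √d * (k : ℝ) ^ (-(1 / (d : ℝ))) := by
  obtain ⟨J, hJ, hI⟩ := h.cell r
  rw [hI] at hs ht
  have hδ : 0 ≤ (k : ℝ) ^ (-(1 / (d : ℝ))) := by positivity
  have hj : ∀ j, dist (s j) (t j) ^ 2 ≤ ((k : ℝ) ^ (-(1 / (d : ℝ)))) ^ 2 := by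
    intro j
    have hsub : Set.uIcc (s j) (t j) ⊆ J j := (hJ j).1.uIcc_subset (hs j) (ht j)
    have hv := measure_mono (μ := volume) hsub
    rw [Real.volume_interval, (hJ j).2] at hv
    have := (ENNReal.ofReal_le_ofReal_iff hδ).mp hv
    rw [dist_comm, Real.dist_eq]
    exact pow_le_pow_left₀ (abs_nonneg _) this 2
  rw [EuclideanSpace.dist_eq]
  refine (Real.sqrt_le_sqrt (Finset.sum_le_sum fun j _ => hj j)).trans ?_
  rw [Finset.sum_const, Finset.card_univ, Fintype.card_fin, nsmul_eq_mul,
    Real.sqrt_mul (by positivity), Real.sqrt_sq hδ]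

end IsCubePartition

end Cubes

/-! ### Poisson cells under the graph of `f` -/

section Intensity

variable {d : ℕ} {f : EuclideanSpace ℝ (Fin d) → ℝ}

/-- Continuity is assumed only on `A`, so `f` is replaced off `A` by `0`, which gives a globally
measurable function with the same region. -/
lemma measurableSet_hypographOver {A : Set (EuclideanSpace ℝ (Fin d))} (hA : MeasurableSet A)
    (hf : ContinuousOn f A) : MeasurableSet (hypographOver A f) := by
  classical
  have hF : Measurable (A.piecewise f 0) := hf.measurable_piecewise continuousOn_const hA
  have := measurableSet_region_between_cc (f := fun _ => (0 : ℝ)) measurable_const hF hA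
  convert! this using 1
  ext z
  simp only [hypographOver, Set.mem_ofPred_eq, Set.mem_Icc]
  constructor
  · rintro ⟨h1, h2, h3⟩; exact ⟨h1, h2, by rwa [Set.piecewise_eq_of_mem _ _ _ h1]⟩
  · rintro ⟨h1, h2, h3⟩; exact ⟨h1, h2, by rwa [Set.piecewise_eq_of_mem _ _ _ h1] at h3⟩

lemma hypographIntensity_prod (a : ℝ) {I : Set (EuclideanSpace ℝ (Fin d))} (hI : I ⊆ unitCube d)
    {B : Set ℝ} (hB : ∀ x ∈ I, ∀ y ∈ B, 0 ≤ y ∧ y ≤ f x) :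
    hypographIntensity a f (I ×ˢ B) = ENNReal.ofReal a * (volume I * volume B) := by
  unfold hypographIntensity
  have hsub : I ×ˢ B ⊆ hypographOver (unitCube d) f :=
    fun z hz => ⟨hI hz.1, hB _ hz.1 _ hz.2⟩
  rw [Measure.smul_apply, Measure.restrict_eq_self _ hsub, Measure.prod_prod, Measure.restrict_eq_self _ hI,
    smul_eq_mul]

lemma hypographIntensity_le (a : ℝ) {I : Set (EuclideanSpace ℝ (Fin d))}
    {B : Set ℝ} {D : Set (EuclideanSpace ℝ (Fin d) × ℝ)} (hD : D ⊆ I ×ˢ B) :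
    hypographIntensity a f D ≤ ENNReal.ofReal a * (volume I * volume B) := by
  unfold hypographIntensity
  rw [Measure.smul_apply, smul_eq_mul]
  gcongr
  refine (Measure.restrict_apply_le _ _).trans ((measure_mono hD).trans ?_)
  rw [Measure.prod_prod]
  exact mul_le_mul_left (Measure.restrict_apply_le _ _) _

/-- A cell above which `f` stays within `η` of the constant `m` is an enlargement of the flat cell
of height `m`. -/
lemma IsPoissonPointProcess.isEnlargedCell {Ω : Type*} [MeasurableSpace Ω] {P : Measure Ω}
    [IsProbabilityMeasure P] {N : Ω → Multiset (EuclideanSpace ℝ (Fin d) × ℝ)} {a : ℝ}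
    (h : IsPoissonPointProcess P N (hypographIntensity a f)) (ha : 0 < a)
    {I : Set (EuclideanSpace ℝ (Fin d))} (hI : MeasurableSet I) (hIc : I ⊆ unitCube d)
    (hf : ContinuousOn f I) {v : ℝ} (hv : 0 < v) (hvol : volume I = ENNReal.ofReal v)
    {m η : ℝ} (hm : 0 < m) (hη : 0 ≤ η) (hmf : ∀ x ∈ I, m ≤ f x) (hfm : ∀ x ∈ I, f x ≤ m + η) :
    IsEnlargedCell P (fun ω => pointCount (N ω) (I ×ˢ Set.Icc 0 m))
      (fun ω => pointCount (N ω) (hypographOver I f \ I ×ˢ Set.Icc 0 m))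
      (fun ω => pointCount (N ω) (hypographOver I f))
      (fun ω => maxOrdinate (N ω) (I ×ˢ Set.Icc 0 m))
      (fun ω => maxOrdinate (N ω) (hypographOver I f)) (a * v) m η := by
  have hH : MeasurableSet (hypographOver I f) := measurableSet_hypographOver hI hf
  have hF : MeasurableSet (I ×ˢ Set.Icc 0 m) := hI.prod measurableSet_Icc
  have hE : MeasurableSet (hypographOver I f \ I ×ˢ Set.Icc 0 m) := hH.diff hF
  have hsub : I ×ˢ Set.Icc 0 m ⊆ hypographOver I f :=
    fun z hz => ⟨hz.1, hz.2.1, hz.2.2.trans (hmf _ hz.1)⟩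
  have hdis : Disjoint (I ×ˢ Set.Icc 0 m) (hypographOver I f \ I ×ˢ Set.Icc 0 m) :=
    Set.disjoint_sdiff_right
  have hun : I ×ˢ Set.Icc 0 m ∪ (hypographOver I f \ I ×ˢ Set.Icc 0 m) = hypographOver I f :=
    Set.union_sdiff_cancel hsub
  have h0H : ∀ z ∈ hypographOver I f, 0 ≤ z.2 := fun z hz => hz.2.1
  have hrect : ∀ B : Set ℝ, B ⊆ Set.Icc 0 m → ∀ l : ℝ, 0 ≤ l → volume B = ENNReal.ofReal l →
      hypographIntensity a f (I ×ˢ B) = ENNReal.ofReal (a * v * l) := by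
    intro B hB l hl hBl
    rw [hypographIntensity_prod a hIc fun x hx y hy => ⟨(hB hy).1, (hB hy).2.trans (hmf x hx)⟩,
      hvol, hBl, ← ENNReal.ofReal_mul hv.le, ← ENNReal.ofReal_mul ha.le, mul_assoc]
  refine ⟨h.isUniformCell hI (mul_pos ha hv) hm ?_ ?_, h.measurable_count _ hE,
    h.measurable_maxOrdinate hH h0H, ?_, ?_, ?_, ?_, ?_, ?_⟩
  · intro y hy hym
    exact hrect _ (Set.Icc_subset_Icc_right hym) y hy (by simp)
  · intro y hy hym
    exact hrect _ (fun u hu => ⟨hy.trans hu.1.le, hu.2⟩) (m - y) (by linarith) (by simp)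
  · intro ω
    rw [← pointCount_union _ hdis, hun]
  · intro ω hω
    have := maxOrdinate_union_of_pointCount_eq_zero (A := I ×ˢ Set.Icc 0 m) hω
    rwa [hun] at this
  · intro ω
    exact maxOrdinate_le _ (by linarith) fun z hz => hz.2.2.trans (hfm _ hz.1)
  · intro ω
    refine (maxOrdinate_le_iff _ _ (maxOrdinate_nonneg _ h0H)).mpr ?_
    rw [pointCount_eq_zero_iff]
    rintro z hz ⟨hzF, hzlt⟩
    rw [Set.mem_ofPred_eq] at hzlt
    exact absurd (le_maxOrdinate hz (hsub hzF)) (not_le.mpr hzlt)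
  -- The flat cell and the leftover region are disjoint, so their (count, maximum) pairs are
  -- independent; only the count of the second is kept.
  · have hi := h.iIndepFun_count_maxOrdinate
      ![I ×ˢ Set.Icc 0 m, hypographOver I f \ I ×ˢ Set.Icc 0 m]
      (fun i => by fin_cases i <;> simp [hF, hE])
      (fun i z hz => by
        fin_cases i
        · exact hz.2.1
        · exact h0H z hz.1)
      (fun i j hij => by
        fin_cases i <;> fin_cases j <;> simp [hdis, hdis.symm] at hij ⊢)
    have h2 := hi.indepFun (i := 0) (j := 1) (by decide)
    exact h2.comp measurable_id measurable_fst
  · have hav : 0 ≤ a * v * η := by positivity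
    refine h.measure_count_pos_le hE hav ?_
    -- The leftover region lies in a slab of height `η`, hence has mean count at most `a * v * η`.
    refine (hypographIntensity_le a (I := I) (B := Set.Ioc m (m + η)) ?_).trans ?_
    · rintro z ⟨hz, hz'⟩
      refine ⟨hz.1, ?_, hz.2.2.trans (hfm _ hz.1)⟩
      by_contra hle
      exact hz' ⟨hz.1, hz.2.1, not_lt.mp hle⟩
    · rw [hvol, Real.volume_Ioc, add_sub_cancel_left, ← ENNReal.ofReal_mul hv.le,
        ← ENNReal.ofReal_mul ha.le, mul_assoc]

end Intensity

/-! ### Cell averages of Lipschitz functions -/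

section CellAverages

variable {d k : ℕ} {I : Fin k → Set (EuclideanSpace ℝ (Fin d))}
  {g : EuclideanSpace ℝ (Fin d) → ℝ}

lemma IsCubePartition.sum_setIntegral (h : IsCubePartition d k I) (hg : Integrable g)
    (hsupp : ∀ t, g t ≠ 0 → t ∈ unitCube d) : ∑ r, ∫ t in I r, g t = ∫ t, g t := by
  rw [← integral_iUnion_fintype h.measurableSet_cell h.disjoint fun r => hg.integrableOn, h.cover]
  refine setIntegral_eq_integral_of_forall_compl_eq_zero fun t ht => ?_
  by_contra h0
  exact ht (hsupp t h0)

lemma IsCubePartition.volume_real_cell (hd : 0 < d) (h : IsCubePartition d k I) (r : Fin k) :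
    volume.real (I r) = 1 / k := by
  rw [measureReal_def, h.volume_cell hd, ENNReal.toReal_ofReal (by positivity)]

lemma IsCubePartition.setIntegral_le (hd : 0 < d) (h : IsCubePartition d k I) (r : Fin k) {M : ℝ}
    (hM : ∀ t, |g t| ≤ M) : ∫ t in I r, g t ≤ M / k := by
  have hfin : volume (I r) < ∞ := by rw [h.volume_cell hd]; exact ENNReal.ofReal_lt_top
  have := norm_setIntegral_le_of_norm_le_const hfin (f := g) (C := M) fun t _ => hM t
  rw [h.volume_real_cell hd] at this
  exact (le_abs_self _).trans (this.trans_eq (by ring))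

/-- Replacing a Lipschitz function by its cell averages hardly changes its `L²` norm. -/
lemma IsCubePartition.abs_sum_sq_setIntegral_sub_le (hd : 0 < d) (h : IsCubePartition d k I)
    (hg : Integrable g) (hg2 : Integrable fun t => g t ^ 2) (hg0 : ∀ t, 0 ≤ g t)
    (hsupp : ∀ t, g t ≠ 0 → t ∈ unitCube d) {L : ℝ} (hL : 0 ≤ L)
    (hlip : ∀ s t, |g s - g t| ≤ L * dist s t) :
    |k * ∑ r, (∫ t in I r, g t) ^ 2 - ∫ t, g t ^ 2| ≤
      L * (√d * (k : ℝ) ^ (-(1 / (d : ℝ)))) * ∫ t, g t := by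
  set D := √d * (k : ℝ) ^ (-(1 / (d : ℝ))) with hD
  have hk : (0 : ℝ) < k := by exact_mod_cast h.card_pos
  have hsupp2 : ∀ t, g t ^ 2 ≠ 0 → t ∈ unitCube d := fun t ht => hsupp t (by
    contrapose! ht; rw [ht]; norm_num)
  rw [← h.sum_setIntegral hg hsupp, ← h.sum_setIntegral hg2 hsupp2, Finset.mul_sum,
    ← Finset.sum_sub_distrib, Finset.mul_sum]
  refine (Finset.abs_sum_le_sum_abs _ _).trans (Finset.sum_le_sum fun r _ => ?_)
  set w := ∫ t in I r, g t with hw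
  have hfin : volume (I r) < ∞ := by rw [h.volume_cell hd]; exact ENNReal.ofReal_lt_top
  have : IsFiniteMeasure (volume.restrict (I r)) := ⟨by simpa using hfin⟩
  -- Since the cell has volume `1 / k`, `k * w` is the average of `g` over it.
  have havg : ∀ t ∈ I r, |k * w - g t| ≤ L * D := by
    intro t ht
    have e : k * w - g t = k * ∫ s in I r, (g s - g t) := by
      rw [integral_sub hg.integrableOn (integrable_const _), setIntegral_const,
        h.volume_real_cell hd, mul_sub, smul_eq_mul]
      field_simp
      rfl
    rw [e, abs_mul, abs_of_pos hk]
    have hb := norm_setIntegral_le_of_norm_le_const hfin (f := fun s => g s - g t) (C := L * D)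
      fun s hs => (hlip s t).trans (mul_le_mul_of_nonneg_left (h.dist_le r hs ht) hL)
    rw [h.volume_real_cell hd, Real.norm_eq_abs] at hb
    calc (k : ℝ) * |∫ s in I r, (g s - g t)| ≤ k * (L * D * (1 / k)) := by gcongr
      _ = L * D := by field_simp
  -- Keeping one factor `g` makes the errors sum to a multiple of `∫ g`, instead of the volume of
  -- the cube.
  have e : k * w ^ 2 - ∫ t in I r, g t ^ 2 = ∫ t in I r, g t * (k * w - g t) := by
    have : (fun t => g t * (k * w - g t)) = fun t => g t * (k * w) - g t ^ 2 := by ext t; ring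
    rw [this, integral_sub (hg.integrableOn.mul_const _) hg2.integrableOn, integral_mul_const]
    ring
  rw [e]
  have hb := norm_integral_le_of_norm_le (μ := volume.restrict (I r))
    (f := fun t => g t * (k * w - g t)) (g := fun t => g t * (L * D))
    (hg.integrableOn.mul_const _) (by
      filter_upwards [ae_restrict_mem (h.measurableSet_cell r)] with t ht
      rw [norm_mul, Real.norm_of_nonneg (hg0 t)]
      exact mul_le_mul_of_nonneg_left (havg t ht) (hg0 t))
  rw [integral_mul_const, Real.norm_eq_abs] at hb
  linarith

end CellAverages

/-! ### The rescaled kernel -/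

section ParzenKernel

variable {d : ℕ} {K : EuclideanSpace ℝ (Fin d) → ℝ}

/-- Quantitative data of a compactly supported Lipschitz kernel: radius, bound and Lipschitz
constant. -/
lemma IsLipschitzParzenKernel.exists_bounds (hK : IsLipschitzParzenKernel K) :
    ∃ R M L : ℝ, 0 < R ∧ 0 ≤ M ∧ 0 ≤ L ∧ (∀ u, K u ≠ 0 → ‖u‖ ≤ R) ∧ (∀ u, |K u| ≤ M) ∧
      ∀ u v, |K u - K v| ≤ L * dist u v := by
  obtain ⟨L, hL⟩ := hK.lipschitz
  obtain ⟨R, hR⟩ := hK.compact_support.isBounded.subset_closedBall 0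
  obtain ⟨M, hM⟩ := hK.compact_support.exists_bound_of_continuous hL.continuous
  -- The maximum with 1 makes the radius positive.
  refine ⟨max R 1, M, L, by positivity, (norm_nonneg _).trans (hM 0), L.2, fun u hu => ?_, hM,
    fun u v => ?_⟩
  · have := hR (subset_tsupport K hu)
    rw [mem_closedBall_zero_iff] at this
    exact this.trans (le_max_left _ _)
  · rw [← Real.dist_eq]
    exact hL.dist_le_mul u v

lemma IsLipschitzParzenKernel.continuous (hK : IsLipschitzParzenKernel K) : Continuous K := by
  obtain ⟨L, hL⟩ := hK.lipschitz
  exact hL.continuous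

lemma integral_comp_rescale (G : EuclideanSpace ℝ (Fin d) → ℝ) {h : ℝ} (hh : 0 < h)
    (x : EuclideanSpace ℝ (Fin d)) : ∫ t, G ((1 / h) • (x - t)) = h ^ d * ∫ u, G u := by
  rw [integral_sub_left_eq_self (fun u => G ((1 / h) • u)) volume x, Measure.integral_comp_smul,
    finrank_euclideanSpace_fin, smul_eq_mul, abs_of_pos (by positivity)]
  congr 1
  rw [one_div, inv_pow, inv_inv]

variable {h : ℝ} (x : EuclideanSpace ℝ (Fin d))

lemma integral_rescaledKernel (hK : IsLipschitzParzenKernel K) (hh : 0 < h) :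
    ∫ t, rescaledKernel K h x t = 1 := by
  unfold rescaledKernel
  rw [integral_const_mul, integral_comp_rescale K hh, hK.integral_eq_one]
  field_simp

lemma integral_rescaledKernel_sq (hh : 0 < h) :
    ∫ t, rescaledKernel K h x t ^ 2 = (∫ u, K u ^ 2) / h ^ d := by
  unfold rescaledKernel
  simp_rw [mul_pow]
  rw [integral_const_mul, integral_comp_rescale (fun u => K u ^ 2) hh]
  field_simp

lemma continuous_rescaledKernel (hK : IsLipschitzParzenKernel K) (h : ℝ) :
    Continuous (rescaledKernel K h x) := by
  have := hK.continuous
  unfold rescaledKernel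
  fun_prop

lemma norm_sub_le_of_rescaledKernel_ne_zero (hh : 0 < h) {R : ℝ} (hR : ∀ u, K u ≠ 0 → ‖u‖ ≤ R)
    {t : EuclideanSpace ℝ (Fin d)} (ht : rescaledKernel K h x t ≠ 0) : dist x t ≤ h * R := by
  have h1 := hR _ (right_ne_zero_of_mul ht)
  rw [norm_smul, Real.norm_of_nonneg (by positivity), one_div, inv_mul_le_iff₀ hh] at h1
  rwa [dist_eq_norm]

lemma hasCompactSupport_rescaledKernel (hK : IsLipschitzParzenKernel K) (hh : 0 < h) :
    HasCompactSupport (rescaledKernel K h x) := by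
  obtain ⟨R, M, L, -, -, -, hR, -⟩ := hK.exists_bounds
  refine HasCompactSupport.of_support_subset_isCompact (isCompact_closedBall x (h * R)) ?_
  intro t ht
  rw [Metric.mem_closedBall, dist_comm]
  exact norm_sub_le_of_rescaledKernel_ne_zero x hh hR ht

lemma integrable_rescaledKernel (hK : IsLipschitzParzenKernel K) (hh : 0 < h) :
    Integrable (rescaledKernel K h x) :=
  (continuous_rescaledKernel x hK h).integrable_of_hasCompactSupport
    (hasCompactSupport_rescaledKernel x hK hh)

lemma integrable_rescaledKernel_sq (hK : IsLipschitzParzenKernel K) (hh : 0 < h) :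
    Integrable (fun t => rescaledKernel K h x t ^ 2) := by
  have e : (fun t => rescaledKernel K h x t ^ 2) =
      rescaledKernel K h x * rescaledKernel K h x := by
    ext t
    rw [Pi.mul_apply, sq]
  rw [e]
  have hc := continuous_rescaledKernel x hK h
  exact (hc.mul hc).integrable_of_hasCompactSupport
    (hasCompactSupport_rescaledKernel x hK hh).mul_left

lemma rescaledKernel_nonneg (hK : IsLipschitzParzenKernel K) (hh : 0 < h)
    (t : EuclideanSpace ℝ (Fin d)) : 0 ≤ rescaledKernel K h x t :=
  mul_nonneg (by positivity) (hK.nonneg _)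

lemma abs_rescaledKernel_le (hh : 0 < h) {M : ℝ} (hM : ∀ u, |K u| ≤ M)
    (t : EuclideanSpace ℝ (Fin d)) : |rescaledKernel K h x t| ≤ M / h ^ d := by
  unfold rescaledKernel
  rw [abs_mul, abs_of_pos (by positivity), one_div, inv_mul_eq_div]
  gcongr
  exact hM _

lemma abs_rescaledKernel_sub_le (hh : 0 < h) {L : ℝ}
    (hL : ∀ u v, |K u - K v| ≤ L * dist u v) (s t : EuclideanSpace ℝ (Fin d)) :
    |rescaledKernel K h x s - rescaledKernel K h x t| ≤ L / h ^ (d + 1) * dist s t := by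
  unfold rescaledKernel
  rw [← mul_sub, abs_mul, abs_of_pos (by positivity)]
  have h1 := hL ((1 / h) • (x - s)) ((1 / h) • (x - t))
  rw [dist_smul₀, Real.norm_of_nonneg (by positivity), dist_sub_left] at h1
  calc 1 / h ^ d * |K ((1 / h) • (x - s)) - K ((1 / h) • (x - t))|
      ≤ 1 / h ^ d * (L * (1 / h * dist s t)) := by gcongr
    _ = L / h ^ (d + 1) * dist s t := by rw [pow_succ]; field_simp

end ParzenKernel

/-! ### Kernel weights of the cells -/

section KernelWeights

variable {d k : ℕ}

/-- The weight `∫_{I_r} h^{-d} K((x - t)/h) dt` of the cell `I r`. -/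
noncomputable def kernelWeight (K : EuclideanSpace ℝ (Fin d) → ℝ) (h : ℝ)
    (I : Fin k → Set (EuclideanSpace ℝ (Fin d))) (x : EuclideanSpace ℝ (Fin d)) (r : Fin k) : ℝ :=
  ∫ t in I r, rescaledKernel K h x t

variable {K : EuclideanSpace ℝ (Fin d) → ℝ} {h : ℝ} {I : Fin k → Set (EuclideanSpace ℝ (Fin d))}
  {x : EuclideanSpace ℝ (Fin d)}

lemma kernelWeight_nonneg (hK : IsLipschitzParzenKernel K) (hh : 0 < h) (r : Fin k) :
    0 ≤ kernelWeight K h I x r :=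
  integral_nonneg fun t => rescaledKernel_nonneg x hK hh t

lemma exists_mem_of_kernelWeight_ne_zero (hh : 0 < h) {R : ℝ}
    (hR : ∀ u, K u ≠ 0 → ‖u‖ ≤ R) {r : Fin k} (hr : kernelWeight K h I x r ≠ 0) :
    ∃ t ∈ I r, dist x t ≤ h * R := by
  by_contra! hcon
  refine hr (setIntegral_eq_zero_of_forall_eq_zero fun t ht => ?_)
  by_contra h0
  exact absurd (norm_sub_le_of_rescaledKernel_ne_zero x hh hR h0) (not_le.mpr (hcon t ht))

/-- The window around `x` stays inside the cube, so no kernel mass is lost at the boundary and the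
estimate is a weighted average of cell estimates. -/
lemma sum_kernelWeight (hI : IsCubePartition d k I) (hK : IsLipschitzParzenKernel K) (hh : 0 < h)
    {R : ℝ} (hR : ∀ u, K u ≠ 0 → ‖u‖ ≤ R) (hx : Metric.closedBall x (h * R) ⊆ unitCube d) :
    ∑ r, kernelWeight K h I x r = 1 := by
  rw [← integral_rescaledKernel x hK hh]
  refine hI.sum_setIntegral (integrable_rescaledKernel x hK hh) fun t ht => hx ?_
  rw [Metric.mem_closedBall, dist_comm]
  exact norm_sub_le_of_rescaledKernel_ne_zero x hh hR ht

/-- No cell dominates: after multiplication by `√(h^d k)` every weight is at most `M / √(h^d k)`. -/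
lemma kernelWeight_le (hd : 0 < d) (hI : IsCubePartition d k I) (hh : 0 < h) {M : ℝ}
    (hM : ∀ u, |K u| ≤ M) (r : Fin k) : kernelWeight K h I x r ≤ M / (h ^ d * k) := by
  refine (hI.setIntegral_le hd r (abs_rescaledKernel_le x hh hM)).trans_eq ?_
  rw [div_div]

/-- The variance at one point. Replacing the kernel by its cell averages costs the ratio of cell
size to bandwidth, while rescaling turns `∫ K²` into `∫ K² / h^d`. -/
lemma abs_sum_kernelWeight_sq_sub_le (hd : 0 < d) (hI : IsCubePartition d k I)
    (hK : IsLipschitzParzenKernel K) (hh : 0 < h)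
    {R L : ℝ} (hR : ∀ u, K u ≠ 0 → ‖u‖ ≤ R) (hL0 : 0 ≤ L)
    (hL : ∀ u v, |K u - K v| ≤ L * dist u v) (hx : Metric.closedBall x (h * R) ⊆ unitCube d) :
    |h ^ d * k * ∑ r, kernelWeight K h I x r ^ 2 - ∫ u, K u ^ 2| ≤
      L * (√d * (k : ℝ) ^ (-(1 / (d : ℝ)))) / h := by
  have h1 := hI.abs_sum_sq_setIntegral_sub_le hd (integrable_rescaledKernel x hK hh)
    (integrable_rescaledKernel_sq x hK hh) (rescaledKernel_nonneg x hK hh) (fun t ht => hx (by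
      rw [Metric.mem_closedBall, dist_comm]
      exact norm_sub_le_of_rescaledKernel_ne_zero x hh hR ht))
    (by positivity) (abs_rescaledKernel_sub_le x hh hL)
  rw [integral_rescaledKernel x hK hh, integral_rescaledKernel_sq x hh, mul_one] at h1
  have hpos : 0 < h ^ d := by positivity
  have e : h ^ d * k * ∑ r, kernelWeight K h I x r ^ 2 - ∫ u, K u ^ 2 =
      h ^ d * (k * ∑ r, (∫ t in I r, rescaledKernel K h x t) ^ 2 - (∫ u, K u ^ 2) / h ^ d) := by
    unfold kernelWeight
    field_simp
  rw [e, abs_mul, abs_of_pos hpos]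
  refine (mul_le_mul_of_nonneg_left h1 hpos.le).trans_eq ?_
  rw [pow_succ]
  field_simp

/-- A cell meeting both windows would put the two points within two window radii plus one cell
diameter. This makes the limiting covariance diagonal. -/
lemma kernelWeight_mul_eq_zero (hI : IsCubePartition d k I) (hh : 0 < h) {R : ℝ}
    (hR : ∀ u, K u ≠ 0 → ‖u‖ ≤ R) {y : EuclideanSpace ℝ (Fin d)}
    (hxy : 2 * (h * R) + √d * (k : ℝ) ^ (-(1 / (d : ℝ))) < dist x y) (r : Fin k) :
    kernelWeight K h I x r * kernelWeight K h I y r = 0 := by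
  by_contra h0
  obtain ⟨s, hs, hsx⟩ := exists_mem_of_kernelWeight_ne_zero hh hR (left_ne_zero_of_mul h0)
  obtain ⟨t, ht, hty⟩ := exists_mem_of_kernelWeight_ne_zero hh hR (right_ne_zero_of_mul h0)
  have h1 := hI.dist_le r hs ht
  have h2 := dist_triangle4 x s t y
  rw [dist_comm t y] at h2
  linarith

end KernelWeights

/-! ### Gaussian approximation at a fixed sample size -/

section FixedSampleSize

variable {d k : ℕ}

lemma HolderOnWith.abs_sub_le {E : Type*} [PseudoMetricSpace E] {f : E → ℝ} {C α : ℝ≥0} {A : Set E}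
    (hf : HolderOnWith C α f A) {s t : E} (hs : s ∈ A) (ht : t ∈ A) :
    |f s - f t| ≤ C * dist s t ^ (α : ℝ) := by
  have h := hf.edist_le hs ht
  rw [edist_dist, edist_dist, ENNReal.ofReal_rpow_of_nonneg dist_nonneg α.coe_nonneg,
    ← ENNReal.ofReal_coe_nnreal, ← ENNReal.ofReal_mul C.coe_nonneg] at h
  rw [← Real.dist_eq]
  exact (ENNReal.ofReal_le_ofReal_iff (by positivity)).mp h

variable {I : Fin k → Set (EuclideanSpace ℝ (Fin d))} {f : EuclideanSpace ℝ (Fin d) → ℝ}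
  {C α : ℝ≥0} {f₀ : ℝ}

lemma IsCubePartition.le_sInf_image (hd : 0 < d) (hI : IsCubePartition d k I)
    (hf₀ : ∀ x ∈ unitCube d, f₀ ≤ f x) (r : Fin k) : f₀ ≤ sInf (f '' I r) := by
  refine le_csInf ((hI.nonempty_cell hd r).image f) ?_
  rintro _ ⟨x, hx, rfl⟩
  exact hf₀ x (hI.cell_subset r hx)

lemma IsCubePartition.sInf_image_le (hI : IsCubePartition d k I)
    (hf₀ : ∀ x ∈ unitCube d, f₀ ≤ f x) (r : Fin k) {x : EuclideanSpace ℝ (Fin d)} (hx : x ∈ I r) :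
    sInf (f '' I r) ≤ f x := by
  refine csInf_le ⟨f₀, ?_⟩ ⟨x, hx, rfl⟩
  rintro _ ⟨y, hy, rfl⟩
  exact hf₀ y (hI.cell_subset r hy)

/-- The oscillation of `f` over a cell is bounded by the Hölder modulus at the cell diameter; this
is the height `η` available to extra points above the flat cell. -/
lemma IsCubePartition.le_sInf_image_add (hd : 0 < d) (hI : IsCubePartition d k I)
    (hf : HolderOnWith C α f (unitCube d)) (r : Fin k) {x : EuclideanSpace ℝ (Fin d)}
    (hx : x ∈ I r) :
    f x ≤ sInf (f '' I r) + C * (√d * (k : ℝ) ^ (-(1 / (d : ℝ)))) ^ (α : ℝ) := by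
  rw [← sub_le_iff_le_add]
  refine le_csInf ((hI.nonempty_cell hd r).image f) ?_
  rintro _ ⟨y, hy, rfl⟩
  have h1 := hf.abs_sub_le (hI.cell_subset r hx) (hI.cell_subset r hy)
  have h2 : (C : ℝ) * dist x y ^ (α : ℝ) ≤
      C * (√d * (k : ℝ) ^ (-(1 / (d : ℝ)))) ^ (α : ℝ) := by
    gcongr
    exact hI.dist_le r hx hy
  have := le_abs_self (f x - f y)
  linarith

variable {K : EuclideanSpace ℝ (Fin d) → ℝ} {h R M : ℝ}

/-- Bias of the estimate: Hölder continuity at the scales of the kernel and of the cells. -/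
lemma abs_sum_kernelWeight_mul_sInf_sub_le (hd : 0 < d) (hI : IsCubePartition d k I)
    (hK : IsLipschitzParzenKernel K) (hh : 0 < h) (hR0 : 0 ≤ R) (hR : ∀ u, K u ≠ 0 → ‖u‖ ≤ R)
    (hf : HolderOnWith C α f (unitCube d)) (hf₀ : ∀ x ∈ unitCube d, f₀ ≤ f x)
    {x : EuclideanSpace ℝ (Fin d)} (hx : Metric.closedBall x (h * R) ⊆ unitCube d) :
    |∑ r, kernelWeight K h I x r * sInf (f '' I r) - f x| ≤
      C * (√d * (k : ℝ) ^ (-(1 / (d : ℝ)))) ^ (α : ℝ) + C * (h * R) ^ (α : ℝ) := by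
  set B := C * (√d * (k : ℝ) ^ (-(1 / (d : ℝ)))) ^ (α : ℝ) + C * (h * R) ^ (α : ℝ) with hB
  have hsum := sum_kernelWeight hI hK hh hR hx
  have hxc : x ∈ unitCube d := hx (Metric.mem_closedBall_self (by positivity))
  have e : ∑ r, kernelWeight K h I x r * sInf (f '' I r) - f x =
      ∑ r, kernelWeight K h I x r * (sInf (f '' I r) - f x) := by
    simp_rw [mul_sub]
    rw [Finset.sum_sub_distrib, ← Finset.sum_mul, hsum, one_mul]
  rw [e]
  calc |∑ r, kernelWeight K h I x r * (sInf (f '' I r) - f x)|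
      ≤ ∑ r, |kernelWeight K h I x r * (sInf (f '' I r) - f x)| := Finset.abs_sum_le_sum_abs _ _
    _ ≤ ∑ r, kernelWeight K h I x r * B := by
        refine Finset.sum_le_sum fun r _ => ?_
        rw [abs_mul, abs_of_nonneg (kernelWeight_nonneg hK hh r)]
        by_cases hw : kernelWeight K h I x r = 0
        · simp [hw]
        refine mul_le_mul_of_nonneg_left ?_ (kernelWeight_nonneg hK hh r)
        -- A cell with nonzero weight contains a point `t` of the window: `f t` is compared with the
        -- infimum at the cell scale and with `f x` at the kernel scale.
        obtain ⟨t, ht, hxt⟩ := exists_mem_of_kernelWeight_ne_zero hh hR hw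
        have h1 := hI.sInf_image_le hf₀ r ht
        have h2 := hI.le_sInf_image_add hd hf r ht
        have h3 := hf.abs_sub_le (hI.cell_subset r ht) hxc
        have h4 : (C : ℝ) * dist t x ^ (α : ℝ) ≤ C * (h * R) ^ (α : ℝ) := by
          rw [dist_comm]; gcongr
        have h5 := abs_le.mp (h3.trans h4)
        rw [abs_le]
        have : 0 ≤ C * (√d * (k : ℝ) ^ (-(1 / (d : ℝ)))) ^ (α : ℝ) := by positivity
        have : 0 ≤ C * (h * R) ^ (α : ℝ) := by positivity
        constructor <;> linarith [h5.1, h5.2]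
    _ = B := by rw [← Finset.sum_mul, hsum, one_mul]

/-- Gaussian approximation of a linear combination of the normalized estimates, at a fixed
sample size. -/
theorem norm_integral_exp_kernelEstimate_sub_le {Ω : Type*} [MeasurableSpace Ω] {P : Measure Ω}
    [IsProbabilityMeasure P] {N : Ω → Multiset (EuclideanSpace ℝ (Fin d) × ℝ)} {a : ℝ} (ha : 0 < a)
    (hN : IsPoissonPointProcess P N (hypographIntensity a f))
    (hd : 0 < d) (hI : IsCubePartition d k I)
    (hK : IsLipschitzParzenKernel K) (hh : 0 < h) (hR0 : 0 ≤ R) (hR : ∀ u, K u ≠ 0 → ‖u‖ ≤ R)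
    (hM : ∀ u, |K u| ≤ M) (hα : 0 < α)
    (hf : HolderOnWith C α f (unitCube d)) (hf₀pos : 0 < f₀) (hf₀ : ∀ x ∈ unitCube d, f₀ ≤ f x)
    {s : ℝ} (hs : 0 < s) (hs2 : s ^ 2 = h ^ d * k)
    {η : ℝ} (hη : η = C * (√d * (k : ℝ) ^ (-(1 / (d : ℝ)))) ^ (α : ℝ)) (hη1 : a / k * η ≤ 1)
    {p : ℕ} (x : Fin p → EuclideanSpace ℝ (Fin d))
    (hx : ∀ j, Metric.closedBall (x j) (h * R) ⊆ unitCube d) (θ : Fin p → ℝ) {T : ℝ}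
    (hT : T = ∑ j, |θ j|) (hTs : T * M / s ≤ 1)
    {Q : ℝ} (hQ : Q = ∑ r, (∑ j, θ j * (s * kernelWeight K h I (x j) r)) ^ 2)
    {Λ : ℝ} (hΛ : Λ = a / k * f₀) :
    ‖∫ ω, Complex.exp (Complex.I * (∑ j, θ j * (a / k * s *
        (kernelEstimate (rescaledKernel K h) I f (N ω) (x j) - f (x j))) : ℝ)) ∂P -
      Complex.exp (-(Q / 2 : ℝ))‖ ≤
      6 * (a / k * η) * (T * s) +
      √(Q * (2 * Real.exp (-(Λ / 2)) + 4 / Λ) + (T * s * (2 * Real.exp (-(Λ / 2)))) ^ 2) +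
      (T * s * Real.exp (-Λ) + 6 * (T * M / s) * Q) +
      a / k * s * T * (η + C * (h * R) ^ (α : ℝ)) := by
  have hk : (0 : ℝ) < k := by exact_mod_cast hI.card_pos
  have hβ : 0 < a / k := by positivity
  have hη0 : 0 ≤ η := by rw [hη]; positivity
  have hT0 : 0 ≤ T := by rw [hT]; positivity
  have hΛ0 : 0 < Λ := by rw [hΛ]; positivity
  set w : Fin p → Fin k → ℝ := fun j r => kernelWeight K h I (x j) r with hw
  have hw0 : ∀ j r, 0 ≤ w j r := fun j r => kernelWeight_nonneg hK hh r
  have hw1 : ∀ j, ∑ r, w j r = 1 := fun j => sum_kernelWeight hI hK hh hR (hx j)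
  set t : Fin k → ℝ := fun r => ∑ j, θ j * (s * w j r) with ht
  set m : Fin k → ℝ := fun r => sInf (f '' I r) with hm
  have hm0 : ∀ r, f₀ ≤ m r := hI.le_sInf_image hd hf₀
  have hcell : ∀ r, _ := fun r => hN.isEnlargedCell ha (hI.measurableSet_cell r)
    (hI.cell_subset r) ((hf.continuousOn hα).mono (hI.cell_subset r))
    (v := 1 / k) (by positivity) (hI.volume_cell hd r) (m := m r) (hf₀pos.trans_le (hm0 r)) hη0
    (fun y hy => hI.sInf_image_le hf₀ r hy)
    (fun y hy => by rw [hη]; exact hI.le_sInf_image_add hd hf r hy)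
  have hak : a * (1 / k) = a / k := by ring
  simp only [hak] at hcell
  have hind := hN.iIndepFun_count_maxOrdinate (fun r => I r ×ˢ Set.Icc 0 (m r))
    (fun r => (hI.measurableSet_cell r).prod measurableSet_Icc) (fun r z hz => hz.2.1)
    (fun i j hij => Set.disjoint_prod.mpr (Or.inl (hI.disjoint hij)))
  have hsum_abs : ∑ r, |t r| ≤ T * s := by
    calc ∑ r, |t r| ≤ ∑ r, ∑ j, |θ j| * (s * w j r) := by
          refine Finset.sum_le_sum fun r _ => (Finset.abs_sum_le_sum_abs _ _).trans ?_
          refine Finset.sum_le_sum fun j _ => ?_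
          rw [abs_mul, abs_of_nonneg (mul_nonneg hs.le (hw0 j r))]
      _ = ∑ j, |θ j| * (s * ∑ r, w j r) := by
          rw [Finset.sum_comm]
          simp_rw [Finset.mul_sum]
      _ = T * s := by
          simp_rw [hw1, mul_one]
          rw [← Finset.sum_mul, hT]
  have hmax : ∀ r, |t r| ≤ T * M / s := by
    intro r
    calc |t r| ≤ ∑ j, |θ j * (s * w j r)| := Finset.abs_sum_le_sum_abs _ _
      _ ≤ ∑ j, |θ j| * (M / s) := by
          refine Finset.sum_le_sum fun j _ => ?_
          rw [abs_mul, abs_of_nonneg (mul_nonneg hs.le (hw0 j r))]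
          refine mul_le_mul_of_nonneg_left ?_ (abs_nonneg _)
          have := kernelWeight_le hd hI hh hM (x := x j) r
          calc s * w j r ≤ s * (M / (h ^ d * k)) := by gcongr
            _ = M / s := by rw [← hs2]; field_simp
      _ = T * M / s := by rw [← Finset.sum_mul, hT]; ring
  have main := norm_integral_exp_sum_sub_le hcell hind hη0 hη1 hΛ0
    (fun r => by rw [hΛ]; exact mul_le_mul_of_nonneg_left (hm0 r) hβ.le) t hTs hmax
  have hQt : ∑ r, t r ^ 2 = Q := by rw [hQ]
  have hQ0 : 0 ≤ Q := by rw [← hQt]; positivity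
  rw [hQt] at main
  -- The deterministic bias is split off; it only multiplies the characteristic function by a
  -- unimodular factor within `|b|` of 1.
  set b : ℝ := a / k * s * ∑ j, θ j * (∑ r, w j r * m r - f (x j)) with hb
  have hbias : |b| ≤ a / k * s * T * (η + C * (h * R) ^ (α : ℝ)) := by
    rw [hb, abs_mul, abs_of_nonneg (mul_nonneg hβ.le hs.le), mul_assoc (a / k * s)]
    refine mul_le_mul_of_nonneg_left ?_ (mul_nonneg hβ.le hs.le)
    rw [hT, Finset.sum_mul]
    refine (Finset.abs_sum_le_sum_abs _ _).trans (Finset.sum_le_sum fun j _ => ?_)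
    rw [abs_mul, hη]
    exact mul_le_mul_of_nonneg_left
      (abs_sum_kernelWeight_mul_sInf_sub_le hd hI hK hh hR0 hR hf hf₀ (hx j)) (abs_nonneg _)
  have hdecomp : ∀ ω, ∑ j, θ j * (a / k * s *
      (kernelEstimate (rescaledKernel K h) I f (N ω) (x j) - f (x j))) =
      ∑ r, t r * (a / k * ((1 + 1 / (pointCount (N ω) (hypographOver (I r) f) : ℝ)) *
        maxOrdinate (N ω) (hypographOver (I r) f)) - a / k * m r) + b := by
    intro ω
    set Y : Fin k → ℝ := fun r => (1 + 1 / (pointCount (N ω) (hypographOver (I r) f) : ℝ)) *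
        maxOrdinate (N ω) (hypographOver (I r) f) with hY
    have e1 : ∀ j, kernelEstimate (rescaledKernel K h) I f (N ω) (x j) = ∑ r, w j r * Y r := by
      intro j
      unfold kernelEstimate
      refine Finset.sum_congr rfl fun r _ => ?_
      rw [mul_assoc]
      rfl
    simp_rw [e1]
    have e2 : ∑ r, t r * (a / k * Y r - a / k * m r) =
        ∑ j, θ j * (a / k * s * (∑ r, w j r * Y r - ∑ r, w j r * m r)) := by
      simp only [ht, Finset.sum_mul]
      rw [Finset.sum_comm]
      refine Finset.sum_congr rfl fun j _ => ?_
      rw [← Finset.sum_sub_distrib, Finset.mul_sum, Finset.mul_sum]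
      refine Finset.sum_congr rfl fun r _ => ?_
      ring
    rw [e2, hb, Finset.mul_sum, ← Finset.sum_add_distrib]
    refine Finset.sum_congr rfl fun j _ => ?_
    ring
  simp_rw [hdecomp]
  set Z : Ω → ℝ := fun ω => ∑ r, t r * (a / k *
    ((1 + 1 / (pointCount (N ω) (hypographOver (I r) f) : ℝ)) *
      maxOrdinate (N ω) (hypographOver (I r) f)) - a / k * m r) with hZ
  have hexp : ∀ ω, Complex.exp (Complex.I * (Z ω + b : ℝ)) =
      Complex.exp (Complex.I * b) * Complex.exp (Complex.I * Z ω) := by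
    intro ω
    rw [← Complex.exp_add]
    congr 1
    push_cast
    ring
  have hn : ‖Complex.exp (Complex.I * b)‖ = 1 := by
    rw [mul_comm, Complex.norm_exp_ofReal_mul_I]
  have hG : ‖Complex.exp (-(Q / 2 : ℝ))‖ ≤ 1 := by
    rw [← Complex.ofReal_neg, Complex.norm_exp_ofReal]
    exact Real.exp_le_one_iff.mpr (by linarith)
  have e3 : ∫ ω, Complex.exp (Complex.I * (Z ω + b : ℝ)) ∂P - Complex.exp (-(Q / 2 : ℝ)) =
      Complex.exp (Complex.I * b) * (∫ ω, Complex.exp (Complex.I * Z ω) ∂P -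
        Complex.exp (-(Q / 2 : ℝ))) +
      (Complex.exp (Complex.I * b) - 1) * Complex.exp (-(Q / 2 : ℝ)) := by
    simp_rw [hexp]
    rw [integral_const_mul]
    ring
  rw [e3]
  refine (norm_add_le _ _).trans (add_le_add ?_ ?_)
  · rw [norm_mul, hn, one_mul]
    refine main.trans ?_
    have : 0 ≤ ∑ r, |t r| := by positivity
    gcongr
  · rw [norm_mul]
    refine (mul_le_of_le_one_right (norm_nonneg _) hG).trans ?_
    exact Real.norm_exp_I_mul_ofReal_sub_one_le.trans hbias

lemma IsPoissonPointProcess.measurable_kernelEstimate {Ω : Type*} [MeasurableSpace Ω]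
    {P : Measure Ω} {N : Ω → Multiset (EuclideanSpace ℝ (Fin d) × ℝ)}
    {μ : Measure (EuclideanSpace ℝ (Fin d) × ℝ)} (hN : IsPoissonPointProcess P N μ)
    (hI : IsCubePartition d k I) (hf : ContinuousOn f (unitCube d))
    (κ : EuclideanSpace ℝ (Fin d) → EuclideanSpace ℝ (Fin d) → ℝ)
    (x : EuclideanSpace ℝ (Fin d)) :
    Measurable fun ω => kernelEstimate κ I f (N ω) x := by
  have hH : ∀ r, MeasurableSet (hypographOver (I r) f) := fun r =>
    measurableSet_hypographOver (hI.measurableSet_cell r) (hf.mono (hI.cell_subset r))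
  have m1 := fun r => hN.measurable_count _ (hH r)
  have m2 := fun r => hN.measurable_maxOrdinate (hH r) fun z hz => hz.2.1
  unfold kernelEstimate
  fun_prop

end FixedSampleSize

/-! ### Asymptotics under the three conditions -/

/-- The conditions on the number `k n` of cells and on the bandwidth `h n`. -/
structure IsSmoothingRegime (d : ℕ) (α : ℝ) (k : ℕ → ℕ) (h : ℕ → ℝ) : Prop where
  card_pos : ∀ n, 1 ≤ n → 0 < k n
  bandwidth_pos : ∀ n, 1 ≤ n → 0 < h n
  bandwidth : Tendsto h atTop (𝓝 0)
  card : Tendsto (fun n : ℕ => (k n : ℝ) * Real.log n / n) atTop (𝓝 0)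
  window : Tendsto (fun n : ℕ => h n ^ d * (k n : ℝ)) atTop atTop
  bias : Tendsto (fun n : ℕ => (n : ℝ) * (k n : ℝ) ^ (-(1 / 2 : ℝ)) *
    h n ^ (α + (d : ℝ) / 2)) atTop (𝓝 0)

namespace IsSmoothingRegime

variable {d : ℕ} {α : ℝ} {k : ℕ → ℕ} {h : ℕ → ℝ}

/-- The scale `√(h^d k)`, the square root of the order of the number of cells in a window. -/
noncomputable def scale (d : ℕ) (k : ℕ → ℕ) (h : ℕ → ℝ) (n : ℕ) : ℝ :=
  h n ^ ((d : ℝ) / 2) * (k n : ℝ) ^ (1 / 2 : ℝ)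

lemma scale_pos (H : IsSmoothingRegime d α k h) {n : ℕ} (hn : 1 ≤ n) : 0 < scale d k h n := by
  have h1 := H.bandwidth_pos n hn
  have h2 : (0 : ℝ) < k n := by exact_mod_cast H.card_pos n hn
  unfold scale
  positivity

lemma scale_sq (H : IsSmoothingRegime d α k h) {n : ℕ} (hn : 1 ≤ n) :
    scale d k h n ^ 2 = h n ^ d * k n := by
  have h1 := H.bandwidth_pos n hn
  have h2 : (0 : ℝ) < k n := by exact_mod_cast H.card_pos n hn
  unfold scale
  rw [mul_pow, ← Real.rpow_natCast, ← Real.rpow_mul h1.le, ← Real.rpow_natCast,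
    ← Real.rpow_mul h2.le]
  norm_num

lemma tendsto_scale (H : IsSmoothingRegime d α k h) : Tendsto (scale d k h) atTop atTop := by
  refine (Real.tendsto_sqrt_atTop.comp H.window).congr' ?_
  filter_upwards [eventually_ge_atTop 1] with n hn
  rw [Function.comp_apply, ← H.scale_sq hn, Real.sqrt_sq (H.scale_pos hn).le]

/-- The points per unit height in a cell times `√(h^d k)` is the announced normalization `v_n c`. -/
lemma rate_eq (H : IsSmoothingRegime d α k h) {n : ℕ} (hn : 1 ≤ n) (c : ℝ) :
    (n : ℝ) * c / k n * scale d k h n =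
      (n : ℝ) * h n ^ ((d : ℝ) / 2) * (k n : ℝ) ^ (-(1 / 2 : ℝ)) * c := by
  have h2 : (0 : ℝ) < k n := by exact_mod_cast H.card_pos n hn
  have e : (k n : ℝ) ^ (-(1 / 2 : ℝ)) = (k n : ℝ) ^ (1 / 2 : ℝ) / k n := by
    rw [eq_div_iff h2.ne', ← Real.rpow_add_one h2.ne']
    norm_num
  unfold scale
  rw [e]
  ring

/-- The ratio equals `(h^d k)^(-1/d)`, so (ii) says that cells are small compared with the window.
-/
lemma tendsto_cellSize_div (hd : 0 < d) (H : IsSmoothingRegime d α k h) :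
    Tendsto (fun n => (k n : ℝ) ^ (-(1 / (d : ℝ))) / h n) atTop (𝓝 0) := by
  have hd' : (0 : ℝ) < 1 / d := by positivity
  refine ((tendsto_rpow_neg_atTop hd').comp H.window).congr' ?_
  filter_upwards [eventually_ge_atTop 1] with n hn
  have h1 := H.bandwidth_pos n hn
  have h2 : (0 : ℝ) < k n := by exact_mod_cast H.card_pos n hn
  rw [Function.comp_apply, Real.mul_rpow (by positivity) h2.le, ← Real.rpow_natCast,
    ← Real.rpow_mul h1.le]
  have : (d : ℝ) * -(1 / d) = -1 := by field_simp
  rw [this, Real.rpow_neg_one]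
  ring

lemma eventually_cellSize_le (hd : 0 < d) (H : IsSmoothingRegime d α k h) :
    ∀ᶠ n in atTop, (k n : ℝ) ^ (-(1 / (d : ℝ))) ≤ h n := by
  filter_upwards [(H.tendsto_cellSize_div hd).eventually (gt_mem_nhds one_pos),
    eventually_ge_atTop 1] with n h1 hn
  exact ((div_lt_one (H.bandwidth_pos n hn)).mp h1).le

lemma tendsto_cellSize (hd : 0 < d) (H : IsSmoothingRegime d α k h) :
    Tendsto (fun n => (k n : ℝ) ^ (-(1 / (d : ℝ)))) atTop (𝓝 0) :=
  squeeze_zero' (Eventually.of_forall fun n => by positivity) (H.eventually_cellSize_le hd)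
    H.bandwidth

/-- The normalization times the Hölder modulus at the bandwidth tends to `0`. -/
lemma tendsto_rate_mul_rpow (H : IsSmoothingRegime d α k h) (c : ℝ) :
    Tendsto (fun n : ℕ => (n : ℝ) * c / k n * scale d k h n * h n ^ α) atTop (𝓝 0) := by
  have := H.bias.mul_const c
  rw [zero_mul] at this
  refine this.congr' ?_
  filter_upwards [eventually_ge_atTop 1] with n hn
  have h1 := H.bandwidth_pos n hn
  rw [H.rate_eq hn, Real.rpow_add h1]
  ring

/-- Cells are eventually smaller than the bandwidth, so both parts of the bias are of order `h ^ α`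
and (iii) handles them together. -/
lemma eventually_modulus_le (hd : 0 < d) (hα : 0 ≤ α) (H : IsSmoothingRegime d α k h) {C R : ℝ}
    (hC : 0 ≤ C) (hR : 0 ≤ R) :
    ∀ᶠ n in atTop, C * (√d * (k n : ℝ) ^ (-(1 / (d : ℝ)))) ^ α + C * (h n * R) ^ α ≤
      (C * √d ^ α + C * R ^ α) * h n ^ α := by
  filter_upwards [H.eventually_cellSize_le hd, eventually_ge_atTop 1] with n h1 hn
  have h2 := H.bandwidth_pos n hn
  have e1 : (√d * (k n : ℝ) ^ (-(1 / (d : ℝ)))) ^ α ≤ √d ^ α * h n ^ α := by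
    rw [← Real.mul_rpow (by positivity) h2.le]
    gcongr
  rw [Real.mul_rpow h2.le hR]
  calc C * (√d * (k n : ℝ) ^ (-(1 / (d : ℝ)))) ^ α + C * (h n ^ α * R ^ α)
      ≤ C * (√d ^ α * h n ^ α) + C * (h n ^ α * R ^ α) := by gcongr
    _ = (C * √d ^ α + C * R ^ α) * h n ^ α := by ring

lemma tendsto_rate_mul_modulus (hd : 0 < d) (hα : 0 ≤ α) (H : IsSmoothingRegime d α k h)
    {c C R : ℝ} (hc : 0 ≤ c) (hC : 0 ≤ C) (hR : 0 ≤ R) :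
    Tendsto (fun n : ℕ => (n : ℝ) * c / k n * scale d k h n *
      (C * (√d * (k n : ℝ) ^ (-(1 / (d : ℝ)))) ^ α + C * (h n * R) ^ α)) atTop (𝓝 0) := by
  have hlim := (H.tendsto_rate_mul_rpow c).const_mul (C * √d ^ α + C * R ^ α)
  rw [mul_zero] at hlim
  refine squeeze_zero' ?_ ?_ hlim
  · filter_upwards [eventually_ge_atTop 1] with n hn
    have h1 := H.scale_pos hn
    have h2 := H.bandwidth_pos n hn
    positivity
  · filter_upwards [eventually_ge_atTop 1, H.eventually_modulus_le hd hα hC hR] with n hn h3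
    have h1 := H.scale_pos hn
    calc (n : ℝ) * c / k n * scale d k h n *
          (C * (√d * (k n : ℝ) ^ (-(1 / (d : ℝ)))) ^ α + C * (h n * R) ^ α)
        ≤ (n : ℝ) * c / k n * scale d k h n * ((C * √d ^ α + C * R ^ α) * h n ^ α) := by
          gcongr
      _ = _ := by ring

/-- The constant 4 makes half of the cell mean exceed `2 * log n`, so the exponential is at most
`n⁻²` and beats the crude bound `n` on the scale. -/
lemma eventually_log_le (H : IsSmoothingRegime d α k h) {b : ℝ} (hb : 0 < b) :
    ∀ᶠ n : ℕ in atTop, 4 * Real.log n ≤ n * b / k n := by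
  have hb4 : 0 < b / 4 := by positivity
  filter_upwards [H.card.eventually (gt_mem_nhds hb4), eventually_ge_atTop 1] with n h1 hn
  have h2 : (0 : ℝ) < k n := by exact_mod_cast H.card_pos n hn
  have h3 : (0 : ℝ) < n := by exact_mod_cast hn
  rw [div_lt_iff₀ h3] at h1
  rw [le_div_iff₀ h2]
  linarith

lemma tendsto_cellMean (H : IsSmoothingRegime d α k h) {b : ℝ} (hb : 0 < b) :
    Tendsto (fun n : ℕ => (n : ℝ) * b / k n) atTop atTop :=
  tendsto_atTop_mono' _ (H.eventually_log_le hb)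
    ((Real.tendsto_log_atTop.comp tendsto_natCast_atTop_atTop).const_mul_atTop (by norm_num))

/-- Once `log n ≥ 1`, condition (i) gives `k ≤ k * log n ≤ n`; and `h ≤ 1` eventually. -/
lemma eventually_scale_le (H : IsSmoothingRegime d α k h) : ∀ᶠ n : ℕ in atTop,
    scale d k h n ≤ n := by
  have hlog : ∀ᶠ n : ℕ in atTop, (1 : ℝ) ≤ Real.log n :=
    (Real.tendsto_log_atTop.comp tendsto_natCast_atTop_atTop).eventually_ge_atTop 1
  filter_upwards [H.card.eventually (gt_mem_nhds one_pos), eventually_ge_atTop 1, hlog,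
    H.bandwidth.eventually (gt_mem_nhds one_pos)] with n h1 hn h2 h3
  have hk : (1 : ℝ) ≤ k n := by exact_mod_cast H.card_pos n hn
  have hn' : (0 : ℝ) < n := by exact_mod_cast hn
  have hh := H.bandwidth_pos n hn
  rw [div_lt_one hn'] at h1
  have hkn : (k n : ℝ) ≤ n := by nlinarith
  have e1 : h n ^ ((d : ℝ) / 2) ≤ 1 := Real.rpow_le_one hh.le h3.le (by positivity)
  have e2 : (k n : ℝ) ^ (1 / 2 : ℝ) ≤ k n := by
    calc (k n : ℝ) ^ (1 / 2 : ℝ) ≤ (k n : ℝ) ^ (1 : ℝ) :=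
          Real.rpow_le_rpow_of_exponent_le hk (by norm_num)
      _ = k n := Real.rpow_one _
  unfold scale
  calc h n ^ ((d : ℝ) / 2) * (k n : ℝ) ^ (1 / 2 : ℝ) ≤ 1 * k n := by gcongr
    _ ≤ n := by linarith

/-- Empty cells are negligible. -/
lemma tendsto_scale_mul_exp (H : IsSmoothingRegime d α k h) {b : ℝ} (hb : 0 < b) :
    Tendsto (fun n : ℕ => scale d k h n * Real.exp (-(n * b / k n / 2))) atTop (𝓝 0) := by
  refine squeeze_zero' ?_ ?_ tendsto_inv_atTop_nhds_zero_nat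
  · filter_upwards [eventually_ge_atTop 1] with n hn
    have := H.scale_pos hn
    positivity
  · filter_upwards [eventually_ge_atTop 1, H.eventually_scale_le, H.eventually_log_le hb]
      with n hn h1 h2
    have hn' : (0 : ℝ) < n := by exact_mod_cast hn
    have e : Real.exp (-(n * b / k n / 2)) ≤ (n : ℝ)⁻¹ ^ 2 := by
      calc Real.exp (-(n * b / k n / 2)) ≤ Real.exp (-(2 * Real.log n)) := by
            gcongr; linarith
        _ = (n : ℝ)⁻¹ ^ 2 := by
            rw [Real.exp_neg, two_mul, Real.exp_add, Real.exp_log hn', inv_pow, sq]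
    calc scale d k h n * Real.exp (-(n * b / k n / 2)) ≤ n * (n : ℝ)⁻¹ ^ 2 := by
          gcongr
      _ = (n : ℝ)⁻¹ := by field_simp

end IsSmoothingRegime

/-! ### Limit of the variances -/

section QuadraticForm

lemma sum_sq_eq_of_mul_eq_zero {ι : Type*} (s : Finset ι) (y : ι → ℝ)
    (hy : ∀ i ∈ s, ∀ j ∈ s, i ≠ j → y i * y j = 0) : (∑ i ∈ s, y i) ^ 2 = ∑ i ∈ s, y i ^ 2 := by
  rw [sq, Finset.sum_mul_sum]
  refine Finset.sum_congr rfl fun i hi => ?_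
  rw [Finset.sum_eq_single i (fun j hj hji => hy i hi j hj hji.symm) (fun h => absurd hi h), sq]

variable {d : ℕ} {α : ℝ} {k : ℕ → ℕ} {h : ℕ → ℝ} {K : EuclideanSpace ℝ (Fin d) → ℝ}
  {I : ∀ n, Fin (k n) → Set (EuclideanSpace ℝ (Fin d))} {p : ℕ}
  {x : Fin p → EuclideanSpace ℝ (Fin d)}

lemma unitCube_mem_nhds {y : EuclideanSpace ℝ (Fin d)} (hy : ∀ i, y i ∈ Set.Ioo (0 : ℝ) 1) :
    unitCube d ∈ 𝓝 y := by
  have hopen : IsOpen {z : EuclideanSpace ℝ (Fin d) | ∀ i, z i ∈ Set.Ioo (0 : ℝ) 1} := by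
    have : {z : EuclideanSpace ℝ (Fin d) | ∀ i, z i ∈ Set.Ioo (0 : ℝ) 1} =
        ⋂ i, (fun z : EuclideanSpace ℝ (Fin d) => z i) ⁻¹' Set.Ioo 0 1 := by ext; simp
    rw [this]
    exact isOpen_iInter_of_finite fun i => isOpen_Ioo.preimage (by fun_prop)
  exact mem_of_superset (hopen.mem_nhds hy) fun z hz i => Set.Ioo_subset_Icc_self (hz i)

lemma IsSmoothingRegime.eventually_closedBall_subset (H : IsSmoothingRegime d α k h) (R : ℝ)
    (hx : ∀ j i, x j i ∈ Set.Ioo (0 : ℝ) 1) :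
    ∀ᶠ n in atTop, ∀ j, Metric.closedBall (x j) (h n * R) ⊆ unitCube d := by
  rw [eventually_all]
  intro j
  obtain ⟨ρ, hρ, hsub⟩ := Metric.nhds_basis_closedBall.mem_iff.mp (unitCube_mem_nhds (hx j))
  have hlim : Tendsto (fun n => h n * R) atTop (𝓝 0) := by simpa using H.bandwidth.mul_const R
  filter_upwards [hlim.eventually (gt_mem_nhds hρ)] with n hn
  exact (Metric.closedBall_subset_closedBall hn.le).trans hsub

/-- Convergence of the variance of linear combinations. -/
lemma IsSmoothingRegime.tendsto_sum_sq (H : IsSmoothingRegime d α k h) (hd : 0 < d)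
    (hI : ∀ n, 1 ≤ n → IsCubePartition d (k n) (I n)) (hK : IsLipschitzParzenKernel K)
    (hxinj : Function.Injective x) (hx : ∀ j i, x j i ∈ Set.Ioo (0 : ℝ) 1) (θ : Fin p → ℝ) :
    Tendsto (fun n => ∑ r, (∑ j, θ j * (scale d k h n * kernelWeight K (h n) (I n) (x j) r)) ^ 2)
      atTop (𝓝 (∑ j, θ j ^ 2 * ∫ u, K u ^ 2)) := by
  obtain ⟨R, M, L, hR0, -, hL0, hR, -, hL⟩ := hK.exists_bounds
  have hball := H.eventually_closedBall_subset R hx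
  have hcell := H.tendsto_cellSize hd
  have hdisj : ∀ᶠ n in atTop, ∀ i j, i ≠ j →
      2 * (h n * R) + √d * (k n : ℝ) ^ (-(1 / (d : ℝ))) < dist (x i) (x j) := by
    rw [eventually_all]; intro i
    rw [eventually_all]; intro j
    by_cases hij : i = j
    · simp [hij]
    have hpos : 0 < dist (x i) (x j) := dist_pos.mpr fun e => hij (hxinj e)
    have hlim : Tendsto (fun n => 2 * (h n * R) + √d * (k n : ℝ) ^ (-(1 / (d : ℝ)))) atTop
        (𝓝 0) := by
      simpa using ((H.bandwidth.mul_const R).const_mul 2).add (hcell.const_mul √d)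
    filter_upwards [hlim.eventually (gt_mem_nhds hpos)] with n hn _
    exact hn
  have hdiag : ∀ j, Tendsto (fun n => h n ^ d * k n * ∑ r, kernelWeight K (h n) (I n) (x j) r ^ 2)
      atTop (𝓝 (∫ u, K u ^ 2)) := by
    intro j
    rw [tendsto_iff_dist_tendsto_zero]
    have hlim : Tendsto (fun n => L * √d * ((k n : ℝ) ^ (-(1 / (d : ℝ))) / h n)) atTop (𝓝 0) := by
      simpa using (H.tendsto_cellSize_div hd).const_mul (L * √d)
    refine squeeze_zero' (Eventually.of_forall fun n => dist_nonneg) ?_ hlim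
    filter_upwards [eventually_ge_atTop 1, hball] with n hn hb
    rw [Real.dist_eq]
    refine (abs_sum_kernelWeight_sq_sub_le hd (hI n hn) hK (H.bandwidth_pos n hn) hR hL0 hL
      (hb j)).trans_eq ?_
    ring
  refine (tendsto_finsetSum _ fun j _ => (hdiag j).const_mul (θ j ^ 2)).congr' ?_
  filter_upwards [eventually_ge_atTop 1, hdisj] with n hn hdj
  -- Each cell eventually meets at most one window, so the cross terms vanish exactly.
  have e : ∀ r, (∑ j, θ j * (scale d k h n * kernelWeight K (h n) (I n) (x j) r)) ^ 2 =
      ∑ j, (θ j * (scale d k h n * kernelWeight K (h n) (I n) (x j) r)) ^ 2 := by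
    intro r
    refine sum_sq_eq_of_mul_eq_zero _ _ fun i _ j _ hij => ?_
    have := kernelWeight_mul_eq_zero (hI n hn) (H.bandwidth_pos n hn) hR (hdj i j hij) r
    linear_combination (θ i * θ j * scale d k h n ^ 2) * this
  simp_rw [e]
  rw [Finset.sum_comm]
  refine Finset.sum_congr rfl fun j _ => ?_
  rw [← H.scale_sq hn, Finset.mul_sum, Finset.mul_sum]
  refine Finset.sum_congr rfl fun r _ => ?_
  ring

end QuadraticForm

/-! ### Central limit theorem -/

section AsymptoticNormality

/-- Measurability of the vector of normalized estimation errors. -/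
lemma aemeasurable_normalized_kernelEstimate {d k : ℕ} {K : EuclideanSpace ℝ (Fin d) → ℝ}
    {f : EuclideanSpace ℝ (Fin d) → ℝ} {I : Fin k → Set (EuclideanSpace ℝ (Fin d))} {p : ℕ}
    {x : Fin p → EuclideanSpace ℝ (Fin d)} {Ω : Type*} [MeasurableSpace Ω] {P : Measure Ω}
    {N : Ω → Multiset (EuclideanSpace ℝ (Fin d) × ℝ)}
    {μ : Measure (EuclideanSpace ℝ (Fin d) × ℝ)} (hf : ContinuousOn f (unitCube d))
    (hN : IsPoissonPointProcess P N μ) (hI : IsCubePartition d k I) (v : ℝ) (b : ℝ) :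
    AEMeasurable (fun ω : Ω => WithLp.toLp 2 fun j : Fin p =>
      v * (kernelEstimate (rescaledKernel K b) I f (N ω) (x j) - f (x j))) P := by
  have := fun j => hN.measurable_kernelEstimate hI hf (rescaledKernel K b) (x j)
  refine Measurable.aemeasurable ?_
  refine (by fun_prop : Measurable (WithLp.toLp 2 : (Fin p → ℝ) → _)).comp ?_
  exact measurable_pi_lambda _ fun j => by fun_prop

variable {d : ℕ} {α : ℝ≥0} {k : ℕ → ℕ} {h : ℕ → ℝ} {K : EuclideanSpace ℝ (Fin d) → ℝ}
  {f : EuclideanSpace ℝ (Fin d) → ℝ}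
  {I : ∀ n, Fin (k n) → Set (EuclideanSpace ℝ (Fin d))} {p : ℕ}
  {x : Fin p → EuclideanSpace ℝ (Fin d)}
  {Ω : ℕ → Type*} [∀ n, MeasurableSpace (Ω n)] {P : ∀ n, Measure (Ω n)}
  [∀ n, IsProbabilityMeasure (P n)]
  {N : ∀ n, Ω n → Multiset (EuclideanSpace ℝ (Fin d) × ℝ)} {c : ℝ}

lemma exists_pos_le_on_unitCube (hf : ContinuousOn f (unitCube d))
    (hpos : ∀ y ∈ unitCube d, 0 < f y) : ∃ f₀ : ℝ, 0 < f₀ ∧ ∀ y ∈ unitCube d, f₀ ≤ f y := by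
  have h0 : (0 : EuclideanSpace ℝ (Fin d)) ∈ unitCube d := fun j => by simp
  obtain ⟨y, hy, hmin⟩ := (isCompact_unitCube d).exists_isMinOn ⟨_, h0⟩ hf
  exact ⟨f y, hpos y hy, fun z hz => hmin hz⟩

/-- Convergence of the characteristic functions of the normalized estimation errors. -/
theorem tendsto_integral_exp_kernelEstimate (H : IsSmoothingRegime d α k h) (hd : 0 < d)
    (hα : 0 < α) (hK : IsLipschitzParzenKernel K) {C : ℝ≥0} (hf : HolderOnWith C α f (unitCube d))
    (hfpos : ∀ y ∈ unitCube d, 0 < f y) (hc : 0 < c)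
    (hN : ∀ n : ℕ, 1 ≤ n →
      IsPoissonPointProcess (P n) (N n) (hypographIntensity ((n : ℝ) * c) f))
    (hI : ∀ n, 1 ≤ n → IsCubePartition d (k n) (I n))
    (hxinj : Function.Injective x) (hx : ∀ j i, x j i ∈ Set.Ioo (0 : ℝ) 1) (θ : Fin p → ℝ) :
    Tendsto (fun n : ℕ => ∫ ω, Complex.exp (Complex.I * (∑ j, θ j *
        (((n : ℝ) * h n ^ ((d : ℝ) / 2) * (k n : ℝ) ^ (-(1 / 2 : ℝ))) * c *
          (kernelEstimate (rescaledKernel K (h n)) (I n) f (N n ω) (x j) - f (x j))) : ℝ)) ∂(P n))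
      atTop (𝓝 (Complex.exp (-((∑ j, θ j ^ 2 * ∫ u, K u ^ 2) / 2 : ℝ)))) := by
  obtain ⟨R, M, L, hR0, hM0, -, hR, hM, -⟩ := hK.exists_bounds
  obtain ⟨f₀, hf₀pos, hf₀⟩ := exists_pos_le_on_unitCube (hf.continuousOn hα) hfpos
  set T := ∑ j, |θ j| with hT
  have hT0 : 0 ≤ T := by positivity
  set s := IsSmoothingRegime.scale d k h with hs
  set η : ℕ → ℝ := fun n => C * (√d * (k n : ℝ) ^ (-(1 / (d : ℝ)))) ^ (α : ℝ) with hη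
  set Q : ℕ → ℝ := fun n =>
    ∑ r, (∑ j, θ j * (s n * kernelWeight K (h n) (I n) (x j) r)) ^ 2 with hQ
  set Λ : ℕ → ℝ := fun n => (n : ℝ) * c / k n * f₀ with hΛ
  have hQlim : Tendsto Q atTop (𝓝 (∑ j, θ j ^ 2 * ∫ u, K u ^ 2)) :=
    H.tendsto_sum_sq hd hI hK hxinj hx θ
  have hb : 0 < c * f₀ := mul_pos hc hf₀pos
  have hΛe : ∀ n, Λ n = n * (c * f₀) / k n := fun n => by simp only [hΛ]; ring
  have hΛlim : Tendsto Λ atTop atTop := (H.tendsto_cellMean hb).congr fun n => (hΛe n).symm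
  have hsexp : Tendsto (fun n => s n * Real.exp (-(Λ n / 2))) atTop (𝓝 0) := by
    simp_rw [hΛe]; exact H.tendsto_scale_mul_exp hb
  have hexp : Tendsto (fun n => Real.exp (-(Λ n / 2))) atTop (𝓝 0) :=
    Real.tendsto_exp_neg_atTop_nhds_zero.comp (hΛlim.atTop_div_const two_pos)
  have hsexp' : Tendsto (fun n => s n * Real.exp (-Λ n)) atTop (𝓝 0) := by
    have := hsexp.mul hexp
    rw [mul_zero] at this
    refine this.congr fun n => ?_
    rw [mul_assoc, ← Real.exp_add]
    congr 2
    ring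
  have hslim : Tendsto s atTop atTop := H.tendsto_scale
  have hmod : Tendsto (fun n : ℕ => (n : ℝ) * c / k n * s n *
      (η n + C * (h n * R) ^ (α : ℝ))) atTop (𝓝 0) :=
    H.tendsto_rate_mul_modulus hd α.coe_nonneg hc.le C.coe_nonneg hR0.le
  -- The part of `hmod` at the cell scale; both parts are nonnegative.
  have hηs : Tendsto (fun n : ℕ => (n : ℝ) * c / k n * η n * s n) atTop (𝓝 0) := by
    refine squeeze_zero' ?_ ?_ hmod
    · filter_upwards [eventually_ge_atTop 1] with n hn
      have := H.scale_pos hn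
      positivity
    · filter_upwards [eventually_ge_atTop 1] with n hn
      have h1 : 0 < s n := H.scale_pos hn
      have h2 := H.bandwidth_pos n hn
      have h3 : 0 ≤ C * (h n * R) ^ (α : ℝ) := by positivity
      have h4 : 0 ≤ (n : ℝ) * c / k n * s n := by positivity
      nlinarith [mul_nonneg h4 h3]
  have hTs : Tendsto (fun n => T * M / s n) atTop (𝓝 0) := hslim.const_div_atTop _
  set bound : ℕ → ℝ := fun n => 6 * ((n : ℝ) * c / k n * η n) * (T * s n) +
      √(Q n * (2 * Real.exp (-(Λ n / 2)) + 4 / Λ n) +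
        (T * s n * (2 * Real.exp (-(Λ n / 2)))) ^ 2) +
      (T * s n * Real.exp (-Λ n) + 6 * (T * M / s n) * Q n) +
      (n : ℝ) * c / k n * s n * T * (η n + C * (h n * R) ^ (α : ℝ)) with hbound
  have hblim : Tendsto bound atTop (𝓝 0) := by
    have b1 : Tendsto (fun n : ℕ => 6 * ((n : ℝ) * c / k n * η n) * (T * s n)) atTop (𝓝 0) := by
      have := hηs.const_mul (6 * T)
      rw [mul_zero] at this
      exact this.congr fun n => by ring
    have b2 : Tendsto (fun n => √(Q n * (2 * Real.exp (-(Λ n / 2)) + 4 / Λ n) +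
        (T * s n * (2 * Real.exp (-(Λ n / 2)))) ^ 2)) atTop (𝓝 0) := by
      have c1 : Tendsto (fun n => 2 * Real.exp (-(Λ n / 2)) + 4 / Λ n) atTop (𝓝 0) := by
        simpa using (hexp.const_mul 2).add (hΛlim.const_div_atTop 4)
      have c2 : Tendsto (fun n => T * s n * (2 * Real.exp (-(Λ n / 2)))) atTop (𝓝 0) := by
        have := hsexp.const_mul (2 * T)
        rw [mul_zero] at this
        exact this.congr fun n => by ring
      have c3 := ((hQlim.mul c1).add (c2.pow 2)).sqrt
      simpa using c3
    have b3 : Tendsto (fun n => T * s n * Real.exp (-Λ n) + 6 * (T * M / s n) * Q n) atTop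
        (𝓝 0) := by
      have c1 := hsexp'.const_mul T
      have c2 := (hTs.const_mul 6).mul hQlim
      have c3 := c1.add c2
      simp only [mul_zero, zero_mul, add_zero] at c3
      exact c3.congr fun n => by ring
    have b4 : Tendsto (fun n : ℕ => (n : ℝ) * c / k n * s n * T *
        (η n + C * (h n * R) ^ (α : ℝ))) atTop (𝓝 0) := by
      have := hmod.const_mul T
      rw [mul_zero] at this
      exact this.congr fun n => by ring
    have := ((b1.add b2).add b3).add b4
    simpa using this
  have hgauss : Tendsto (fun n => Complex.exp (-(Q n / 2 : ℝ))) atTop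
      (𝓝 (Complex.exp (-((∑ j, θ j ^ 2 * ∫ u, K u ^ 2) / 2 : ℝ)))) := by
    have hcont : Continuous fun y : ℝ => Complex.exp (-(y / 2 : ℝ)) := by fun_prop
    exact (hcont.tendsto _).comp hQlim
  refine (tendsto_iff_of_dist (squeeze_zero' (Eventually.of_forall fun n => dist_nonneg) ?_
    hblim)).mpr hgauss
  filter_upwards [eventually_ge_atTop 1, H.eventually_closedBall_subset R hx,
    hηs.eventually (gt_mem_nhds one_pos), hslim.eventually_ge_atTop 1,
    hTs.eventually (gt_mem_nhds one_pos)] with n hn hball hη1 hs1 hTs1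
  have hn' : (0 : ℝ) < n := by exact_mod_cast hn
  have hspos : 0 < s n := H.scale_pos hn
  have hη0 : 0 ≤ (n : ℝ) * c / k n * η n := by positivity
  -- From `β η s < 1` and `s ≥ 1`.
  have hη1' : (n : ℝ) * c / k n * η n ≤ 1 := by nlinarith
  have key := norm_integral_exp_kernelEstimate_sub_le (mul_pos hn' hc) (hN n hn) hd (hI n hn) hK
    (H.bandwidth_pos n hn) hR0.le hR hM hα hf hf₀pos hf₀ hspos (H.scale_sq hn) (η := η n) rfl
    hη1' x hball θ hT hTs1.le (Q := Q n) rfl (Λ := Λ n) rfl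
  rw [H.rate_eq hn] at key
  rw [dist_eq_norm]
  convert! key using 1
  simp only [hbound]
  rw [H.rate_eq hn]

/-- Lévy's continuity theorem, with `charFun` tested at `θ`. The normalization and bandwidth enter
as sequences `v`, `b` agreeing eventually with the formulas in `h` and `k`, so one statement serves
both the general and the explicit choice. -/
theorem tendstoInDistribution_kernelEstimate (H : IsSmoothingRegime d α k h) (hd : 0 < d)
    (hα : 0 < α) (hK : IsLipschitzParzenKernel K) {C : ℝ≥0} (hf : HolderOnWith C α f (unitCube d))
    (hfpos : ∀ y ∈ unitCube d, 0 < f y) (hc : 0 < c)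
    (hN : ∀ n : ℕ, 1 ≤ n →
      IsPoissonPointProcess (P n) (N n) (hypographIntensity ((n : ℝ) * c) f))
    (hI : ∀ n, 1 ≤ n → IsCubePartition d (k n) (I n))
    (hxinj : Function.Injective x) (hx : ∀ j i, x j i ∈ Set.Ioo (0 : ℝ) 1)
    {v b : ℕ → ℝ} (hv0 : v 0 = 0)
    (hv : ∀ᶠ n : ℕ in atTop, v n = (n : ℝ) * h n ^ ((d : ℝ) / 2) * (k n : ℝ) ^ (-(1 / 2 : ℝ)))
    (hb : ∀ᶠ n in atTop, b n = h n) :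
    TendstoInDistribution
      (fun (n : ℕ) (ω : Ω n) => WithLp.toLp 2 fun j : Fin p =>
        v n * c * (kernelEstimate (rescaledKernel K (b n)) (I n) f (N n ω) (x j) - f (x j)))
      atTop id P
      (multivariateGaussian 0 ((∫ u, K u ^ 2) • (1 : Matrix (Fin p) (Fin p) ℝ))) := by
  have hm : ∀ n, AEMeasurable (fun ω : Ω n => WithLp.toLp 2 fun j : Fin p =>
      v n * c * (kernelEstimate (rescaledKernel K (b n)) (I n) f (N n ω) (x j) - f (x j)))
      (P n) := by
    intro n
    -- Nothing is assumed about the process at `n = 0`; the vanishing normalization makes that term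
    -- constant, hence measurable.
    rcases Nat.eq_zero_or_pos n with rfl | hn
    · simp only [hv0, zero_mul]
      exact aemeasurable_const
    · exact aemeasurable_normalized_kernelEstimate (hf.continuousOn hα) (hN n hn) (hI n hn) _ _
  refine ⟨hm, aemeasurable_id, ?_⟩
  refine (ProbabilityMeasure.tendsto_iff_tendsto_charFun (E := EuclideanSpace ℝ (Fin p))).mpr
    fun θ => ?_
  have hpsd : ((∫ u, K u ^ 2) • (1 : Matrix (Fin p) (Fin p) ℝ)).PosSemidef :=
    Matrix.PosSemidef.one.smul (integral_nonneg fun u => sq_nonneg (K u))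
  have hlim := tendsto_integral_exp_kernelEstimate H hd hα hK hf hfpos hc hN hI hxinj hx θ
  simp only [ProbabilityMeasure.coe_mk, Measure.map_id]
  rw [charFun_multivariateGaussian hpsd]
  have e1 : Complex.exp (↑(inner ℝ θ 0) * Complex.I - ↑(θ.ofLp ⬝ᵥ
      ((∫ u, K u ^ 2) • (1 : Matrix (Fin p) (Fin p) ℝ)).mulVec θ.ofLp) / 2) =
      Complex.exp (-((∑ j, θ j ^ 2 * ∫ u, K u ^ 2) / 2 : ℝ)) := by
    rw [inner_zero_right, Matrix.smul_mulVec, Matrix.one_mulVec, dotProduct_smul]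
    congr 1
    have : (∫ u, K u ^ 2) • (θ.ofLp ⬝ᵥ θ.ofLp) = ∑ j, θ j ^ 2 * ∫ u, K u ^ 2 := by
      rw [dotProduct, smul_eq_mul, Finset.mul_sum]
      exact Finset.sum_congr rfl fun j _ => by ring
    rw [this]
    push_cast
    ring
  rw [e1]
  refine hlim.congr' ?_
  filter_upwards [hv, hb] with n hvn hbn
  rw [charFun_apply, integral_map (hm n) (Measurable.aestronglyMeasurable (by fun_prop))]
  refine integral_congr_ae (Eventually.of_forall fun ω => ?_)
  simp only [hvn, hbn]
  rw [mul_comm Complex.I]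
  congr 3

end AsymptoticNormality

/-! ### Exponents for the explicit choice -/

section ExplicitChoice

variable {d : ℕ} {α : ℝ} {u : ℕ → ℝ} {k : ℕ → ℕ} {h : ℕ → ℝ}

/-- The explicit bandwidth and number of cells form a smoothing regime. -/
lemma isSmoothingRegime_of_eq (hα : 0 < α)
    (hu : ∀ n, 1 ≤ n → 0 < u n) (hulim : Tendsto u atTop atTop)
    (hulog : Tendsto (fun n : ℕ => u n ^ 2 * Real.log n * (n : ℝ) ^ (-(α / (α + d))))
      atTop (𝓝 0))
    (hk : ∀ n : ℕ, 1 ≤ n → (k n : ℝ) = (n : ℝ) ^ ((d : ℝ) / (α + d)) * u n ^ 2)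
    (hh : ∀ n : ℕ, 1 ≤ n → h n = (n : ℝ) ^ (-(1 / (α + d)))) :
    IsSmoothingRegime d α k h ∧ ∀ n : ℕ, 1 ≤ n →
      (n : ℝ) * h n ^ ((d : ℝ) / 2) * (k n : ℝ) ^ (-(1 / 2 : ℝ)) =
        (n : ℝ) ^ (α / (α + d)) * (u n)⁻¹ := by
  have he : 0 < α + d := by positivity
  have hroot : ∀ n : ℕ, 1 ≤ n → (k n : ℝ) ^ (-(1 / 2 : ℝ)) =
      (n : ℝ) ^ (-((d : ℝ) / (α + d) / 2)) * (u n)⁻¹ := by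
    intro n hn
    have hn' : (0 : ℝ) < n := by exact_mod_cast hn
    have h1 := hu n hn
    rw [hk n hn, Real.mul_rpow (by positivity) (by positivity), ← Real.rpow_mul hn'.le,
      ← Real.rpow_natCast, ← Real.rpow_mul h1.le, ← Real.rpow_neg_one (u n)]
    congr 2
    · ring
    · norm_num
  refine ⟨⟨fun n hn => ?_, fun n hn => ?_, ?_, ?_, ?_, ?_⟩, fun n hn => ?_⟩
  · have hn' : (0 : ℝ) < n := by exact_mod_cast hn
    have h1 := hu n hn
    have : (0 : ℝ) < k n := by rw [hk n hn]; positivity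
    exact_mod_cast this
  · have hn' : (0 : ℝ) < n := by exact_mod_cast hn
    rw [hh n hn]; positivity
  · have := (tendsto_rpow_neg_atTop (y := 1 / (α + d)) (by positivity)).comp
      tendsto_natCast_atTop_atTop
    refine this.congr' ?_
    filter_upwards [eventually_ge_atTop 1] with n hn
    rw [hh n hn]; rfl
  · refine hulog.congr' ?_
    filter_upwards [eventually_ge_atTop 1] with n hn
    have hn' : (0 : ℝ) < n := by exact_mod_cast hn
    have e : (n : ℝ) ^ (-(α / (α + d))) = (n : ℝ) ^ ((d : ℝ) / (α + d)) / n := by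
      rw [eq_div_iff hn'.ne', ← Real.rpow_add_one hn'.ne']
      congr 1
      field_simp
      ring
    rw [hk n hn, e]
    ring
  -- The powers of `n` cancel: `h^d k = u²`.
  · have : Tendsto (fun n => u n ^ 2) atTop atTop :=
      (tendsto_pow_atTop two_ne_zero).comp hulim
    refine this.congr' ?_
    filter_upwards [eventually_ge_atTop 1] with n hn
    have hn' : (0 : ℝ) < n := by exact_mod_cast hn
    rw [hk n hn, hh n hn, ← Real.rpow_mul_natCast hn'.le, ← mul_assoc,
      ← Real.rpow_add hn']
    have : -(1 / (α + d)) * (d : ℝ) + d / (α + d) = 0 := by ring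
    rw [this, Real.rpow_zero, one_mul]
  -- The powers of `n` cancel here too: the quantity in (iii) is exactly `1 / u`.
  · refine (tendsto_inv_atTop_zero.comp hulim).congr' ?_
    filter_upwards [eventually_ge_atTop 1] with n hn
    have hn' : (0 : ℝ) < n := by exact_mod_cast hn
    rw [hroot n hn, hh n hn, ← Real.rpow_mul hn'.le, Function.comp_apply]
    have : (n : ℝ) * ((n : ℝ) ^ (-((d : ℝ) / (α + d) / 2)) * (u n)⁻¹) *
        (n : ℝ) ^ (-(1 / (α + d)) * (α + d / 2)) =
        (n : ℝ) ^ (1 : ℝ) * (n : ℝ) ^ (-((d : ℝ) / (α + d) / 2)) *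
        (n : ℝ) ^ (-(1 / (α + d)) * (α + d / 2)) * (u n)⁻¹ := by rw [Real.rpow_one]; ring
    rw [this, ← Real.rpow_add hn', ← Real.rpow_add hn']
    have e : 1 + -((d : ℝ) / (α + d) / 2) + -(1 / (α + d)) * (α + d / 2) = 0 := by
      field_simp
      ring
    rw [e, Real.rpow_zero, one_mul]
  · have hn' : (0 : ℝ) < n := by exact_mod_cast hn
    rw [hroot n hn, hh n hn, ← Real.rpow_mul hn'.le]
    have : (n : ℝ) * (n : ℝ) ^ (-(1 / (α + d)) * ((d : ℝ) / 2)) *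
        ((n : ℝ) ^ (-((d : ℝ) / (α + d) / 2)) * (u n)⁻¹) =
        (n : ℝ) ^ (1 : ℝ) * (n : ℝ) ^ (-(1 / (α + d)) * ((d : ℝ) / 2)) *
        (n : ℝ) ^ (-((d : ℝ) / (α + d) / 2)) * (u n)⁻¹ := by rw [Real.rpow_one]; ring
    rw [this, ← Real.rpow_add hn', ← Real.rpow_add hn']
    congr 2
    field_simp
    ring

end ExplicitChoice

/-! ### Regular grids -/

section GridPartition

/-- The `i`-th of `m` consecutive intervals of length `1 / m` partitioning `[0,1]`. -/
def gridInterval (m : ℕ) (i : Fin m) : Set ℝ :=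
  {y | y ∈ Set.Icc (0 : ℝ) 1 ∧ min ⌊m * y⌋₊ (m - 1) = i}

/-- The partition of the unit cube into `m ^ d` congruent cubes. -/
def gridCell (d m : ℕ) (r : Fin (m ^ d)) : Set (EuclideanSpace ℝ (Fin d)) :=
  {x | ∀ j, x j ∈ gridInterval m (finFunctionFinEquiv.symm r j)}

/-- The interval is a level set of a monotone function on `[0, 1]`. -/
lemma ordConnected_gridInterval {m : ℕ} (i : Fin m) : (gridInterval m i).OrdConnected := by
  have hmono : Monotone fun y : ℝ => min ⌊m * y⌋₊ (m - 1) := by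
    intro y z hyz
    dsimp only
    gcongr
  refine ⟨fun y hy z hz w hw => ⟨⟨hy.1.1.trans hw.1, hw.2.trans hz.1.2⟩, ?_⟩⟩
  have h1 := hmono hw.1
  have h2 := hmono hw.2
  have h3 := hy.2
  have h4 := hz.2
  dsimp only at h1 h2
  omega

/-- The set lies between the open and the closed interval from `i/m` to `(i+1)/m`, so the endpoint
conventions do not affect its length. -/
lemma volume_gridInterval {m : ℕ} (i : Fin m) :
    volume (gridInterval m i) = ENNReal.ofReal (1 / m) := by
  have hm : (0 : ℝ) < m := by exact_mod_cast i.pos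
  have hi := i.isLt
  have hlen : ((i : ℝ) + 1) / m - i / m = 1 / m := by ring
  refine le_antisymm ?_ ?_
  · rw [← hlen, ← Real.volume_Icc]
    refine measure_mono fun y hy => ?_
    obtain ⟨⟨h0, h1⟩, h2⟩ := hy
    have hmy : 0 ≤ m * y := by positivity
    have hfl := Nat.floor_le hmy
    have hlt := Nat.lt_floor_add_one (m * y)
    constructor
    · rw [div_le_iff₀ hm]
      have : (i : ℕ) ≤ ⌊m * y⌋₊ := by omega
      have : ((i : ℕ) : ℝ) ≤ ⌊m * y⌋₊ := by exact_mod_cast this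
      linarith
    · rw [le_div_iff₀ hm]
      by_cases hc : ⌊m * y⌋₊ ≤ m - 1
      · have : ⌊m * y⌋₊ = i := by omega
        rw [this] at hlt
        linarith
      -- The truncation by `m - 1` acts only at `y = 1`, which goes into the last interval.
      · have : (i : ℕ) + 1 = m := by omega
        have : ((i : ℕ) : ℝ) + 1 = m := by exact_mod_cast this
        nlinarith
  · rw [← hlen, ← Real.volume_Ioo]
    refine measure_mono fun y hy => ?_
    obtain ⟨h1, h2⟩ := hy
    rw [div_lt_iff₀ hm] at h1
    rw [lt_div_iff₀ hm] at h2
    have hi' : ((i : ℕ) : ℝ) + 1 ≤ m := by exact_mod_cast hi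
    have hi0 : (0 : ℝ) ≤ (i : ℕ) := by positivity
    have hy0 : 0 < y := by
      by_contra hc
      nlinarith
    refine ⟨⟨hy0.le, ?_⟩, ?_⟩
    · by_contra hc
      nlinarith
    · have : ⌊m * y⌋₊ = i := by
        rw [Nat.floor_eq_iff (by positivity)]
        constructor <;> linarith
      omega

lemma isCubePartition_gridCell {d m : ℕ} (hd : 0 < d) (hm : 0 < m) :
    IsCubePartition d (m ^ d) (gridCell d m) := by
  have hm' : (0 : ℝ) < m := by exact_mod_cast hm
  refine ⟨fun r => ⟨fun j => gridInterval m (finFunctionFinEquiv.symm r j), fun j =>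
    ⟨ordConnected_gridInterval _, ?_⟩, rfl⟩, fun r s hrs => ?_, ?_⟩
  · rw [volume_gridInterval]
    congr 1
    push_cast
    rw [← Real.rpow_natCast, ← Real.rpow_mul hm'.le]
    have : (d : ℝ) * -(1 / d) = -1 := by field_simp
    rw [this, Real.rpow_neg_one, one_div]
  · refine Set.disjoint_left.mpr fun x hx hx' => ?_
    refine hrs (finFunctionFinEquiv.symm.injective (funext fun j => Fin.ext ?_))
    exact (hx j).2.symm.trans (hx' j).2
  · ext x
    simp only [Set.mem_iUnion]
    constructor
    · rintro ⟨r, hr⟩ j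
      exact (hr j).1
    · intro hx
      refine ⟨finFunctionFinEquiv fun j => ⟨min ⌊m * x j⌋₊ (m - 1), by omega⟩, fun j => ?_⟩
      exact ⟨hx j, by simp⟩

end GridPartition

/-! ### Slowly growing sequences -/

section SlowGrowth

/-- Below every sequence tending to infinity there is, after any change of scale `F`, a monotone
sequence of integers tending to infinity. -/
lemma exists_monotone_tendsto_atTop_le (F : ℕ → ℝ) {b : ℕ → ℝ} (hb : Tendsto b atTop atTop) :
    ∃ s : ℕ → ℕ, Monotone s ∧ Tendsto s atTop atTop ∧ ∀ᶠ n in atTop, F (s n) ≤ b n := by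
  classical
  -- `p n j` bounds `F j` by the whole tail of `b` from `n` on, so it persists as `n` grows; this
  -- makes the greatest admissible `j ≤ n` monotone in `n`.
  set p : ℕ → ℕ → Prop := fun n j => ∀ l, n ≤ l → F j ≤ b l with hp
  refine ⟨fun n => Nat.findGreatest (p n) n, fun n n' hn => ?_, ?_, ?_⟩
  · dsimp only
    refine (Nat.findGreatest_mono_left (fun j hj l hl => hj l (hn.trans hl)) n).trans ?_
    exact Nat.findGreatest_mono_right _ hn
  · refine tendsto_atTop.mpr fun j => ?_
    have := hb.eventually_ge_atTop (F j)
    obtain ⟨n₀, hn₀⟩ := eventually_atTop.mp this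
    filter_upwards [eventually_ge_atTop n₀, eventually_ge_atTop j] with n h1 h2
    exact Nat.le_findGreatest h2 fun l hl => hn₀ l (h1.trans hl)
  · obtain ⟨n₀, hn₀⟩ := eventually_atTop.mp (hb.eventually_ge_atTop (F 0))
    filter_upwards [eventually_ge_atTop n₀] with n hn
    have : p n (Nat.findGreatest (p n) n) :=
      Nat.findGreatest_spec (P := p n) (Nat.zero_le n) fun l hl => hn₀ l (hn.trans hl)
    exact this n le_rfl

lemma tendsto_log_sq_mul_rpow_neg {r : ℝ} (hr : 0 < r) :
    Tendsto (fun n : ℕ => Real.log n ^ 2 * (n : ℝ) ^ (-r)) atTop (𝓝 0) := by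
  have h := (isLittleO_log_rpow_rpow_atTop 2 hr).tendsto_div_nhds_zero.comp
    tendsto_natCast_atTop_atTop
  refine h.congr fun n => ?_
  simp only [Function.comp_apply]
  rw [Real.rpow_neg (by positivity), Real.rpow_two]
  rfl

/-- Grids whose number of cells exceeds `n ^ (d / (α + d))` by a factor growing as slowly as one
likes. -/
theorem exists_slow_cubePartitions {d : ℕ} (hd : 0 < d) {α : ℝ} (hα : 0 < α) (a : ℕ → ℝ)
    (ha : Tendsto a atTop atTop) :
    ∃ (u : ℕ → ℝ) (k : ℕ → ℕ) (I : ∀ n, Fin (k n) → Set (EuclideanSpace ℝ (Fin d))),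
      (∀ n, 1 ≤ n → 0 < u n) ∧
      Tendsto u atTop atTop ∧
      (∀ᶠ n in atTop, u n ≤ a n) ∧
      Tendsto (fun n : ℕ => u n ^ 2 * Real.log n * (n : ℝ) ^ (-(α / (α + d)))) atTop (𝓝 0) ∧
      Monotone k ∧
      (∀ n : ℕ, 1 ≤ n → (k n : ℝ) = (n : ℝ) ^ ((d : ℝ) / (α + d)) * u n ^ 2) ∧
      ∀ n, 1 ≤ n → IsCubePartition d (k n) (I n) := by
  have he : 0 < α + d := by positivity
  have hlog : Tendsto (fun n : ℕ => Real.log n) atTop atTop :=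
    Real.tendsto_log_atTop.comp tendsto_natCast_atTop_atTop
  -- `(2(s+1))^d` will bound `u²`; keeping it below both `a n` and `log n` gives the slow growth and
  -- the logarithmic condition at once.
  obtain ⟨s, hsmono, hslim, hsle⟩ := exists_monotone_tendsto_atTop_le
    (fun j => (2 * ((j : ℝ) + 1)) ^ d) (b := fun n => min (a n) (Real.log n))
    (tendsto_atTop.mpr fun c => by
      filter_upwards [ha.eventually_ge_atTop c, hlog.eventually_ge_atTop c] with n h1 h2
      exact le_min h1 h2)
  set g : ℕ → ℝ := fun n => (n : ℝ) ^ (1 / (α + d)) with hg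
  -- The number of cells per side must be an integer, so `u` is defined afterwards from `m`.
  -- Rounding up at most doubles `m`, because `g n * (s n + 1) ≥ 1`, hence `(s+1)^d ≤ u² ≤
  -- (2(s+1))^d`.
  set m : ℕ → ℕ := fun n => ⌈g n * ((s n : ℝ) + 1)⌉₊ with hm
  set u : ℕ → ℝ := fun n => √((m n : ℝ) ^ d / (n : ℝ) ^ ((d : ℝ) / (α + d))) with hu
  have hg1 : ∀ n, 1 ≤ n → 1 ≤ g n := fun n hn =>
    Real.one_le_rpow (by exact_mod_cast hn) (by positivity)
  have hgd : ∀ n : ℕ, g n ^ d = (n : ℝ) ^ ((d : ℝ) / (α + d)) := by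
    intro n
    simp only [hg]
    rw [← Real.rpow_natCast, ← Real.rpow_mul (by positivity)]
    congr 1
    ring
  have hmpos : ∀ n, 1 ≤ n → 0 < m n := fun n hn => by
    have := hg1 n hn
    exact Nat.ceil_pos.mpr (by positivity)
  have husq : ∀ n : ℕ, 1 ≤ n → u n ^ 2 = (m n : ℝ) ^ d / (n : ℝ) ^ ((d : ℝ) / (α + d)) :=
    fun n hn => Real.sq_sqrt (by positivity)
  have hupos : ∀ n, 1 ≤ n → 0 < u n := fun n hn => by
    have h1 : (0 : ℝ) < m n := by exact_mod_cast hmpos n hn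
    have h2 : (0 : ℝ) < n := by exact_mod_cast hn
    exact Real.sqrt_pos.mpr (by positivity)
  have hlow : ∀ n, 1 ≤ n → ((s n : ℝ) + 1) ^ d ≤ u n ^ 2 := by
    intro n hn
    have h2 : (0 : ℝ) < n := by exact_mod_cast hn
    rw [husq n hn, le_div_iff₀ (by positivity), ← hgd, ← mul_pow, mul_comm]
    have := hg1 n hn
    exact pow_le_pow_left₀ (by positivity) (Nat.le_ceil _) d
  have hupp : ∀ n, 1 ≤ n → u n ^ 2 ≤ (2 * ((s n : ℝ) + 1)) ^ d := by
    intro n hn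
    have h2 : (0 : ℝ) < n := by exact_mod_cast hn
    rw [husq n hn, div_le_iff₀ (by positivity), ← hgd, ← mul_pow]
    have h1 := hg1 n hn
    have h3 : (0 : ℝ) ≤ s n := by positivity
    have h4 := (Nat.ceil_lt_add_one (show 0 ≤ g n * ((s n : ℝ) + 1) by positivity)).le
    refine pow_le_pow_left₀ (by positivity) ?_ d
    have h5 : 1 ≤ g n * ((s n : ℝ) + 1) := by nlinarith
    calc (m n : ℝ) ≤ g n * ((s n : ℝ) + 1) + 1 := h4
      _ ≤ 2 * ((s n : ℝ) + 1) * g n := by linarith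
  have hmonom : Monotone m := by
    intro n n' hn
    refine Nat.ceil_mono ?_
    have h1 : (s n : ℝ) ≤ s n' := by exact_mod_cast hsmono hn
    have h2 : g n ≤ g n' :=
      Real.rpow_le_rpow (by positivity) (by exact_mod_cast hn) (by positivity)
    have h3 : 0 ≤ g n' := by positivity
    gcongr
  refine ⟨u, fun n => m n ^ d, fun n => gridCell d (m n), hupos, ?_, ?_, ?_, ?_, ?_, ?_⟩
  · refine tendsto_atTop_mono' _ ?_ (Real.tendsto_sqrt_atTop.comp
      (tendsto_natCast_atTop_atTop.comp hslim))
    filter_upwards [eventually_ge_atTop 1] with n hn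
    refine Real.sqrt_le_sqrt ?_
    rw [← husq n hn]
    refine le_trans ?_ (hlow n hn)
    have h3 : (0 : ℝ) ≤ s n := by positivity
    calc (s n : ℝ) ≤ s n + 1 := by linarith
      _ ≤ ((s n : ℝ) + 1) ^ d := le_self_pow₀ (by linarith) hd.ne'
  · filter_upwards [eventually_ge_atTop 1, hsle, ha.eventually_ge_atTop 1] with n hn h1 h2
    have h3 := (hupp n hn).trans (h1.trans (min_le_left _ _))
    have h4 := hupos n hn
    nlinarith
  · refine squeeze_zero' ?_ ?_ (tendsto_log_sq_mul_rpow_neg (r := α / (α + d)) (by positivity))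
    · filter_upwards [eventually_ge_atTop 1] with n hn
      have : 0 ≤ Real.log n := Real.log_natCast_nonneg n
      positivity
    · filter_upwards [eventually_ge_atTop 1, hsle] with n hn h1
      have h3 := (hupp n hn).trans (h1.trans (min_le_right _ _))
      have : 0 ≤ Real.log n := Real.log_natCast_nonneg n
      rw [sq (Real.log n)]
      gcongr
  · intro n n' hn
    exact Nat.pow_le_pow_left (hmonom hn) d
  · intro n hn
    have h2 : (0 : ℝ) < n := by exact_mod_cast hn
    rw [husq n hn]
    push_cast
    field_simp
  · intro n hn
    exact isCubePartition_gridCell hd (hmpos n hn)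

end SlowGrowth

theorem corollary2 (d : ℕ) (hd : 0 < d) (α : ℝ≥0) (hα : 0 < α) (hα1 : α ≤ 1) :
    (∀ (K : EuclideanSpace ℝ (Fin d) → ℝ), IsLipschitzParzenKernel K →
      ∀ (f : EuclideanSpace ℝ (Fin d) → ℝ), (∃ L : ℝ≥0, HolderOnWith L α f (unitCube d)) →
      (∀ x ∈ unitCube d, 0 < f x) →
      ∀ (c : ℝ), 0 < c →
      ∀ (Ω : ℕ → Type*) [∀ n, MeasurableSpace (Ω n)] (P : ∀ n, Measure (Ω n))
        [∀ n, IsProbabilityMeasure (P n)]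
        (N : ∀ n, Ω n → Multiset (EuclideanSpace ℝ (Fin d) × ℝ)),
      (∀ n : ℕ, 1 ≤ n →
        IsPoissonPointProcess (P n) (N n) (hypographIntensity ((n : ℝ) * c) f)) →
      -- asymptotic normality under the three conditions on `k` and `h`
      (∀ (k : ℕ → ℕ) (h : ℕ → ℝ) (I : ∀ n, Fin (k n) → Set (EuclideanSpace ℝ (Fin d))),
        (∀ n, 1 ≤ n → IsCubePartition d (k n) (I n)) →
        (∀ n, 1 ≤ n → 0 < h n) →
        Tendsto h atTop (𝓝 0) →
        Tendsto (fun n : ℕ => (k n : ℝ) * Real.log n / n) atTop (𝓝 0) →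
        Tendsto (fun n : ℕ => h n ^ d * (k n : ℝ)) atTop atTop →
        Tendsto (fun n : ℕ => (n : ℝ) * (k n : ℝ) ^ (-(1 / 2 : ℝ)) *
          h n ^ ((α : ℝ) + (d : ℝ) / 2)) atTop (𝓝 0) →
        ∀ (p : ℕ) (x : Fin p → EuclideanSpace ℝ (Fin d)), Function.Injective x →
        (∀ j i, x j i ∈ Set.Ioo (0 : ℝ) 1) →
        TendstoInDistribution
          (fun (n : ℕ) (ω : Ω n) => WithLp.toLp 2 fun j : Fin p =>
            ((n : ℝ) * h n ^ ((d : ℝ) / 2) * (k n : ℝ) ^ (-(1 / 2 : ℝ))) * c *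
              (kernelEstimate (rescaledKernel K (h n)) (I n) f (N n ω) (x j) - f (x j)))
          atTop id P
          (multivariateGaussian 0 ((∫ u, K u ^ 2) • (1 : Matrix (Fin p) (Fin p) ℝ)))) ∧
      -- asymptotic normality with rate `n^{α/(α+d)} / u n` for the explicit choice of `h` and `k`
      (∀ (u : ℕ → ℝ) (k : ℕ → ℕ) (I : ∀ n, Fin (k n) → Set (EuclideanSpace ℝ (Fin d))),
        (∀ n, 1 ≤ n → IsCubePartition d (k n) (I n)) →
        Tendsto u atTop atTop →
        Tendsto (fun n : ℕ => u n ^ 2 * Real.log n * (n : ℝ) ^ (-((α : ℝ) / (α + d))))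
          atTop (𝓝 0) →
        (∀ n : ℕ, 1 ≤ n → (k n : ℝ) = (n : ℝ) ^ ((d : ℝ) / (α + d)) * u n ^ 2) →
        ∀ (p : ℕ) (x : Fin p → EuclideanSpace ℝ (Fin d)), Function.Injective x →
        (∀ j i, x j i ∈ Set.Ioo (0 : ℝ) 1) →
        TendstoInDistribution
          (fun (n : ℕ) (ω : Ω n) => WithLp.toLp 2 fun j : Fin p =>
            ((n : ℝ) ^ ((α : ℝ) / (α + d)) * (u n)⁻¹) * c *
              (kernelEstimate (rescaledKernel K ((n : ℝ) ^ (-(1 / ((α : ℝ) + d))))) (I n) f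
                (N n ω) (x j) - f (x j)))
          atTop id P
          (multivariateGaussian 0 ((∫ u, K u ^ 2) • (1 : Matrix (Fin p) (Fin p) ℝ))))) ∧
    -- the explicit choice satisfies the conditions on `k` and `h` and yields the announced normalization
    (∀ (u : ℕ → ℝ) (k : ℕ → ℕ) (h : ℕ → ℝ),
      (∀ n, 1 ≤ n → 0 < u n) →
      Tendsto u atTop atTop →
      Tendsto (fun n : ℕ => u n ^ 2 * Real.log n * (n : ℝ) ^ (-((α : ℝ) / (α + d))))
        atTop (𝓝 0) →
      (∀ n : ℕ, 1 ≤ n → (k n : ℝ) = (n : ℝ) ^ ((d : ℝ) / (α + d)) * u n ^ 2) →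
      (∀ n : ℕ, 1 ≤ n → h n = (n : ℝ) ^ (-(1 / ((α : ℝ) + d)))) →
      Tendsto h atTop (𝓝 0) ∧
      Tendsto (fun n : ℕ => (k n : ℝ) * Real.log n / n) atTop (𝓝 0) ∧
      Tendsto (fun n : ℕ => h n ^ d * (k n : ℝ)) atTop atTop ∧
      Tendsto (fun n : ℕ => (n : ℝ) * (k n : ℝ) ^ (-(1 / 2 : ℝ)) *
        h n ^ ((α : ℝ) + (d : ℝ) / 2)) atTop (𝓝 0) ∧
      ∀ n : ℕ, 1 ≤ n →
        (n : ℝ) * h n ^ ((d : ℝ) / 2) * (k n : ℝ) ^ (-(1 / 2 : ℝ)) =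
          (n : ℝ) ^ ((α : ℝ) / (α + d)) * (u n)⁻¹) ∧
    -- such choices, with actual partitions, exist with `u` tending to infinity arbitrarily slowly
    (∀ a : ℕ → ℝ, Tendsto a atTop atTop →
      ∃ (u : ℕ → ℝ) (k : ℕ → ℕ) (I : ∀ n, Fin (k n) → Set (EuclideanSpace ℝ (Fin d))),
        (∀ n, 1 ≤ n → 0 < u n) ∧
        Tendsto u atTop atTop ∧
        (∀ᶠ n in atTop, u n ≤ a n) ∧
        Tendsto (fun n : ℕ => u n ^ 2 * Real.log n * (n : ℝ) ^ (-((α : ℝ) / (α + d))))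
          atTop (𝓝 0) ∧
        Monotone k ∧
        (∀ n : ℕ, 1 ≤ n → (k n : ℝ) = (n : ℝ) ^ ((d : ℝ) / (α + d)) * u n ^ 2) ∧
        ∀ n, 1 ≤ n → IsCubePartition d (k n) (I n)) := by
  refine ⟨?_, ?_, ?_⟩
  · rintro K hK f ⟨C, hf⟩ hfpos c hc Ω _ P _ N hN
    refine ⟨?_, ?_⟩
    · intro k h I hI hh hh0 hcard hwin hbias p x hxinj hx
      have H : IsSmoothingRegime d α k h :=
        ⟨fun n hn => (hI n hn).card_pos, hh, hh0, hcard, hwin, hbias⟩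
      exact tendstoInDistribution_kernelEstimate H hd hα hK hf hfpos hc hN hI hxinj hx (by simp)
        (Eventually.of_forall fun n => rfl) (Eventually.of_forall fun n => rfl)
    · intro u k I hI hulim hulog hk p x hxinj hx
      have hα' : (0 : ℝ) < α := by exact_mod_cast hα
      -- The sign of `u` at small `n` is not prescribed. It is nonzero since `k n > 0`, only `u²`
      -- enters the hypotheses, and `|u| = u` eventually.
      have hu0 : ∀ n, 1 ≤ n → 0 < |u n| := by
        intro n hn
        refine abs_pos.mpr fun h0 => ?_
        have h1 := hk n hn
        rw [h0] at h1
        have h2 := (hI n hn).card_pos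
        simp at h1
        omega
      obtain ⟨H, hrate⟩ := isSmoothingRegime_of_eq (d := d) (α := α) (u := fun n => |u n|)
        (k := k) (h := fun n => (n : ℝ) ^ (-(1 / ((α : ℝ) + d)))) hα' hu0
        (tendsto_abs_atTop_atTop.comp hulim) (by simpa only [sq_abs] using hulog)
        (by simpa only [sq_abs] using hk) (fun n _ => rfl)
      have hexp : (α : ℝ) / (α + d) ≠ 0 := by positivity
      refine tendstoInDistribution_kernelEstimate H hd hα hK hf hfpos hc hN hI hxinj hx
        (by simp [Real.zero_rpow hexp]) ?_ (Eventually.of_forall fun n => rfl)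
      filter_upwards [eventually_ge_atTop 1, hulim.eventually_gt_atTop 0] with n hn hun
      rw [hrate n hn, abs_of_pos hun]
  · intro u k h hu hulim hulog hk hh
    have hα' : (0 : ℝ) < α := by exact_mod_cast hα
    obtain ⟨H, hrate⟩ := isSmoothingRegime_of_eq hα' hu hulim hulog hk hh
    exact ⟨H.bandwidth, H.card, H.window, H.bias, hrate⟩
  · intro a ha
    exact exists_slow_cubePartitions hd (by exact_mod_cast hα) a ha
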